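/- Let $k$ be a commutative ring and let $\mathcal{H}$ be a Hopf algebroid with invertible antipode over $k$ (in the sense of Böhm–Szlachányi): a $k$-algebra $\mathcal{H}$ carrying a left bialgebroid structure $(A_l,s_l,t_l,\Delta_l,\epsilon_l)$ and a right bialgebroid structure $(A_r,s_r,t_r,\Delta_r,\epsilon_r)$ over $k$-algebras $A_l,A_r$, and a bijective $k$-linear antipode $S:\mathcal{H}\to\mathcal{H}$, such that $s_l\epsilon_lt_r=t_r$, $t_l\epsilon_ls_r=s_r$, $s_r\epsilon_rt_l=t_l$, $t_r\epsilon_rs_l=s_l$; $(\Delta_l\otimes\mathrm{id})\Delta_r=(\mathrm{id}\otimes\Delta_r)\Delta_l$ and $(\Delta_r\otimes\mathrm{id})\Delta_l=(\mathrm{id}\otimes\Delta_l)\Delta_r$; $S(t_l(a)\,h\,t_r(b))=s_r(b)\,S(h)\,s_l(a)$; and $\mu(S\otimes\mathrm{id})\Delta_l=s_r\epsilon_r$, $\mu(\mathrm{id}\otimes S)\Delta_r=s_l\epsilon_l$. *Cohomology.* Regard $\mathcal{H}$ as an $A_l$-bimodule by $a_1\cdot h\cdot a_2=s_l(a_1)t_l(a_2)h$.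 Let $C^0(\mathcal{H})=A_l$, $C^n(\mathcal{H})=\mathcal{H}^{\otimes_{A_l}n}$ for $n\ge1$, and $b=\sum_{i=0}^{n+1}(-1)^i\delta_i:C^n(\mathcal{H})\to C^{n+1}(\mathcal{H})$, where $\delta_0=t_l$, $\delta_1=s_l$ for $n=0$, and for $n\ge1$ $$\delta_0(x)=1\otimes x,\qquad \delta_i(h^1\otimes\cdots\otimes h^n)=h^1\otimes\cdots\otimes\Delta_lh^i\otimes\cdots\otimes h^n\ (1\le i\le n),\qquad \delta_{n+1}(x)=x\otimes1 .$$ Let $HH^n(\mathcal{H})=H^n(C^\bullet(\mathcal{H}),b)$. The cobar complex $\mathrm{Cobar}^n(\mathcal{H})=\mathcal{H}^{\otimes_{A_l}(n+1)}$, with differential $b'=\sum_{i=0}^{n+1}(-1)^i\delta'_i$, where $\delta'_i$ applies $\Delta_l$ to the factor $h^i$ for $0\le i\le n$ and $\delta'_{n+1}(x)=x\otimes1$, is a complex of left $\mathcal{H}_l$-comodules (coaction $\Delta_l$ on the first factor), coaugmented by $s_l:A_l\to\mathrm{Cobar}^0(\mathcal{H})$. If $\mathcal{H}$ is flat as a right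 $A_l$-module via $h\cdot a=t_l(a)h$, then the category of left $\mathcal{H}_l$-comodules is abelian with enough injectives, and $\mathrm{Cotor}^n_{\mathcal{H}}(A_l,A_l)$ denotes the $n$-th right derived functor of $A_l\,\square_{\mathcal{H}_l}-$, from left $\mathcal{H}_l$-comodules to $k$-modules, at $A_l$; here $A_l$ is a right comodule by $a\mapsto1\otimes t_l(a)$ and a left comodule by $a\mapsto s_l(a)\otimes1$. *Homology.* Let $C_0(\mathcal{H})=A_r$ and, for $n\ge1$, $C_n(\mathcal{H})=\mathcal{H}^{\otimes_{A_r}n}$, formed with $h\,s_r(a)\otimes h'=h\otimes s_r(a)h'$. Let $b=\sum_{i=0}^{n}(-1)^id_i:C_n(\mathcal{H})\to C_{n-1}(\mathcal{H})$, where $d_0=\epsilon_r$, $d_1=\epsilon_rS^{-1}$ for $n=1$, and for $n\ge2$ $$d_0(h^1\otimes\cdots\otimes h^n)=s_r(\epsilon_rh^1)h^2\otimes\cdots\otimes h^n,\qquad d_i(h^1\otimes\cdots\otimes h^n)=h^1\otimes\cdots\otimes h^ih^{i+1}\otimes\cdots\otimes h^n\ (1\le i\le n-1),$$ $$d_n(h^1\otimes\cdots\otimes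 h^n)=h^1\otimes\cdots\otimes h^{n-1}s_r(\epsilon_r(S^{-1}h^n)).$$ Let $HH_n(\mathcal{H})=H_n(C_\bullet(\mathcal{H}),b)$. The bar complex $\mathrm{Bar}_n(\mathcal{H})=\mathcal{H}^{\otimes_{A_r}(n+1)}$, with differential $\sum_{i=0}^n(-1)^id'_i$, where $d'_i$ multiplies $h^i$ and $h^{i+1}$ for $0\le i\le n-1$ and $d'_n(h^0\otimes\cdots\otimes h^n)=h^0\otimes\cdots\otimes h^{n-1}s_r(\epsilon_r(S^{-1}h^n))$, is a complex of left $\mathcal{H}$-modules (multiplication on the first factor), augmented by $\epsilon_l:\mathrm{Bar}_0(\mathcal{H})\to A_l$. Here $A_l$ is the left $\mathcal{H}$-module with $h\cdot a=\epsilon_l(h\,s_l(a))$, and $A_r$ is the right $\mathcal{H}$-module with $a\cdot h=\epsilon_r(s_r(a)h)$. **Theorem.** 1. Suppose that $\mathcal{H}$ is flat as a right $A_l$-module via $h\cdot a=t_l(a)h$. Then there are canonical isomorphisms of $k$-modules $$HH^n(\mathcal{H})\cong\mathrm{Cotor}^n_{\mathcal{H}}(A_l,A_l)\qquad(n\ge0),$$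 computed with the cobar complex: for every injective resolution $A_l\to I^\bullet$ of left $\mathcal{H}_l$-comodules there is a map of complexes of comodules $g:\mathrm{Cobar}^\bullet(\mathcal{H})\to I^\bullet$ under $A_l$, and for every such $g$ the isomorphism is the map induced on cohomology by $$C^\bullet(\mathcal{H})\longrightarrow A_l\,\square_{\mathcal{H}_l}\mathrm{Cobar}^\bullet(\mathcal{H})\xrightarrow{\ \mathrm{id}\,\square\,g\ }A_l\,\square_{\mathcal{H}_l}I^\bullet,$$ where the first map is $x\mapsto1\otimes1\otimes x$ for $n\ge1$ and $a\mapsto1\otimes t_l(a)$ for $n=0$. 2. Suppose that $\mathcal{H}$ is projective as a left $A_r$-module via $a\cdot h=s_r(a)h$. Then there are canonical isomorphisms of $k$-modules $$HH_n(\mathcal{H})\cong\mathrm{Tor}^{\mathcal{H}}_n(A_r,A_l)\qquad(n\ge0),$$ computed with the bar complex: for every projective resolution $P_\bullet\to A_l$ of left $\mathcal{H}$-modules there is a map of complexes of $\mathcal{H}$-modules $g:P_\bullet\to\mathrm{Bar}_\bullet(\mathcal{H})$ over $A_l$, and for every such $g$ the inverse isomorphism is the map induced on homology by $$A_r\otimes_{\mathcal{H}}P_\bullet\xrightarrow{\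 \mathrm{id}\otimes g\ }A_r\otimes_{\mathcal{H}}\mathrm{Bar}_\bullet(\mathcal{H})\longrightarrow C_\bullet(\mathcal{H}),$$ where the second map is $a\otimes h^0\otimes h^1\otimes\cdots\otimes h^n\mapsto s_r(\epsilon_r(s_r(a)h^0))h^1\otimes\cdots\otimes h^n$ for $n\ge1$ and $a\otimes h^0\mapsto\epsilon_r(s_r(a)h^0)$ for $n=0$. -/

import Mathlib

open CategoryTheory TensorProduct MulOpposite

universe u

noncomputable section

namespace HopfAlgd

/-! ### Tensor products over a noncommutative ring -/

section Tens

variable {R M N : Type u} [Ring R] [AddCommGroup M] [AddCommGroup N]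

/-- The tensor product `M ⊗_R N` over a (noncommutative) ring `R` of a right `R`-module `M`
and a left `R`-module `N`, the actions being given explicitly: the quotient of `M ⊗_ℤ N` by the
subgroup generated by all `m·r ⊗ n - m ⊗ r·n`. -/
def Tens (ρ : Rᵐᵒᵖ →+* AddMonoid.End M) (l : R →+* AddMonoid.End N) : Type u :=
  (M ⊗[ℤ] N) ⧸ AddSubgroup.closure
    {z : M ⊗[ℤ] N | ∃ (r : R) (m : M) (n : N), z = (ρ (op r) m) ⊗ₜ[ℤ] n - m ⊗ₜ[ℤ] (l r n)}

namespace Tens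

variable (ρ : Rᵐᵒᵖ →+* AddMonoid.End M) (l : R →+* AddMonoid.End N)

instance : AddCommGroup (Tens ρ l) := by unfold Tens; infer_instance

/-- The projection `M ⊗_ℤ N → M ⊗_R N`. -/
def mk : M ⊗[ℤ] N →+ Tens ρ l := QuotientAddGroup.mk' _

variable {ρ l}

/-- The element `m ⊗ n` of `M ⊗_R N`, as a biadditive map. -/
def tmul : M →+ N →+ Tens ρ l :=
  AddMonoidHom.mk' (fun m => AddMonoidHom.mk' (fun n => mk ρ l (m ⊗ₜ[ℤ] n))
    (fun a b => by rw [TensorProduct.tmul_add, map_add]))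
    (fun a b => by ext n; simp [TensorProduct.add_tmul])

theorem mk_tmul (m : M) (n : N) : mk ρ l (m ⊗ₜ[ℤ] n) = tmul m n := rfl

theorem balanced (m : M) (r : R) (n : N) :
    (tmul (ρ (op r) m) n : Tens ρ l) = tmul m (l r n) := by
  rw [← mk_tmul, ← mk_tmul, ← sub_eq_zero, ← map_sub]
  exact (QuotientAddGroup.eq_zero_iff _).2 (AddSubgroup.subset_closure ⟨r, m, n, rfl⟩)

theorem mk_surjective : Function.Surjective (mk ρ l) := QuotientAddGroup.mk'_surjective _

theorem induction {P : Tens ρ l → Prop} (x : Tens ρ l) (h0 : P 0)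
    (ht : ∀ m n, P (tmul m n)) (ha : ∀ x y, P x → P y → P (x + y)) : P x := by
  obtain ⟨x, rfl⟩ := mk_surjective x
  induction x with
  | zero => simpa using h0
  | tmul m n => exact ht m n
  | add x y hx hy => rw [map_add]; exact ha _ _ hx hy

theorem hom_ext {P : Type*} [AddCommGroup P] {f g : Tens ρ l →+ P}
    (h : ∀ m n, f (tmul m n) = g (tmul m n)) : f = g := by
  ext x
  induction x using induction with
  | h0 => simp
  | ht m n => exact h m n
  | ha x y hx hy => rw [map_add, map_add, hx, hy]

/-- The universal property of `M ⊗_R N`. -/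
def lift {P : Type*} [AddCommGroup P] (f : M →+ N →+ P)
    (hf : ∀ m r n, f (ρ (op r) m) n = f m (l r n)) : Tens ρ l →+ P :=
  QuotientAddGroup.lift _
    (TensorProduct.liftAddHom f (fun r m n => by
      rw [map_zsmul, map_zsmul, AddMonoidHom.smul_apply]))
    ((AddSubgroup.closure_le _).2 (by
      rintro _ ⟨r, m, n, rfl⟩
      simp [hf]))

@[simp] theorem lift_tmul {P : Type*} [AddCommGroup P] (f : M →+ N →+ P)
    (hf : ∀ m r n, f (ρ (op r) m) n = f m (l r n)) (m : M) (n : N) :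
    lift f hf (tmul m n : Tens ρ l) = f m n := rfl

/-- `M ⊗_R N → M' ⊗_R N'`, `m ⊗ n ↦ f m ⊗ g n`, for `R`-linear maps `f` and `g`. -/
def map {M' N' : Type u} [AddCommGroup M'] [AddCommGroup N']
    {ρ' : Rᵐᵒᵖ →+* AddMonoid.End M'} {l' : R →+* AddMonoid.End N'}
    (f : M →+ M') (hf : ∀ r m, f (ρ (op r) m) = ρ' (op r) (f m))
    (g : N →+ N') (hg : ∀ r n, g (l r n) = l' r (g n)) : Tens ρ l →+ Tens ρ' l' :=
  lift ((AddMonoidHom.compHom.flip g).comp (tmul.comp f)) (fun m r n => by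
    simp [hf, hg, balanced])

@[simp] theorem map_tmul {M' N' : Type u} [AddCommGroup M'] [AddCommGroup N']
    {ρ' : Rᵐᵒᵖ →+* AddMonoid.End M'} {l' : R →+* AddMonoid.End N'}
    (f : M →+ M') (hf : ∀ r m, f (ρ (op r) m) = ρ' (op r) (f m))
    (g : N →+ N') (hg : ∀ r n, g (l r n) = l' r (g n)) (m : M) (n : N) :
    map f hf g hg (tmul m n : Tens ρ l) = tmul (f m) (g n) := rfl

/-- A left action on `M` which commutes with the right `R`-action induces a left action on
`M ⊗_R N`, namely `x·(m ⊗ n) = (x·m) ⊗ n`. -/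
def leftAct {L : Type u} [Ring L] (e : L →+* AddMonoid.End M)
    (he : ∀ x r m, e x (ρ r m) = ρ r (e x m)) : L →+* AddMonoid.End (Tens ρ l) where
  toFun x := map (e x) (fun r m => he x (op r) m) (AddMonoidHom.id N) (fun _ _ => rfl)
  map_one' := hom_ext fun m n => by
    change tmul (e 1 m) n = tmul m n
    rw [map_one]; rfl
  map_mul' x y := hom_ext fun m n => by
    change tmul (e (x * y) m) n = tmul (e x (e y m)) n
    rw [map_mul]; rfl
  map_zero' := hom_ext fun m n => by
    change tmul (e 0 m) n = 0
    rw [map_zero]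
    exact DFunLike.congr_fun (map_zero (tmul (ρ := ρ) (l := l))) n
  map_add' x y := hom_ext fun m n => by
    change tmul (e (x + y) m) n = tmul (e x m) n + tmul (e y m) n
    rw [map_add]
    exact DFunLike.congr_fun (map_add (tmul (ρ := ρ) (l := l)) (e x m) (e y m)) n

@[simp] theorem leftAct_tmul {L : Type u} [Ring L] (e : L →+* AddMonoid.End M)
    (he : ∀ x r m, e x (ρ r m) = ρ r (e x m)) (x : L) (m : M) (n : N) :
    leftAct e he x (tmul m n : Tens ρ l) = tmul (e x m) n := rfl

end Tens

end Tens

/-- The action map of a left `R`-module. -/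
abbrev lact (R N : Type u) [Ring R] [AddCommGroup N] [Module R N] : R →+* AddMonoid.End N :=
  Module.toAddMonoidEnd R N

/-! ### Bimodules and corings -/

/-- An `(A, A)`-bimodule structure on `M`: a left action and a right action that commute. -/
structure Bimod (A M : Type u) [Ring A] [AddCommGroup M] where
  left : A →+* AddMonoid.End M
  right : Aᵐᵒᵖ →+* AddMonoid.End M
  comm : ∀ a b m, left a (right b m) = right b (left a m)

namespace Bimod

variable {A M : Type u} [Ring A] [AddCommGroup M] (β : Bimod A M)

/-- The bimodule as a left `A`-module. -/
@[nolint unusedArguments]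
def Self (_ : Bimod A M) : Type u := M

instance : AddCommGroup β.Self := inferInstanceAs (AddCommGroup M)

instance : Module A β.Self := Module.compHom M β.left

theorem smul_self (a : A) (m : β.Self) : a • m = (β.left a (m : M) : M) := rfl

section

variable (N : Type u) [AddCommGroup N] [Module A N]

/-- The tensor product `M ⊗_A N` of the bimodule `M` with a left `A`-module `N`; it is a left
`A`-module by `a·(m ⊗ n) = (a·m) ⊗ n`. -/
def Ten : Type u := Tens β.right (lact A N)

instance : AddCommGroup (β.Ten N) := inferInstanceAs (AddCommGroup (Tens _ _))

instance : Module A (β.Ten N) :=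
  Module.compHom (Tens β.right (lact A N))
    (Tens.leftAct (ρ := β.right) (l := lact A N) β.left β.comm)

end

variable {N N' N'' : Type u} [AddCommGroup N] [Module A N] [AddCommGroup N'] [Module A N']
  [AddCommGroup N''] [Module A N'']

/-- The element `m ⊗ n`. -/
def tm : β.Self →+ N →+ β.Ten N := Tens.tmul (ρ := β.right) (l := lact A N)

theorem smul_tm (a : A) (m : β.Self) (n : N) : a • β.tm m n = β.tm (a • m) n := rfl

theorem tm_right (m : β.Self) (a : A) (n : N) :
    β.tm (β.right (op a) m : M) n = β.tm m (a • n) :=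
  Tens.balanced (ρ := β.right) (l := lact A N) m a n

theorem ten_induction {P : β.Ten N → Prop} (x : β.Ten N) (h0 : P 0)
    (ht : ∀ m n, P (β.tm m n)) (ha : ∀ x y, P x → P y → P (x + y)) : P x :=
  Tens.induction (ρ := β.right) (l := lact A N) x h0 ht ha

theorem ten_ext {P : Type*} [AddCommGroup P] [Module A P] {f g : β.Ten N →ₗ[A] P}
    (h : ∀ m n, f (β.tm m n) = g (β.tm m n)) : f = g := by
  ext x
  induction x using ten_induction with
  | h0 => simp
  | ht m n => exact h m n
  | ha x y hx hy => rw [map_add, map_add, hx, hy]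

/-- The universal property of `M ⊗_A N` for left `A`-linear maps. -/
def lift {P : Type*} [AddCommGroup P] [Module A P] (f : β.Self →ₗ[A] N →+ P)
    (hf : ∀ (m : β.Self) (a : A) (n : N), f (β.right (op a) m : M) n = f m (a • n)) :
    β.Ten N →ₗ[A] P :=
  let g : β.Ten N →+ P := Tens.lift (ρ := β.right) (l := lact A N) f.toAddMonoidHom hf
  { g with
    map_smul' := fun a x => by
      change g (a • x) = a • g x
      induction x using ten_induction with
      | h0 => rw [smul_zero, _root_.map_zero, smul_zero]
      | ht m n =>
        change (f (a • m)) n = a • (f m n)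
        rw [map_smul]; rfl
      | ha x y hx hy => rw [smul_add, _root_.map_add, _root_.map_add, smul_add, hx, hy] }

@[simp] theorem lift_tm {P : Type*} [AddCommGroup P] [Module A P] (f : β.Self →ₗ[A] N →+ P)
    (hf : ∀ (m : β.Self) (a : A) (n : N), f (β.right (op a) m : M) n = f m (a • n))
    (m : β.Self) (n : N) : β.lift f hf (β.tm m n) = f m n := rfl

/-- `id ⊗ f : M ⊗_A N → M ⊗_A N'`. -/
def map (f : N →ₗ[A] N') : β.Ten N →ₗ[A] β.Ten N' :=
  β.lift
    { toFun := fun m => (β.tm m).comp f.toAddMonoidHom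
      map_add' := fun x y => by ext n; simp
      map_smul' := fun a x => by ext n; simp [smul_tm] }
    (fun m a n => by simp [tm_right])

@[simp] theorem map_tm (f : N →ₗ[A] N') (m : β.Self) (n : N) :
    β.map f (β.tm m n) = β.tm m (f n) := rfl

theorem map_id : β.map (LinearMap.id : N →ₗ[A] N) = LinearMap.id := β.ten_ext fun _ _ => rfl

theorem map_comp (g : N' →ₗ[A] N'') (f : N →ₗ[A] N') :
    β.map (g.comp f) = (β.map g).comp (β.map f) := β.ten_ext fun _ _ => rfl

theorem map_add (f g : N →ₗ[A] N') : β.map (f + g) = β.map f + β.map g :=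
  β.ten_ext fun _ _ => by simp

/-- `M ⊗_A N` as an endofunctor of the category of left `A`-modules. -/
def functor : ModuleCat.{u} A ⥤ ModuleCat.{u} A where
  obj N := ModuleCat.of A (β.Ten N)
  map f := ModuleCat.ofHom (β.map f.hom)
  map_id N := by rw [ModuleCat.hom_id, map_id]; rfl
  map_comp f g := by rw [ModuleCat.hom_comp, map_comp]; rfl

instance : β.functor.Additive where
  map_add {_ _ f g} := by
    change ModuleCat.ofHom (β.map (f + g).hom) = _
    rw [ModuleCat.hom_add, map_add]; rfl

/-- The right action of `a`, as a left `A`-linear map. -/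
def rightLin (a : A) : β.Self →ₗ[A] β.Self where
  toFun m := (β.right (op a) (m : M) : M)
  map_add' x y := (β.right (op a)).map_add x y
  map_smul' b x := (β.comm b (op a) x).symm

/-- For `n ∈ N`, the left `A`-linear map `M → M ⊗_A N`, `m ↦ m ⊗ n`. -/
def ins (n : N) : β.Self →ₗ[A] β.Ten N where
  toFun m := β.tm m n
  map_add' x y := by simp
  map_smul' a x := rfl

@[simp] theorem ins_apply (n : N) (m : β.Self) : β.ins n m = β.tm m n := rfl

/-- For a bimodule map `f : M → M ⊗_A M`, the map `f ⊗ id : M ⊗_A N → M ⊗_A (M ⊗_A N)`. If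
`f m = ∑ mᵢ ⊗ m'ᵢ` then `m ⊗ n` is sent to `∑ mᵢ ⊗ (m'ᵢ ⊗ n)`. -/
def extend (f : β.Self →ₗ[A] β.Ten β.Self)
    (hf : ∀ (a : A) (m : β.Self), f (β.rightLin a m) = β.map (β.rightLin a) (f m)) :
    β.Ten N →ₗ[A] β.Ten (β.Ten N) :=
  β.lift
    { toFun := fun m => AddMonoidHom.mk' (fun n => β.map (β.ins n) (f m)) (fun n n' => by
        rw [← LinearMap.add_apply, ← map_add]
        congr 2
        ext m
        simp)
      map_add' := fun x y => by ext n; simp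
      map_smul' := fun a x => by ext n; simp }
    (fun m a n => by
      change β.map (β.ins n) (f (β.rightLin a m)) = β.map (β.ins (a • n)) (f m)
      rw [hf, ← LinearMap.comp_apply, ← map_comp]
      congr 2
      ext m
      exact β.tm_right m a n)

theorem extend_tm (f : β.Self →ₗ[A] β.Ten β.Self)
    (hf : ∀ (a : A) (m : β.Self), f (β.rightLin a m) = β.map (β.rightLin a) (f m))
    (m : β.Self) (n : N) : β.extend f hf (β.tm m n) = β.map (β.ins n) (f m) := rfl

/-- For a left `A`-linear map `e : M → A` with `e (m·a) = e m * a`, the map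
`e ⊗ id : M ⊗_A N → N`, `m ⊗ n ↦ e m • n`. -/
def contract (e : β.Self →ₗ[A] A) (he : ∀ (a : A) (m : β.Self), e (β.rightLin a m) = e m * a) :
    β.Ten N →ₗ[A] N :=
  β.lift
    { toFun := fun m => Module.toAddMonoidEnd A N (e m)
      map_add' := fun x y => by ext n; exact (congrArg (· • n) (e.map_add x y)).trans (add_smul _ _ _)
      map_smul' := fun a x => by
        ext n; exact (congrArg (· • n) (e.map_smul a x)).trans (mul_smul _ _ _) }
    (fun m a n => by
      change e (β.rightLin a m) • n = e m • (a • n)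
      rw [he, mul_smul])

@[simp] theorem contract_tm (e : β.Self →ₗ[A] A)
    (he : ∀ (a : A) (m : β.Self), e (β.rightLin a m) = e m * a) (m : β.Self) (n : N) :
    β.contract e he (β.tm m n) = e m • n := rfl

/-- For a left `A`-linear map `e : M → A`, the map `id ⊗ e : M ⊗_A M → M`,
`m ⊗ m' ↦ m·e m'`. -/
def contractRight (e : β.Self →ₗ[A] A) : β.Ten β.Self →ₗ[A] β.Self :=
  β.lift
    { toFun := fun m => AddMonoidHom.mk' (fun m' => (β.right (op (e m')) (m : M) : M))
        (fun x y => by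
          have h : β.right (op (e (x + y))) = β.right (op (e x)) + β.right (op (e y)) := by
            rw [_root_.map_add, MulOpposite.op_add, _root_.map_add]
          exact DFunLike.congr_fun h (m : M))
      map_add' := fun x y => by ext n; exact (β.right (op (e n))).map_add x y
      map_smul' := fun a x => by ext n; exact (β.comm a (op (e n)) x).symm }
    (fun m a n => by
      change β.right (op (e n)) (β.right (op a) m) = β.right (op (e (a • n))) m
      rw [map_smul, smul_eq_mul, op_mul, map_mul]; rfl)

@[simp] theorem contractRight_tm (e : β.Self →ₗ[A] A) (m m' : β.Self) :
    β.contractRight e (β.tm m m') = β.rightLin (e m') m := rfl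

/-- `M` is flat as a right `A`-module: tensoring with `M` preserves exact sequences of left
`A`-modules. -/
class IsFlat : Prop where
  exact : ∀ {X Y Z : Type u} [AddCommGroup X] [AddCommGroup Y] [AddCommGroup Z]
    [Module A X] [Module A Y] [Module A Z] (f : X →ₗ[A] Y) (g : Y →ₗ[A] Z),
    Function.Exact f g → Function.Exact (β.map f) (β.map g)

end Bimod

/-- An `A`-coalgebra (a comonoid in the monoidal category of `(A, A)`-bimodules) structure on a
bimodule. -/
structure Coring {A M : Type u} [Ring A] [AddCommGroup M] (β : Bimod A M) where
  /-- the coproduct `M → M ⊗_A M`, left `A`-linear -/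
  comul : β.Self →ₗ[A] β.Ten β.Self
  /-- the coproduct is right `A`-linear -/
  comul_right : ∀ (a : A) (m : β.Self),
    comul (β.rightLin a m) = β.map (β.rightLin a) (comul m)
  /-- the counit `M → A`, left `A`-linear -/
  counit : β.Self →ₗ[A] A
  /-- the counit is right `A`-linear -/
  counit_right : ∀ (a : A) (m : β.Self), counit (β.rightLin a m) = counit m * a
  /-- `(id ⊗ Δ) Δ = (Δ ⊗ id) Δ` -/
  coassoc : ∀ m, β.map comul (comul m) = β.extend comul comul_right (comul m)
  /-- `(ε ⊗ id) Δ = id` -/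
  counit_comul : ∀ m, β.contract counit counit_right (comul m) = m
  /-- `(id ⊗ ε) Δ = id` -/
  comul_counit : ∀ m, β.contractRight counit (comul m) = m

namespace Coring

variable {A M : Type u} [Ring A] [AddCommGroup M] {β : Bimod A M} (C : Coring β)

variable {N N' : Type u} [AddCommGroup N] [Module A N] [AddCommGroup N'] [Module A N']

variable (N) in
/-- `Δ ⊗ id : M ⊗_A N → M ⊗_A (M ⊗_A N)`. -/
def ext : β.Ten N →ₗ[A] β.Ten (β.Ten N) := β.extend C.comul C.comul_right

variable (N) in
/-- `ε ⊗ id : M ⊗_A N → N`. -/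
def ctr : β.Ten N →ₗ[A] N := β.contract C.counit C.counit_right

theorem ext_tm (m : β.Self) (n : N) : C.ext N (β.tm m n) = β.map (β.ins n) (C.comul m) := rfl

theorem ctr_tm (m : β.Self) (n : N) : C.ctr N (β.tm m n) = C.counit m • n := rfl

theorem ext_naturality (f : N →ₗ[A] N') :
    (C.ext N').comp (β.map f) = (β.map (β.map f)).comp (C.ext N) :=
  β.ten_ext fun m n => by
    simp only [LinearMap.comp_apply, Bimod.map_tm, ext_tm]
    rw [← LinearMap.comp_apply (f := β.map (β.map f)), ← β.map_comp]
    rfl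

theorem ctr_naturality (f : N →ₗ[A] N') : (C.ctr N').comp (β.map f) = f.comp (C.ctr N) :=
  β.ten_ext fun m n => by simp [ctr_tm]

theorem ext_coassoc : (β.map (C.ext N)).comp (C.ext N) = (C.ext (β.Ten N)).comp (C.ext N) :=
  β.ten_ext fun m n => by
    have h1 : (C.ext N).comp (β.ins n) = (β.map (β.ins n)).comp C.comul := rfl
    have h2 := LinearMap.congr_fun (C.ext_naturality (β.ins n)) (C.comul m)
    simp only [LinearMap.comp_apply] at h2
    rw [LinearMap.comp_apply, LinearMap.comp_apply, ext_tm, h2,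
      ← LinearMap.comp_apply (f := β.map (C.ext N)), ← β.map_comp, h1, β.map_comp,
      LinearMap.comp_apply, C.coassoc]
    rfl

theorem ctr_ext : (C.ctr (β.Ten N)).comp (C.ext N) = LinearMap.id :=
  β.ten_ext fun m n => by
    have h2 := LinearMap.congr_fun (C.ctr_naturality (β.ins n)) (C.comul m)
    simp only [LinearMap.comp_apply] at h2
    rw [LinearMap.comp_apply, ext_tm, h2]
    exact congrArg (β.ins n) (C.counit_comul m)

theorem map_ctr_ext : (β.map (C.ctr N)).comp (C.ext N) = LinearMap.id :=
  β.ten_ext fun m n => by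
    have h : ∀ x : β.Ten β.Self,
        β.map (C.ctr N) (β.map (β.ins n) x) = β.tm (β.contractRight C.counit x) n := by
      intro x
      induction x using Bimod.ten_induction with
      | h0 => simp
      | ht a b => exact (β.tm_right a (C.counit b) n).symm
      | ha x y hx hy => simp only [map_add, AddMonoidHom.add_apply, hx, hy]
    rw [LinearMap.comp_apply, ext_tm, h, C.comul_counit]
    rfl

/-- The comonad `M ⊗_A -` on left `A`-modules defined by the `A`-coalgebra `M`. -/
def comonad : Comonad (ModuleCat.{u} A) where
  toFunctor := β.functor
  ε := { app := fun N => ModuleCat.ofHom (C.ctr N)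
         naturality := fun _ _ f => by
          ext1; exact C.ctr_naturality f.hom }
  δ := { app := fun N => ModuleCat.ofHom (C.ext N)
         naturality := fun _ _ f => by
          ext1; exact C.ext_naturality f.hom }
  coassoc N := by ext1; exact C.ext_coassoc
  left_counit N := by ext1; exact C.ctr_ext
  right_counit N := by ext1; exact C.map_ctr_ext

/-- The category of left comodules over the `A`-coalgebra `M`: left `A`-modules `N` with a
left `A`-linear coaction `N → M ⊗_A N` which is coassociative and counital, that is, coalgebras
over the comonad `M ⊗_A -`. -/
abbrev Comod : Type (u + 1) := C.comonad.Coalgebra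

instance : (C.comonad.toFunctor).Additive := inferInstanceAs β.functor.Additive

/-- If `M` is flat as a right `A`-module then the functor `M ⊗_A -` is left exact. -/
instance preservesFiniteLimits [hM : β.IsFlat] :
    Limits.PreservesFiniteLimits C.comonad.toFunctor := by
  refine (((Functor.exact_tfae C.comonad.toFunctor).out 1 3 :).1 ?_).1
  intro S hS
  rw [ShortComplex.ShortExact.moduleCat_exact_iff_function_exact] at hS ⊢
  exact hM.exact _ _ hS

open Limits in
instance abelian [β.IsFlat] : Abelian C.Comod :=
  have : HasFiniteLimits C.Comod := ⟨fun _ _ _ =>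
    hasLimitsOfShape_of_hasLimitsOfShape_createsLimitsOfShape C.comonad.forget⟩
  have : HasFiniteColimits C.Comod := ⟨fun _ _ _ =>
    hasColimitsOfShape_of_hasColimitsOfShape_createsColimitsOfShape C.comonad.forget⟩
  have : PreservesFiniteLimits C.comonad.forget := ⟨fun _ _ _ => inferInstance⟩
  have : ∀ {X Y : C.Comod} (f : X ⟶ Y), IsIso (Abelian.coimageImageComparison f) := by
    intro X Y f
    have : IsIso (C.comonad.forget.map (Abelian.coimageImageComparison f)) := by
      rw [Arrow.isIso_iff_isIso_of_isIso
        (Abelian.PreservesCoimageImageComparison.iso C.comonad.forget f).hom]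
      infer_instance
    exact isIso_of_reflects_iso _ C.comonad.forget
  Abelian.ofCoimageImageComparisonIsIso

instance [β.IsFlat] : EnoughInjectives C.Comod :=
  have : Limits.PreservesFiniteLimits C.comonad.forget := ⟨fun _ _ _ => inferInstance⟩
  EnoughInjectives.of_adjunction C.comonad.adj

end Coring

/-! ### Right modules, right comodules and the cotensor product -/

/-- A right `R`-module structure on the `k`-module `M`, for a `k`-algebra `R`. -/
structure RMod (k R M : Type u) [CommRing k] [Ring R] [Algebra k R] [AddCommGroup M]
    [Module k M] where
  act : Rᵐᵒᵖ →+* AddMonoid.End M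
  act_algebraMap : ∀ (c : k) (m : M), act (op (algebraMap k R c)) m = c • m

namespace RMod

variable {k R M : Type u} [CommRing k] [Ring R] [Algebra k R] [AddCommGroup M] [Module k M]
  (P : RMod k R M)

theorem smul_act (c : k) (r : Rᵐᵒᵖ) (m : M) : c • P.act r m = P.act r (c • m) := by
  rw [← P.act_algebraMap, ← P.act_algebraMap]
  have h : P.act (op (algebraMap k R c)) * P.act r = P.act r * P.act (op (algebraMap k R c)) := by
    rw [← map_mul, ← map_mul]
    congr 1
    apply unop_injective
    simpa using (Algebra.commutes c r.unop).symm
  exact DFunLike.congr_fun h m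

section

variable (N : Type u) [AddCommGroup N] [Module R N]

/-- The `k`-module `M ⊗_R N`, for a right `R`-module `M` and a left `R`-module `N`. -/
def Ten : Type u := Tens P.act (lact R N)

instance : AddCommGroup (P.Ten N) := inferInstanceAs (AddCommGroup (Tens _ _))

instance : Module k (P.Ten N) :=
  Module.compHom (Tens P.act (lact R N))
    (Tens.leftAct (ρ := P.act) (l := lact R N) (lact k M) P.smul_act)

end

variable {N N' N'' : Type u} [AddCommGroup N] [Module R N] [AddCommGroup N'] [Module R N']
  [AddCommGroup N''] [Module R N'']

/-- The element `m ⊗ n`. -/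
def tm : M →+ N →+ P.Ten N := Tens.tmul (ρ := P.act) (l := lact R N)

theorem smul_tm (c : k) (m : M) (n : N) : c • P.tm m n = P.tm (c • m) n := rfl

theorem tm_right (m : M) (r : R) (n : N) : P.tm (P.act (op r) m) n = P.tm m (r • n) :=
  Tens.balanced (ρ := P.act) (l := lact R N) m r n

theorem ten_induction {Q : P.Ten N → Prop} (x : P.Ten N) (h0 : Q 0)
    (ht : ∀ m n, Q (P.tm m n)) (ha : ∀ x y, Q x → Q y → Q (x + y)) : Q x :=
  Tens.induction (ρ := P.act) (l := lact R N) x h0 ht ha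

theorem ten_ext {Q : Type*} [AddCommGroup Q] [Module k Q] {f g : P.Ten N →ₗ[k] Q}
    (h : ∀ m n, f (P.tm m n) = g (P.tm m n)) : f = g := by
  ext x
  induction x using ten_induction with
  | h0 => simp
  | ht m n => exact h m n
  | ha x y hx hy => rw [map_add, map_add, hx, hy]

/-- The universal property of `M ⊗_R N` for `k`-linear maps. -/
def lift {Q : Type*} [AddCommGroup Q] [Module k Q] (f : M →ₗ[k] N →+ Q)
    (hf : ∀ (m : M) (r : R) (n : N), f (P.act (op r) m) n = f m (r • n)) :
    P.Ten N →ₗ[k] Q :=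
  let g : P.Ten N →+ Q := Tens.lift (ρ := P.act) (l := lact R N) f.toAddMonoidHom hf
  { g with
    map_smul' := fun a x => by
      change g (a • x) = a • g x
      induction x using ten_induction with
      | h0 => rw [smul_zero, _root_.map_zero, smul_zero]
      | ht m n =>
        change (f (a • m)) n = a • (f m n)
        rw [map_smul]; rfl
      | ha x y hx hy => rw [smul_add, _root_.map_add, _root_.map_add, smul_add, hx, hy] }

@[simp] theorem lift_tm {Q : Type*} [AddCommGroup Q] [Module k Q] (f : M →ₗ[k] N →+ Q)
    (hf : ∀ (m : M) (r : R) (n : N), f (P.act (op r) m) n = f m (r • n)) (m : M) (n : N) :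
    P.lift f hf (P.tm m n) = f m n := rfl

/-- `id ⊗ f : M ⊗_R N → M ⊗_R N'`. -/
def map (f : N →ₗ[R] N') : P.Ten N →ₗ[k] P.Ten N' :=
  P.lift
    { toFun := fun m => (P.tm m).comp f.toAddMonoidHom
      map_add' := fun x y => by ext n; simp
      map_smul' := fun a x => by ext n; simp [smul_tm] }
    (fun m a n => by simp [tm_right])

@[simp] theorem map_tm (f : N →ₗ[R] N') (m : M) (n : N) :
    P.map f (P.tm m n) = P.tm m (f n) := rfl

theorem map_id : P.map (LinearMap.id : N →ₗ[R] N) = LinearMap.id := P.ten_ext fun _ _ => rfl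

theorem map_comp (g : N' →ₗ[R] N'') (f : N →ₗ[R] N') :
    P.map (g.comp f) = (P.map g).comp (P.map f) := P.ten_ext fun _ _ => rfl

theorem map_add (f g : N →ₗ[R] N') : P.map (f + g) = P.map f + P.map g :=
  P.ten_ext fun _ _ => by simp

/-- The functor `M ⊗_R -` from left `R`-modules to `k`-modules. -/
def tensorFunctor : ModuleCat.{u} R ⥤ ModuleCat.{u} k where
  obj N := ModuleCat.of k (P.Ten N)
  map f := ModuleCat.ofHom (P.map f.hom)
  map_id N := by rw [ModuleCat.hom_id, map_id]; rfl
  map_comp f g := by rw [ModuleCat.hom_comp, map_comp]; rfl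

instance : P.tensorFunctor.Additive where
  map_add {_ _ f g} := by
    change ModuleCat.ofHom (P.map (f + g).hom) = _
    rw [ModuleCat.hom_add, map_add]; rfl

/-- `Tor_n^R(M, -)`: the left derived functors of `M ⊗_R -`. -/
def tor (n : ℕ) : ModuleCat.{u} R ⥤ ModuleCat.{u} k := P.tensorFunctor.leftDerived n

section extend

variable {A B : Type u} [Ring A] [Algebra k A] [AddCommGroup B] {β : Bimod A B}
  {M : Type u} [AddCommGroup M] [Module k M] (P : RMod k A M)
  {N N' : Type u} [AddCommGroup N] [Module A N] [AddCommGroup N'] [Module A N']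

/-- For a right `A`-linear map `f : M → M ⊗_A B` into the tensor product with a bimodule `B`,
the map `f ⊗ id : M ⊗_A N → M ⊗_A (B ⊗_A N)`. -/
def extend (f : M →ₗ[k] P.Ten β.Self)
    (hf : ∀ (a : A) (m : M), f (P.act (op a) m) = P.map (β.rightLin a) (f m)) :
    P.Ten N →ₗ[k] P.Ten (β.Ten N) :=
  P.lift
    { toFun := fun m => AddMonoidHom.mk' (fun n => P.map (β.ins n) (f m)) (fun n n' => by
        rw [← LinearMap.add_apply, ← map_add]
        congr 2
        ext m
        simp)
      map_add' := fun x y => by ext n; simp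
      map_smul' := fun a x => by ext n; simp }
    (fun m a n => by
      change P.map (β.ins n) (f (P.act (op a) m)) = P.map (β.ins (a • n)) (f m)
      rw [hf, ← LinearMap.comp_apply, ← map_comp]
      congr 2
      ext m
      exact β.tm_right m a n)

theorem extend_tm (f : M →ₗ[k] P.Ten β.Self)
    (hf : ∀ (a : A) (m : M), f (P.act (op a) m) = P.map (β.rightLin a) (f m)) (m : M) (n : N) :
    P.extend f hf (P.tm m n) = P.map (β.ins n) (f m) := rfl

theorem extend_naturality (f : M →ₗ[k] P.Ten β.Self)
    (hf : ∀ (a : A) (m : M), f (P.act (op a) m) = P.map (β.rightLin a) (f m))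
    (g : N →ₗ[A] N') :
    (P.extend f hf).comp (P.map g) = (P.map (β.map g)).comp (P.extend f hf) :=
  P.ten_ext fun m n => by
    simp only [LinearMap.comp_apply, map_tm, extend_tm]
    rw [← LinearMap.comp_apply (f := P.map (β.map g)), ← P.map_comp]
    rfl

/-- For a left `A`-linear map `e : B → A`, the map `id ⊗ e : M ⊗_A B → M`, `m ⊗ b ↦ m·e b`. -/
def contractRight (e : β.Self →ₗ[A] A) : P.Ten β.Self →ₗ[k] M :=
  P.lift
    { toFun := fun m => AddMonoidHom.mk' (fun b => P.act (op (e b)) m)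
        (fun x y => by
          have h : P.act (op (e (x + y))) = P.act (op (e x)) + P.act (op (e y)) := by
            rw [_root_.map_add, MulOpposite.op_add, _root_.map_add]
          exact DFunLike.congr_fun h m)
      map_add' := fun x y => by ext b; exact (P.act (op (e b))).map_add x y
      map_smul' := fun c x => by ext b; exact (P.smul_act c (op (e b)) x).symm }
    (fun m a b => by
      change P.act (op (e b)) (P.act (op a) m) = P.act (op (e (a • b))) m
      rw [map_smul, smul_eq_mul, op_mul, map_mul]; rfl)

end extend

end RMod

/-- A right comodule structure, over the `A`-coalgebra `B`, on the `k`-module `M`. -/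
structure RightComod (k : Type u) {A B : Type u} [CommRing k] [Ring A] [Algebra k A]
    [AddCommGroup B] {β : Bimod A B} (C : Coring β) (M : Type u) [AddCommGroup M] [Module k M]
    extends RMod k A M where
  /-- the coaction `M → M ⊗_A B` -/
  coact : M →ₗ[k] toRMod.Ten β.Self
  /-- the coaction is right `A`-linear -/
  coact_right : ∀ (a : A) (m : M), coact (act (op a) m) = toRMod.map (β.rightLin a) (coact m)
  coassoc : ∀ m, toRMod.map C.comul (coact m) = toRMod.extend coact coact_right (coact m)
  counit : ∀ m, toRMod.contractRight C.counit (coact m) = m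

namespace Coring

variable {k A B M : Type u} [CommRing k] [Ring A] [Algebra k A] [AddCommGroup B] {β : Bimod A B}
  {C : Coring β} [AddCommGroup M] [Module k M]

/-- The coaction `N → B ⊗_A N` of a left comodule `N`. -/
def Comod.coaction (N : C.Comod) : N.A →ₗ[A] β.Ten N.A := N.a.hom

theorem Comod.coaction_hom {N N' : C.Comod} (f : N ⟶ N') :
    (β.map f.f.hom).comp N.coaction = N'.coaction.comp f.f.hom :=
  congrArg ModuleCat.Hom.hom f.h

variable (P : RightComod k C M)

/-- The cotensor product `M □ N`: the kernel of
`Δ_M ⊗ id - id ⊗ Δ_N : M ⊗_A N → M ⊗_A B ⊗_A N`. -/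
def cotensorObj (N : C.Comod) : Submodule k (P.toRMod.Ten N.A) :=
  LinearMap.ker (P.toRMod.extend P.coact P.coact_right - P.toRMod.map N.coaction)

theorem mem_cotensorObj (N : C.Comod) (x : P.toRMod.Ten N.A) :
    x ∈ cotensorObj P N ↔
      P.toRMod.extend P.coact P.coact_right x = P.toRMod.map N.coaction x := by
  rw [cotensorObj, LinearMap.mem_ker, LinearMap.sub_apply, sub_eq_zero]

theorem cotensor_map_mem {N N' : C.Comod} (f : N ⟶ N') (x : P.toRMod.Ten N.A)
    (hx : x ∈ cotensorObj P N) : P.toRMod.map f.f.hom x ∈ cotensorObj P N' := by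
  rw [cotensorObj, LinearMap.mem_ker, LinearMap.sub_apply, sub_eq_zero] at hx ⊢
  have h1 := LinearMap.congr_fun
    (P.toRMod.extend_naturality P.coact P.coact_right f.f.hom) x
  simp only [LinearMap.comp_apply] at h1
  rw [h1, hx, ← LinearMap.comp_apply, ← P.toRMod.map_comp, Comod.coaction_hom, P.toRMod.map_comp]
  rfl

/-- The functor `M □ -` from left comodules to `k`-modules. -/
def cotensor : C.Comod ⥤ ModuleCat.{u} k where
  obj N := ModuleCat.of k (cotensorObj P N)
  map f := ModuleCat.ofHom ((P.toRMod.map f.f.hom).restrict (cotensor_map_mem P f))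
  map_id N := by
    ext x
    exact LinearMap.congr_fun (P.toRMod.map_id (N := N.A)) x.1
  map_comp f g := by
    ext x
    exact LinearMap.congr_fun (P.toRMod.map_comp g.f.hom f.f.hom) x.1

instance : (cotensor P).Additive where
  map_add {_ _ f g} := by
    ext x
    apply Subtype.ext
    exact LinearMap.congr_fun (P.toRMod.map_add f.f.hom g.f.hom) x.1

/-- `Cotor^n(M, -)`: the right derived functors of the cotensor product `M □ -` on the category
of left comodules (which is abelian with enough injectives by flatness). -/
def cotor [β.IsFlat] (n : ℕ) : C.Comod ⥤ ModuleCat.{u} k := (cotensor P).rightDerived n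

end Coring

/-! ### Bialgebroids and Hopf algebroids -/

/-- An `(s, t)`-ring over `A`: a `k`-algebra `H` with source and target homomorphisms
`A → H` and `Aᵒᵖ → H` whose images commute. -/
structure SourceTarget (k A H : Type u) [CommRing k] [Ring A] [Algebra k A] [Ring H]
    [Algebra k H] where
  s : A →ₐ[k] H
  t : Aᵐᵒᵖ →ₐ[k] H
  commutes : ∀ (a : A) (b : Aᵐᵒᵖ), s a * t b = t b * s a

section mulActions

variable {H : Type u} [Ring H]

variable (H) in
/-- Right multiplication on a ring, as a right action. -/
def mulRightEnd : Hᵐᵒᵖ →+* AddMonoid.End H := Module.toAddMonoidEnd Hᵐᵒᵖ H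

variable (H) in
/-- Left multiplication on a ring, as a left action. -/
def mulLeftEnd : H →+* AddMonoid.End H := Module.toAddMonoidEnd H H

@[simp] theorem mulRightEnd_apply (x : Hᵐᵒᵖ) (h : H) : mulRightEnd H x h = h * x.unop := rfl

@[simp] theorem mulLeftEnd_apply (x h : H) : mulLeftEnd H x h = x * h := rfl

end mulActions

namespace SourceTarget

variable {k A H : Type u} [CommRing k] [Ring A] [Algebra k A] [Ring H] [Algebra k H]
  (E : SourceTarget k A H)

/-- The bimodule structure `a₁·h·a₂ = s(a₁) t(a₂) h` on `H`. -/
def leftBimod : Bimod A H where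
  left := (mulLeftEnd H).comp E.s.toRingHom
  right := (mulLeftEnd H).comp E.t.toRingHom
  comm a b m := by
    change E.s a * (E.t b * m) = E.t b * (E.s a * m)
    rw [← mul_assoc, E.commutes, mul_assoc]

/-- The bimodule structure `a₁·h·a₂ = h t(a₁) s(a₂)` on `H`. -/
def rightBimod : Bimod A H where
  left := (mulRightEnd H).comp
    { toFun := fun a => op (E.t (op a))
      map_one' := by simp
      map_mul' := fun a b => by simp
      map_zero' := by simp
      map_add' := fun a b => by simp }
  right := (mulRightEnd H).comp
    { toFun := fun a => op (E.s a.unop)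
      map_one' := by simp
      map_mul' := fun a b => by simp
      map_zero' := by simp
      map_add' := fun a b => by simp }
  comm a b m := by
    change (m * E.s b.unop) * E.t (op a) = (m * E.t (op a)) * E.s b.unop
    rw [mul_assoc, mul_assoc, E.commutes]

/-- The projection of `H ⊗ H` onto `H ⊗_A H`, formed with the bimodule structure
`a₁·h·a₂ = s(a₁) t(a₂) h`. -/
def mkL : H ⊗[ℤ] H →+ E.leftBimod.Ten E.leftBimod.Self :=
  Tens.mk E.leftBimod.right (lact A E.leftBimod.Self)

/-- The projection of `H ⊗ H` onto `H ⊗_A H`, formed with the bimodule structure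
`a₁·h·a₂ = h t(a₁) s(a₂)`. -/
def mkR : H ⊗[ℤ] H →+ E.rightBimod.Ten E.rightBimod.Self :=
  Tens.mk E.rightBimod.right (lact A E.rightBimod.Self)

end SourceTarget

/-- A left bialgebroid `(H, A, s, t, Δ, ε)` over the `k`-algebra `A`. Identities in `H ⊗_A H`
which involve multiplications are stated on representatives in the ring `H ⊗ H`. -/
structure LeftBialgebroid (k A H : Type u) [CommRing k] [Ring A] [Algebra k A] [Ring H]
    [Algebra k H] extends SourceTarget k A H where
  /-- coproduct and counit -/
  coring : Coring toSourceTarget.leftBimod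
  /-- the coproduct has values in the Takeuchi product: if `Δ h = ∑ hᵢ ⊗ h'ᵢ` then
  `∑ hᵢ t(a) ⊗ h'ᵢ = ∑ hᵢ ⊗ h'ᵢ s(a)` -/
  takeuchi : ∀ (h : H) (x : H ⊗[ℤ] H) (a : A), toSourceTarget.mkL x = coring.comul h →
    toSourceTarget.mkL (x * (t (op a) ⊗ₜ[ℤ] 1)) = toSourceTarget.mkL (x * (1 ⊗ₜ[ℤ] s a))
  /-- the coproduct is unital -/
  comul_one : coring.comul (1 : H) = toSourceTarget.mkL 1
  /-- the coproduct is multiplicative, for the factorwise multiplication of the Takeuchi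
  product -/
  comul_mul : ∀ (h h' : H) (x x' : H ⊗[ℤ] H), toSourceTarget.mkL x = coring.comul h →
    toSourceTarget.mkL x' = coring.comul h' →
    coring.comul (h * h' : H) = toSourceTarget.mkL (x * x')
  counit_one : coring.counit (1 : H) = 1
  counit_mul_s : ∀ h h' : H, coring.counit (h * h' : H) = coring.counit (h * s (coring.counit h') : H)
  counit_mul_t : ∀ h h' : H,
    coring.counit (h * h' : H) = coring.counit (h * t (op (coring.counit h')) : H)

/-- A right bialgebroid `(H, A, s, t, Δ, ε)` over the `k`-algebra `A`. -/
structure RightBialgebroid (k A H : Type u) [CommRing k] [Ring A] [Algebra k A] [Ring H]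
    [Algebra k H] extends SourceTarget k A H where
  /-- coproduct and counit -/
  coring : Coring toSourceTarget.rightBimod
  /-- the coproduct has values in the Takeuchi product: if `Δ h = ∑ hᵢ ⊗ h'ᵢ` then
  `∑ s(a) hᵢ ⊗ h'ᵢ = ∑ hᵢ ⊗ t(a) h'ᵢ` -/
  takeuchi : ∀ (h : H) (x : H ⊗[ℤ] H) (a : A), toSourceTarget.mkR x = coring.comul h →
    toSourceTarget.mkR ((s a ⊗ₜ[ℤ] 1) * x) = toSourceTarget.mkR ((1 ⊗ₜ[ℤ] t (op a)) * x)
  comul_one : coring.comul (1 : H) = toSourceTarget.mkR 1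
  comul_mul : ∀ (h h' : H) (x x' : H ⊗[ℤ] H), toSourceTarget.mkR x = coring.comul h →
    toSourceTarget.mkR x' = coring.comul h' →
    coring.comul (h * h' : H) = toSourceTarget.mkR (x * x')
  counit_one : coring.counit (1 : H) = 1
  counit_mul_s : ∀ h h' : H, coring.counit (h * h' : H) = coring.counit (s (coring.counit h) * h' : H)
  counit_mul_t : ∀ h h' : H,
    coring.counit (h * h' : H) = coring.counit (t (op (coring.counit h)) * h' : H)

section Tens₃

variable {R R' H : Type u} [Ring R] [Ring R'] [Ring H]
  (ρ : Rᵐᵒᵖ →+* AddMonoid.End H) (l : R →+* AddMonoid.End H)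
  (ρ' : R'ᵐᵒᵖ →+* AddMonoid.End H) (l' : R' →+* AddMonoid.End H)

/-- The triple tensor product `H ⊗_R H ⊗_R' H`. -/
def Tens₃ : Type u :=
  (H ⊗[ℤ] (H ⊗[ℤ] H)) ⧸ AddSubgroup.closure
    ({w | ∃ (r : R) (x y z : H), w = (ρ (op r) x) ⊗ₜ[ℤ] (y ⊗ₜ[ℤ] z) - x ⊗ₜ[ℤ] ((l r y) ⊗ₜ[ℤ] z)} ∪
     {w | ∃ (r : R') (x y z : H),
      w = x ⊗ₜ[ℤ] ((ρ' (op r) y) ⊗ₜ[ℤ] z) - x ⊗ₜ[ℤ] (y ⊗ₜ[ℤ] (l' r z))})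

instance : AddCommGroup (Tens₃ ρ l ρ' l') := by unfold Tens₃; infer_instance

/-- The projection onto the triple tensor product. -/
def mk₃ : H ⊗[ℤ] (H ⊗[ℤ] H) →+ Tens₃ ρ l ρ' l' := QuotientAddGroup.mk' _

/-- `(x ⊗ y, z) ↦ x ⊗ y ⊗ z`, as a map `H ⊗_R H → H ⊗_R H ⊗_R' H` for `z ∈ H`. -/
def appR (z : H) : Tens ρ l →+ Tens₃ ρ l ρ' l' :=
  Tens.lift
    (AddMonoidHom.mk' (fun x => AddMonoidHom.mk' (fun y => mk₃ ρ l ρ' l' (x ⊗ₜ[ℤ] (y ⊗ₜ[ℤ] z)))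
      (fun a b => by rw [TensorProduct.add_tmul, TensorProduct.tmul_add, map_add]))
      (fun a b => by ext y; simp [TensorProduct.add_tmul]))
    (fun x r y => by
      refine sub_eq_zero.1 ?_
      change mk₃ ρ l ρ' l' _ - mk₃ ρ l ρ' l' _ = 0
      rw [← map_sub]
      exact (QuotientAddGroup.eq_zero_iff _).2
        (AddSubgroup.subset_closure (Or.inl ⟨r, x, y, z, rfl⟩)))

/-- `(x, y ⊗ z) ↦ x ⊗ y ⊗ z`, as a map `H ⊗_R' H → H ⊗_R H ⊗_R' H` for `x ∈ H`. -/
def appL (x : H) : Tens ρ' l' →+ Tens₃ ρ l ρ' l' :=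
  Tens.lift
    (AddMonoidHom.mk' (fun y => AddMonoidHom.mk' (fun z => mk₃ ρ l ρ' l' (x ⊗ₜ[ℤ] (y ⊗ₜ[ℤ] z)))
      (fun a b => by rw [TensorProduct.tmul_add, TensorProduct.tmul_add, map_add]))
      (fun a b => by ext y; simp [TensorProduct.add_tmul, TensorProduct.tmul_add]))
    (fun y r z => by
      refine sub_eq_zero.1 ?_
      change mk₃ ρ l ρ' l' _ - mk₃ ρ l ρ' l' _ = 0
      rw [← map_sub]
      exact (QuotientAddGroup.eq_zero_iff _).2
        (AddSubgroup.subset_closure (Or.inr ⟨r, x, y, z, rfl⟩)))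

theorem appR_add (z z' : H) : appR ρ l ρ' l' (z + z') = appR ρ l ρ' l' z + appR ρ l ρ' l' z' :=
  Tens.hom_ext fun x y => by
    change mk₃ ρ l ρ' l' (x ⊗ₜ[ℤ] (y ⊗ₜ[ℤ] (z + z'))) =
      mk₃ ρ l ρ' l' (x ⊗ₜ[ℤ] (y ⊗ₜ[ℤ] z)) + mk₃ ρ l ρ' l' (x ⊗ₜ[ℤ] (y ⊗ₜ[ℤ] z'))
    rw [← map_add, TensorProduct.tmul_add, TensorProduct.tmul_add]

theorem appL_add (x x' : H) : appL ρ l ρ' l' (x + x') = appL ρ l ρ' l' x + appL ρ l ρ' l' x' :=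
  Tens.hom_ext fun y z => by
    change mk₃ ρ l ρ' l' ((x + x') ⊗ₜ[ℤ] (y ⊗ₜ[ℤ] z)) =
      mk₃ ρ l ρ' l' (x ⊗ₜ[ℤ] (y ⊗ₜ[ℤ] z)) + mk₃ ρ l ρ' l' (x' ⊗ₜ[ℤ] (y ⊗ₜ[ℤ] z))
    rw [← map_add, TensorProduct.add_tmul]

/-- `D ⊗ id : H ⊗ H → H ⊗_R H ⊗_R' H` for `D : H → H ⊗_R H`. -/
def compL (D : H →+ Tens ρ l) : H ⊗[ℤ] H →+ Tens₃ ρ l ρ' l' :=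
  TensorProduct.liftAddHom
    (AddMonoidHom.mk' (fun x => AddMonoidHom.mk' (fun z => appR ρ l ρ' l' z (D x))
      (fun z z' => by rw [appR_add]; rfl))
      (fun x x' => by ext z; simp))
    (fun r x z => by
      rw [map_zsmul, map_zsmul, AddMonoidHom.smul_apply])

/-- `id ⊗ D : H ⊗ H → H ⊗_R H ⊗_R' H` for `D : H → H ⊗_R' H`. -/
def compR (D : H →+ Tens ρ' l') : H ⊗[ℤ] H →+ Tens₃ ρ l ρ' l' :=
  TensorProduct.liftAddHom
    (AddMonoidHom.mk' (fun x => AddMonoidHom.mk' (fun z => appL ρ l ρ' l' x (D z))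
      (fun z z' => by simp))
      (fun x x' => by ext z; simp [appL_add]))
    (fun r x z => by
      rw [map_zsmul, map_zsmul, AddMonoidHom.smul_apply])

end Tens₃

/-- `μ (f ⊗ g) : H ⊗ H → H`, `x ⊗ y ↦ f x * g y`. -/
def mulMap {H : Type u} [Ring H] (f g : H →+ H) : H ⊗[ℤ] H →+ H :=
  ((LinearMap.mul' ℤ H).comp
    (TensorProduct.map f.toIntLinearMap g.toIntLinearMap)).toAddMonoidHom

namespace LeftBialgebroid

variable {k A H : Type u} [CommRing k] [Ring A] [Algebra k A] [Ring H] [Algebra k H]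
  (L : LeftBialgebroid k A H)

/-- the coproduct -/
def Δ : H →+ L.leftBimod.Ten L.leftBimod.Self := L.coring.comul.toAddMonoidHom

/-- the counit -/
def ε : H →+ A := L.coring.counit.toAddMonoidHom

end LeftBialgebroid

namespace RightBialgebroid

variable {k A H : Type u} [CommRing k] [Ring A] [Algebra k A] [Ring H] [Algebra k H]
  (L : RightBialgebroid k A H)

/-- the coproduct -/
def Δ : H →+ L.rightBimod.Ten L.rightBimod.Self := L.coring.comul.toAddMonoidHom

/-- the counit -/
def ε : H →+ A := L.coring.counit.toAddMonoidHom

end RightBialgebroid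

/-- A Hopf algebroid with invertible antipode: a left bialgebroid over `Al` and a right
bialgebroid over `Ar` on the same `k`-algebra `H`, and a bijective `k`-linear map `S : H → H`.
Identities for maps defined on tensor products over `Al` and `Ar` are stated on representatives
in `H ⊗ H`. -/
structure HopfAlgebroid (k Al Ar H : Type u) [CommRing k] [Ring Al] [Algebra k Al] [Ring Ar]
    [Algebra k Ar] [Ring H] [Algebra k H] where
  l : LeftBialgebroid k Al H
  r : RightBialgebroid k Ar H
  /-- the antipode -/
  S : H ≃ₗ[k] H
  sl_εl_tr : ∀ a, l.s (l.ε (r.t a)) = r.t a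
  tl_εl_sr : ∀ a, l.t (op (l.ε (r.s a))) = r.s a
  sr_εr_tl : ∀ a, r.s (r.ε (l.t a)) = l.t a
  tr_εr_sl : ∀ a, r.t (op (r.ε (l.s a))) = l.s a
  /-- `(Δₗ ⊗ id) Δᵣ = (id ⊗ Δᵣ) Δₗ` in `H ⊗_{Al} H ⊗_{Ar} H` -/
  twisted_coassoc_lr : ∀ (h : H) (x y : H ⊗[ℤ] H), r.mkR x = r.Δ h → l.mkL y = l.Δ h →
    compL l.leftBimod.right l.leftBimod.left r.rightBimod.right r.rightBimod.left l.Δ x =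
    compR l.leftBimod.right l.leftBimod.left r.rightBimod.right r.rightBimod.left r.Δ y
  /-- `(Δᵣ ⊗ id) Δₗ = (id ⊗ Δₗ) Δᵣ` in `H ⊗_{Ar} H ⊗_{Al} H` -/
  twisted_coassoc_rl : ∀ (h : H) (x y : H ⊗[ℤ] H), l.mkL x = l.Δ h → r.mkR y = r.Δ h →
    compL r.rightBimod.right r.rightBimod.left l.leftBimod.right l.leftBimod.left r.Δ x =
    compR r.rightBimod.right r.rightBimod.left l.leftBimod.right l.leftBimod.left l.Δ y
  S_tl_tr : ∀ (a : Al) (b : Ar) (h : H),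
    S (l.t (op a) * h * r.t (op b)) = r.s b * S h * l.s a
  /-- `μ (S ⊗ id) Δₗ = sᵣ εᵣ` -/
  antipode_l : ∀ (h : H) (x : H ⊗[ℤ] H), l.mkL x = l.Δ h →
    mulMap S.toLinearMap.toAddMonoidHom (AddMonoidHom.id H) x = r.s (r.ε h)
  /-- `μ (id ⊗ S) Δᵣ = sₗ εₗ` -/
  antipode_r : ∀ (h : H) (x : H ⊗[ℤ] H), r.mkR x = r.Δ h →
    mulMap (AddMonoidHom.id H) S.toLinearMap.toAddMonoidHom x = l.s (l.ε h)

/-! ### Hochschild cohomology, the cobar complex and Cotor -/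

namespace Bimod

variable {A M N N' : Type u} [Ring A] [AddCommGroup M] (β : Bimod A M)
  [AddCommGroup N] [Module A N] [AddCommGroup N'] [Module A N']

theorem map_sub (f g : N →ₗ[A] N') : β.map (f - g) = β.map f - β.map g :=
  β.ten_ext fun _ _ => by simp

theorem map_zero : β.map (0 : N →ₗ[A] N') = 0 := β.ten_ext fun _ _ => by simp

theorem map_zsmul (c : ℤ) (f : N →ₗ[A] N') : β.map (c • f) = c • β.map f :=
  β.ten_ext fun _ _ => by simp

theorem map_sum {ι : Type*} (s : Finset ι) (f : ι → N →ₗ[A] N') :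
    β.map (∑ i ∈ s, f i) = ∑ i ∈ s, β.map (f i) :=
  β.ten_ext fun _ _ => by simp

end Bimod

namespace LeftBialgebroid

variable {k A H : Type u} [CommRing k] [Ring A] [Algebra k A] [Ring H] [Algebra k H]
  (L : LeftBialgebroid k A H)

/-- The bimodule `H` with `a₁·h·a₂ = s(a₁) t(a₂) h`. -/
abbrev bim : Bimod A H := L.leftBimod

/-- `H` is flat as a right `A`-module via `h·a = t(a) h`. -/
abbrev IsFlat : Prop := L.bim.IsFlat

/-- The category of left comodules over the left bialgebroid `H`. -/
abbrev Comod : Type (u + 1) := L.coring.Comod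

/-- The unit of `H`. -/
def e : L.bim.Self := (1 : H)

/-- The source map as a left `A`-linear map. -/
def sLin : A →ₗ[A] L.bim.Self where
  toFun a := (L.s a : H)
  map_add' x y := map_add L.s x y
  map_smul' a x := map_mul L.s a x

/-- The target map. -/
def tHom : A →+ L.bim.Self where
  toFun a := (L.t (op a) : H)
  map_add' x y := map_add L.t (op x) (op y)
  map_zero' := map_zero L.t

theorem sLin_one : L.sLin 1 = L.e := map_one L.s

theorem tHom_one : L.tHom 1 = L.e := map_one L.t

theorem smul_e (a : A) : a • L.e = L.sLin a := mul_one (L.s a)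

theorem rightLin_e (a : A) : L.bim.rightLin a L.e = L.tHom a := mul_one (L.t (op a))

theorem rightLin_tHom (a b : A) : L.bim.rightLin b (L.tHom a) = L.tHom (a * b) :=
  (map_mul L.t (op b) (op a)).symm

theorem tHom_tm {N : Type u} [AddCommGroup N] [Module A N] (a : A) (n : N) :
    L.bim.tm (L.tHom a) n = L.bim.tm L.e (a • n) := by
  rw [← rightLin_e]; exact L.bim.tm_right L.e a n

theorem tHom_algebraMap (c : k) (a : A) :
    L.tHom (algebraMap k A c * a) = algebraMap k A c • L.tHom a := by
  change L.t (op (algebraMap k A c * a)) = L.s (algebraMap k A c) * L.t (op a)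
  have h : op (algebraMap k A c) = algebraMap k Aᵐᵒᵖ c := rfl
  rw [op_mul, map_mul, h, AlgHom.commutes, AlgHom.commutes, Algebra.commutes]

theorem comul_e : L.coring.comul L.e = L.bim.tm L.e L.e := L.comul_one

theorem counit_e : L.coring.counit L.e = 1 := L.counit_one

theorem comul_sLin (a : A) : L.coring.comul (L.sLin a) = L.bim.tm (L.sLin a) L.e := by
  rw [← smul_e, map_smul, comul_e, Bimod.smul_tm]

theorem comul_tHom (a : A) : L.coring.comul (L.tHom a) = L.bim.tm L.e (L.tHom a) := by
  rw [← rightLin_e, L.coring.comul_right, comul_e, Bimod.map_tm]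

theorem counit_sLin (a : A) : L.coring.counit (L.sLin a) = a := by
  rw [← smul_e, map_smul, counit_e, smul_eq_mul, mul_one]

theorem counit_tHom (a : A) : L.coring.counit (L.tHom a) = a := by
  rw [← rightLin_e, L.coring.counit_right, counit_e, one_mul]

/-- The `(n + 1)`-fold tensor product `H ⊗_A ⋯ ⊗_A H`, as a left `A`-module via the source map
on the first factor. -/
def tpow : ℕ → ModuleCat.{u} A
  | 0 => ModuleCat.of A L.bim.Self
  | n + 1 => ModuleCat.of A (L.bim.Ten (tpow n))

/-- `id ⊗ f : H ⊗_A H^{⊗ (m + 1)} → H ⊗_A H^{⊗ (n + 1)}`. -/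
def tmap {m n : ℕ} (f : L.tpow m →ₗ[A] L.tpow n) : L.tpow (m + 1) →ₗ[A] L.tpow (n + 1) :=
  L.bim.map f

/-- `h ↦ h ⊗ 1`. -/
def appUnit : L.tpow 0 →ₗ[A] L.tpow 1 := L.bim.ins L.e

/-- The cofaces `δ'ᵢ : H^{⊗ (n + 1)} → H^{⊗ (n + 2)}`, `0 ≤ i ≤ n + 1`, of the cobar complex:
`δ'ᵢ(h⁰ ⊗ ⋯ ⊗ hⁿ) = h⁰ ⊗ ⋯ ⊗ Δ hⁱ ⊗ ⋯ ⊗ hⁿ` for `i ≤ n`, and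
`δ'ₙ₊₁(h⁰ ⊗ ⋯ ⊗ hⁿ) = h⁰ ⊗ ⋯ ⊗ hⁿ ⊗ 1`. -/
def cobarFace : ∀ (n : ℕ), ℕ → (L.tpow n →ₗ[A] L.tpow (n + 1))
  | 0, 0 => L.coring.comul
  | 0, _ + 1 => L.appUnit
  | n + 1, 0 => L.coring.ext (L.tpow n)
  | n + 1, i + 1 => L.tmap (cobarFace n i)

/-- The differential `b' = ∑ᵢ (-1)ⁱ δ'ᵢ` of the cobar complex. -/
def cobarD (n : ℕ) : L.tpow n →ₗ[A] L.tpow (n + 1) :=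
  ∑ i ∈ Finset.range (n + 2), (-1 : ℤ) ^ i • L.cobarFace n i

theorem tmap_comp {l m n : ℕ} (g : L.tpow m →ₗ[A] L.tpow n) (f : L.tpow l →ₗ[A] L.tpow m) :
    L.tmap (g.comp f) = (L.tmap g).comp (L.tmap f) := L.bim.map_comp g f

theorem tmap_sub {m n : ℕ} (f g : L.tpow m →ₗ[A] L.tpow n) :
    L.tmap (f - g) = L.tmap f - L.tmap g := L.bim.map_sub f g

theorem tmap_zero {m n : ℕ} : L.tmap (0 : L.tpow m →ₗ[A] L.tpow n) = 0 := L.bim.map_zero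

theorem face_coassoc (n : ℕ) :
    (L.tmap (L.cobarFace n 0)).comp (L.cobarFace n 0) =
      (L.cobarFace (n + 1) 0).comp (L.cobarFace n 0) := by
  cases n with
  | zero => exact LinearMap.ext L.coring.coassoc
  | succ n => exact L.coring.ext_coassoc (N := L.tpow n)

theorem face_counit (n : ℕ) :
    (L.coring.ctr (L.tpow n)).comp (L.cobarFace n 0) = LinearMap.id := by
  cases n with
  | zero => exact LinearMap.ext L.coring.counit_comul
  | succ n => exact L.coring.ctr_ext (N := L.tpow n)

theorem face_naturality {m n : ℕ} (f : L.tpow m →ₗ[A] L.tpow n) :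
    (L.cobarFace (n + 1) 0).comp (L.tmap f) =
      (L.tmap (L.tmap f)).comp (L.cobarFace (m + 1) 0) := L.coring.ext_naturality f

theorem face_appUnit :
    (L.cobarFace 1 0).comp L.appUnit = (L.tmap L.appUnit).comp (L.cobarFace 0 0) := rfl

theorem tmap_face_appUnit :
    (L.tmap (L.cobarFace 0 0)).comp L.appUnit = (L.tmap L.appUnit).comp L.appUnit := by
  refine LinearMap.ext fun h => ?_
  change L.bim.tm h (L.coring.comul L.e) = L.bim.tm h (L.bim.tm L.e L.e)
  rw [comul_e]

theorem cobarD_zero : L.cobarD 0 = L.cobarFace 0 0 - L.appUnit := by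
  simp only [cobarD, Finset.sum_range_succ, Finset.sum_range_zero]
  rw [pow_zero, one_smul, pow_one, neg_one_zsmul]
  refine Eq.trans ?_ (sub_eq_add_neg (L.cobarFace 0 0) L.appUnit).symm
  exact congrArg (· + -L.appUnit) (zero_add (L.cobarFace 0 0))

theorem cobarD_succ (n : ℕ) :
    L.cobarD (n + 1) = L.cobarFace (n + 1) 0 - L.tmap (L.cobarD n) := by
  have h : L.tmap (L.cobarD n) =
      ∑ i ∈ Finset.range (n + 2), (-1 : ℤ) ^ i • L.cobarFace (n + 1) (i + 1) := by
    refine (L.bim.map_sum _ _).trans (Finset.sum_congr rfl fun i _ => ?_)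
    exact L.bim.map_zsmul _ _
  rw [h, cobarD, Finset.sum_range_succ', pow_zero, one_smul, add_comm _ (L.cobarFace (n + 1) 0),
    sub_eq_add_neg, ← Finset.sum_neg_distrib]
  congr 1
  refine Finset.sum_congr rfl fun i _ => ?_
  rw [pow_succ, mul_neg_one, neg_smul]

/-- The cobar differential is a comodule map. -/
theorem cobarD_comod (n : ℕ) :
    (L.cobarFace (n + 1) 0).comp (L.cobarD n) = (L.tmap (L.cobarD n)).comp (L.cobarFace n 0) := by
  cases n with
  | zero =>
    rw [cobarD_zero, tmap_sub, LinearMap.comp_sub, LinearMap.sub_comp, face_appUnit, face_coassoc]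
  | succ n =>
    rw [cobarD_succ, tmap_sub, LinearMap.comp_sub, LinearMap.sub_comp, face_naturality,
      face_coassoc]

theorem cobarD_comp (n : ℕ) : (L.cobarD (n + 1)).comp (L.cobarD n) = 0 := by
  induction n with
  | zero =>
    rw [cobarD_succ, LinearMap.sub_comp, cobarD_comod, ← LinearMap.comp_sub]
    have h : L.cobarFace 0 0 - L.cobarD 0 = L.appUnit := by rw [cobarD_zero]; abel
    rw [h, cobarD_zero, tmap_sub, LinearMap.sub_comp, tmap_face_appUnit, sub_self]
  | succ n ih =>
    rw [cobarD_succ (n := n + 1), LinearMap.sub_comp, cobarD_comod, ← LinearMap.comp_sub]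
    have h : L.cobarFace (n + 1) 0 - L.cobarD (n + 1) = L.tmap (L.cobarD n) := by
      rw [cobarD_succ]; abel
    rw [h, ← tmap_comp, ih, tmap_zero]

/-- The comodule `Cobarⁿ(H) = H^{⊗ (n + 1)}`, with coaction `Δ` on the first factor. -/
def cobarObj (n : ℕ) : L.Comod where
  A := L.tpow n
  a := ModuleCat.ofHom (L.cobarFace n 0)
  counit := by ext1; exact L.face_counit n
  coassoc := by ext1; exact (L.face_coassoc n).symm

/-- The differential of the cobar complex, as a comodule map. -/
def cobarHom (n : ℕ) : L.cobarObj n ⟶ L.cobarObj (n + 1) where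
  f := ModuleCat.ofHom (L.cobarD n)
  h := by ext1; exact (L.cobarD_comod n).symm

/-- The cobar complex, a cochain complex of left comodules. -/
def cobar : CochainComplex L.Comod ℕ :=
  CochainComplex.of L.cobarObj L.cobarHom (fun n => by
    apply Comonad.Coalgebra.Hom.ext
    ext1
    exact L.cobarD_comp n)

/-- `A` as a left comodule, by means of the source map: `a ↦ s(a) ⊗ 1 ∈ H ⊗_A A`. -/
def base : L.Comod where
  A := ModuleCat.of A A
  a := ModuleCat.ofHom ((L.bim.ins (1 : A)).comp L.sLin)
  counit := by
    ext1
    refine LinearMap.ext fun a => ?_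
    change L.coring.counit (L.sLin a) • (1 : A) = a
    rw [counit_sLin, smul_eq_mul, mul_one]
  coassoc := by
    ext1
    refine LinearMap.ext fun a => ?_
    change L.bim.map (L.bim.ins 1) (L.coring.comul (L.sLin a)) =
      L.bim.tm (L.sLin a) (L.bim.tm (L.sLin 1) (1 : A))
    rw [comul_sLin, sLin_one]
    rfl

/-- The coaugmentation `A → Cobar⁰(H) = H` given by the source map. -/
def coaug : L.base ⟶ L.cobar.X 0 where
  f := ModuleCat.ofHom L.sLin
  h := by
    ext1
    refine LinearMap.ext fun a => ?_
    refine Eq.trans ?_ (L.comul_sLin a).symm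
    exact congrArg (L.bim.tm (L.sLin a)) L.sLin_one

/-- `A` as a right module over itself. -/
def baseRMod : RMod k A A where
  act := mulRightEnd A
  act_algebraMap c a := by
    rw [mulRightEnd_apply, unop_op, ← Algebra.commutes, Algebra.smul_def]

/-- `A` as a right comodule, by means of the target map: `a ↦ 1 ⊗ t(a) ∈ A ⊗_A H`. -/
def baseRight : RightComod k L.coring A where
  toRMod := baseRMod
  coact :=
    { toFun := fun a => (baseRMod (k := k)).tm (1 : A) (L.tHom a)
      map_add' := fun a b => by rw [map_add, map_add]
      map_smul' := fun c a => by
        rw [Algebra.smul_def, tHom_algebraMap, RingHom.id_apply, RMod.smul_tm,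
          ← (baseRMod (k := k)).tm_right, ← (baseRMod (k := k) (A := A)).act_algebraMap] }
  coact_right a m := by
    change baseRMod.tm (1 : A) (L.tHom (m * a)) = baseRMod.tm (1 : A) (L.bim.rightLin a (L.tHom m))
    rw [rightLin_tHom]
  coassoc m := by
    change baseRMod.tm (1 : A) (L.coring.comul (L.tHom m)) =
      baseRMod.tm (1 : A) (L.bim.tm (L.tHom 1) (L.tHom m))
    rw [comul_tHom, tHom_one]
  counit m := by
    change (1 : A) * L.coring.counit (L.tHom m) = m
    rw [counit_tHom, one_mul]

/-- `Cotorⁿ_H(A, A)`: the right derived functors of `A □ -` on left comodules, at `A`. -/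
def Cotor [L.IsFlat] (n : ℕ) : ModuleCat.{u} k := (Coring.cotor L.baseRight n).obj L.base

/-- `C⁰(H) = A` and `Cⁿ(H) = H ⊗_A ⋯ ⊗_A H` (`n` factors) for `n ≥ 1`, as left `A`-modules. -/
def hochA : ℕ → ModuleCat.{u} A
  | 0 => ModuleCat.of A A
  | n + 1 => L.tpow n

/-- The zeroth coface `Cⁿ(H) → Cⁿ⁺¹(H)`: `a ↦ t(a)` for `n = 0` and
`h¹ ⊗ ⋯ ⊗ hⁿ ↦ 1 ⊗ h¹ ⊗ ⋯ ⊗ hⁿ` for `n ≥ 1`. -/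
def firstFace : ∀ n : ℕ, L.hochA n →+ L.tpow n
  | 0 => L.tHom
  | n + 1 => L.bim.tm (N := L.tpow n) L.e

/-- The cofaces `δᵢ : Cⁿ(H) → Cⁿ⁺¹(H)`, `0 ≤ i ≤ n + 1`. For `n = 0`, `δ₀ = t` and `δ₁ = s`.
For `n ≥ 1`, `δ₀(x) = 1 ⊗ x`, `δᵢ` applies `Δ` to the `i`-th factor for `1 ≤ i ≤ n`, and
`δₙ₊₁(x) = x ⊗ 1`. -/
def hochFace : ∀ n : ℕ, ℕ → (L.hochA n →+ L.hochA (n + 1))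
  | n, 0 => L.firstFace n
  | 0, _ + 1 => L.sLin.toAddMonoidHom
  | n + 1, i + 1 => (L.cobarFace n i).toAddMonoidHom

/-- The Hochschild differential `b = ∑ᵢ (-1)ⁱ δᵢ`. -/
def hochB (n : ℕ) : L.hochA n →+ L.hochA (n + 1) :=
  ∑ i ∈ Finset.range (n + 2), (-1 : ℤ) ^ i • L.hochFace n i

theorem firstFace_smul (n : ℕ) (c : k) (x : L.hochA n) :
    L.firstFace n (algebraMap k A c • x) = algebraMap k A c • L.firstFace n x := by
  cases n with
  | zero => exact L.tHom_algebraMap c x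
  | succ n =>
    refine (L.tHom_tm (N := L.tpow n) (algebraMap k A c) x).symm.trans ?_
    rw [← mul_one (algebraMap k A c), tHom_algebraMap, tHom_one, mul_one]
    rfl

theorem hochFace_smul (n i : ℕ) (c : k) (x : L.hochA n) :
    L.hochFace n i (algebraMap k A c • x) = algebraMap k A c • L.hochFace n i x := by
  cases i with
  | zero => cases n <;> exact L.firstFace_smul _ c x
  | succ i =>
    cases n with
    | zero => exact L.sLin.map_smul _ (x : A)
    | succ n => exact (L.cobarFace n i).map_smul _ x

theorem hochB_smul (n : ℕ) (c : k) (x : L.hochA n) :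
    L.hochB n (algebraMap k A c • x) = algebraMap k A c • L.hochB n x := by
  simp only [hochB, AddMonoidHom.finsetSum_apply, AddMonoidHom.smul_apply, hochFace_smul,
    Finset.smul_sum]
  exact Finset.sum_congr rfl fun i _ => smul_comm _ _ _

/-- `b : C⁰(H) → C¹(H)`. -/
def bZ : A →+ L.tpow 0 := L.hochB 0

/-- `b : Cⁿ⁺¹(H) → Cⁿ⁺²(H)`. -/
def bS (n : ℕ) : L.tpow n →+ L.tpow (n + 1) := L.hochB (n + 1)

/-- `x ↦ 1 ⊗ x`. -/
def firstS (n : ℕ) : L.tpow n →+ L.tpow (n + 1) := L.firstFace (n + 1)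

theorem bZ_apply (a : A) : L.bZ a = (L.tHom a - L.sLin a : L.bim.Self) := by
  have h : L.hochB 0 = L.hochFace 0 0 - L.hochFace 0 1 := by
    simp only [hochB, Finset.sum_range_succ, Finset.sum_range_zero]
    rw [pow_zero, one_smul, pow_one, neg_one_zsmul]
    refine Eq.trans ?_ (sub_eq_add_neg (L.hochFace 0 0) (L.hochFace 0 1)).symm
    exact congrArg (· + -L.hochFace 0 1) (zero_add (L.hochFace 0 0))
  exact DFunLike.congr_fun h a

theorem bS_apply (n : ℕ) (x : L.tpow n) : L.bS n x = L.firstS n x - L.cobarD n x := by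
  have h : L.hochB (n + 1) = L.hochFace (n + 1) 0 -
      ∑ i ∈ Finset.range (n + 2), (-1 : ℤ) ^ i • L.hochFace (n + 1) (i + 1) := by
    rw [hochB, Finset.sum_range_succ', pow_zero, one_smul, add_comm _ (L.hochFace (n + 1) 0),
      sub_eq_add_neg, ← Finset.sum_neg_distrib]
    congr 1
    refine Finset.sum_congr rfl fun i _ => ?_
    rw [pow_succ, mul_neg_one, neg_smul]
  refine (DFunLike.congr_fun h x).trans ?_
  refine congrArg (L.firstS n x - ·) ?_
  refine (AddMonoidHom.finsetSum_apply _ _ _).trans ?_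
  refine Eq.trans ?_ (LinearMap.sum_apply _ _ _).symm
  rfl

/-- `b' δ₀ = δ₀ b` in degree zero. -/
theorem cobarD_firstFace_zero (a : A) : L.cobarD 0 (L.tHom a) = L.firstS 0 (L.bZ a) := by
  rw [bZ_apply, cobarD_zero]
  change L.coring.comul (L.tHom a) - L.bim.tm (L.tHom a) L.e =
    L.bim.tm L.e (L.tHom a - L.sLin a)
  rw [comul_tHom, tHom_tm, smul_e, map_sub]

/-- `b' δ₀ = δ₀ b` in positive degrees. -/
theorem cobarD_firstFace_succ (n : ℕ) (x : L.tpow n) :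
    L.cobarD (n + 1) (L.firstS n x) = L.firstS (n + 1) (L.bS n x) := by
  rw [bS_apply, cobarD_succ]
  have h : L.cobarFace (n + 1) 0 (L.firstS n x) = L.firstS (n + 1) (L.firstS n x) := by
    change L.bim.map (L.bim.ins (N := L.tpow n) x) (L.coring.comul L.e) = _
    rw [comul_e]
    rfl
  rw [LinearMap.sub_apply, h, map_sub]
  rfl

theorem bS_bZ (a : A) : L.bS 0 (L.bZ a) = 0 := by
  have h1 : L.cobarD 0 (L.sLin a) = 0 := by
    rw [cobarD_zero]
    change L.coring.comul (L.sLin a) - L.bim.tm (L.sLin a) L.e = 0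
    rw [comul_sLin, sub_self]
  have h2 : L.cobarD 0 (L.bZ a) = L.cobarD 0 (L.tHom a) := by
    rw [bZ_apply]
    refine ((L.cobarD 0).map_sub (L.tHom a) (L.sLin a)).trans ?_
    rw [h1, sub_zero]
  rw [bS_apply, h2, cobarD_firstFace_zero, sub_self]

theorem bS_bS (n : ℕ) (x : L.tpow n) : L.bS (n + 1) (L.bS n x) = 0 := by
  have h1 : L.cobarD (n + 1) (L.cobarD n x) = 0 := LinearMap.congr_fun (L.cobarD_comp n) x
  have h2 : L.cobarD (n + 1) (L.bS n x) = L.cobarD (n + 1) (L.firstS n x) := by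
    rw [L.bS_apply n, map_sub, h1, sub_zero]
  rw [L.bS_apply (n + 1), h2, cobarD_firstFace_succ, sub_self]

theorem hochB_hochB (n : ℕ) (x : L.hochA n) : L.hochB (n + 1) (L.hochB n x) = 0 := by
  cases n with
  | zero => exact L.bS_bZ x
  | succ n => exact L.bS_bS n x

theorem cobarD_firstFace (n : ℕ) (x : L.hochA n) :
    L.cobarD n (L.firstFace n x) = L.firstFace (n + 1) (L.hochB n x) := by
  cases n with
  | zero => exact L.cobarD_firstFace_zero x
  | succ n => exact L.cobarD_firstFace_succ n x

theorem face_firstFace (n : ℕ) (x : L.hochA n) :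
    L.cobarFace n 0 (L.firstFace n x) = L.firstS n (L.firstFace n x) := by
  cases n with
  | zero => exact L.comul_tHom x
  | succ n =>
    change L.bim.map (L.bim.ins (N := L.tpow n) x) (L.coring.comul L.e) = _
    rw [comul_e]
    rfl

/-- The `k`-modules `Cⁿ(H)`. -/
def hochX (n : ℕ) : ModuleCat.{u} k :=
  (ModuleCat.restrictScalars (algebraMap k A)).obj (L.hochA n)

/-- The Hochschild differential as a `k`-linear map. -/
def hochD (n : ℕ) : L.hochX n ⟶ L.hochX (n + 1) :=
  ModuleCat.ofHom (X := L.hochX n) (Y := L.hochX (n + 1))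
    { toFun := L.hochB n
      map_add' := (L.hochB n).map_add
      map_smul' := L.hochB_smul n }

/-- The Hochschild cochain complex `(C^•(H), b)`. -/
def hoch : CochainComplex (ModuleCat.{u} k) ℕ :=
  CochainComplex.of L.hochX L.hochD (fun n => by
    ext x
    exact L.hochB_hochB n x)

/-- The Hochschild cohomology `HHⁿ(H)`. -/
def HH (n : ℕ) : ModuleCat.{u} k := L.hoch.homology n

/-- `x ↦ 1 ⊗ x`, as a map `Cobarⁿ(H) → A ⊗_A Cobarⁿ(H)`. -/
def oneTm (n : ℕ) : L.tpow n →+ L.baseRight.toRMod.Ten (L.tpow n) :=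
  L.baseRight.toRMod.tm (1 : A)

theorem oneTm_smul (n : ℕ) (c : k) (x : L.tpow n) :
    L.oneTm n (algebraMap k A c • x) = c • L.oneTm n x := by
  change L.baseRight.toRMod.tm (1 : A) (algebraMap k A c • x) =
    L.baseRight.toRMod.tm (c • (1 : A)) x
  rw [← L.baseRight.toRMod.tm_right, L.baseRight.toRMod.act_algebraMap]

theorem oneTm_mem (n : ℕ) (x : L.hochA n) :
    L.oneTm n (L.firstFace n x) ∈ Coring.cotensorObj L.baseRight (L.cobarObj n) := by
  refine (Coring.mem_cotensorObj L.baseRight (L.cobarObj n) _).2 ?_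
  have h : L.oneTm (n + 1) (L.bim.tm (N := L.tpow n) (L.tHom 1) (L.firstFace n x)) =
      L.oneTm (n + 1) (L.cobarFace n 0 (L.firstFace n x)) := by
    rw [face_firstFace, tHom_one]
    rfl
  exact h

/-- The maps `Cⁿ(H) → A □ Cobarⁿ(H)`, `x ↦ 1 ⊗ 1 ⊗ x` for `n ≥ 1` and `a ↦ 1 ⊗ t(a)` for
`n = 0`. -/
def hochToCobarAux (n : ℕ) :
    L.hochX n ⟶ (Coring.cotensor L.baseRight).obj (L.cobarObj n) :=
  ModuleCat.ofHom (X := L.hochX n)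
    { toFun := fun x => ⟨L.oneTm n (L.firstFace n x), L.oneTm_mem n x⟩
      map_add' := fun x y => Subtype.ext
        ((congrArg (L.oneTm n) ((L.firstFace n).map_add x y)).trans ((L.oneTm n).map_add _ _))
      map_smul' := fun c x => Subtype.ext
        ((congrArg (L.oneTm n) (L.firstFace_smul n c x)).trans (L.oneTm_smul n c _)) }

/-- The isomorphism of complexes `C^•(H) → A □ Cobar^•(H)`, as a cochain map: it sends
`x ∈ Cⁿ(H)` to `1 ⊗ 1 ⊗ x` for `n ≥ 1`, and `a ∈ C⁰(H) = A` to `1 ⊗ t(a)`. -/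
def hochToCobar : L.hoch ⟶
    ((Coring.cotensor L.baseRight).mapHomologicalComplex (ComplexShape.up ℕ)).obj L.cobar where
  f n := L.hochToCobarAux n
  comm' i j hij := by
    obtain rfl : i + 1 = j := hij
    simp only [hoch, cobar, Functor.mapHomologicalComplex_obj_d, CochainComplex.of_d]
    ext x
    exact Subtype.ext (congrArg (L.oneTm (i + 1)) (L.cobarD_firstFace i x))

end LeftBialgebroid

/-! ### Hochschild homology, the bar complex and Tor -/

namespace HopfAlgebroid

variable {k Al Ar H : Type u} [CommRing k] [Ring Al] [Algebra k Al] [Ring Ar] [Algebra k Ar]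
  [Ring H] [Algebra k H] (𝓗 : HopfAlgebroid k Al Ar H)

/-- The source map of the right bialgebroid. -/
abbrev sr : Ar →+* H := 𝓗.r.s.toRingHom

/-- `h ↦ εᵣ(S⁻¹ h)`. -/
def ν : H →+ Ar := 𝓗.r.ε.comp 𝓗.S.symm.toLinearMap.toAddMonoidHom

theorem ν_apply (h : H) : 𝓗.ν h = 𝓗.r.ε (𝓗.S.symm h) := rfl

theorem εr_mul_sr (h : H) (a : Ar) : 𝓗.r.ε (h * 𝓗.sr a) = 𝓗.r.ε h * a :=
  𝓗.r.coring.counit_right a h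

theorem εr_mul_tr (h : H) (a : Ar) : 𝓗.r.ε (h * 𝓗.r.t (op a)) = a * 𝓗.r.ε h :=
  𝓗.r.coring.counit.map_smul a h

theorem εr_one : 𝓗.r.ε 1 = 1 := 𝓗.r.counit_one

theorem εr_sr (a : Ar) : 𝓗.r.ε (𝓗.sr a) = a := by
  have h := 𝓗.εr_mul_sr 1 a
  rwa [one_mul, εr_one, one_mul] at h

theorem εr_sr_εr (h h' : H) : 𝓗.r.ε (𝓗.sr (𝓗.r.ε h) * h') = 𝓗.r.ε (h * h') :=
  (𝓗.r.counit_mul_s h h').symm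

theorem εl_sl_εl (h h' : H) : 𝓗.l.ε (h * 𝓗.l.s (𝓗.l.ε h')) = 𝓗.l.ε (h * h') :=
  (𝓗.l.counit_mul_s h h').symm

theorem εl_tl_εl (h h' : H) : 𝓗.l.ε (h * 𝓗.l.t (op (𝓗.l.ε h'))) = 𝓗.l.ε (h * h') :=
  (𝓗.l.counit_mul_t h h').symm

theorem S_mul_tr (h : H) (a : Ar) : 𝓗.S (h * 𝓗.r.t (op a)) = 𝓗.sr a * 𝓗.S h := by
  have h1 := 𝓗.S_tl_tr 1 a h
  rw [op_one, map_one, map_one, one_mul, mul_one] at h1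
  exact h1

theorem S_tl_mul (h : H) (a : Al) : 𝓗.S (𝓗.l.t (op a) * h) = 𝓗.S h * 𝓗.l.s a := by
  have h1 := 𝓗.S_tl_tr a 1 h
  rw [op_one, map_one, map_one, one_mul, mul_one] at h1
  exact h1

theorem ν_sr_mul (a : Ar) (h : H) : 𝓗.ν (𝓗.sr a * h) = a * 𝓗.ν h := by
  have h1 : 𝓗.S.symm (𝓗.sr a * h) = 𝓗.S.symm h * 𝓗.r.t (op a) := by
    rw [LinearEquiv.symm_apply_eq, S_mul_tr, LinearEquiv.apply_symm_apply]
  rw [ν_apply, h1, εr_mul_tr, ν_apply]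

theorem εl_S (h : H) : 𝓗.l.ε (𝓗.S h) = 𝓗.l.ε (𝓗.sr (𝓗.r.ε h)) := by
  obtain ⟨x, hx⟩ := Tens.mk_surjective (ρ := 𝓗.l.leftBimod.right)
    (l := lact Al 𝓗.l.leftBimod.Self) (𝓗.l.Δ h)
  have key : ∀ x : H ⊗[ℤ] H, 𝓗.l.ε (mulMap 𝓗.S.toLinearMap.toAddMonoidHom (AddMonoidHom.id H) x) =
      𝓗.l.ε (𝓗.S (𝓗.l.leftBimod.contractRight 𝓗.l.coring.counit (𝓗.l.mkL x) : H)) := by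
    intro x
    induction x with
    | zero =>
      rw [map_zero, map_zero, map_zero]
      exact ((congrArg 𝓗.l.ε (map_zero 𝓗.S)).trans (map_zero 𝓗.l.ε)).symm
    | tmul a b =>
      change 𝓗.l.ε (𝓗.S a * b) = 𝓗.l.ε (𝓗.S (𝓗.l.t (op (𝓗.l.ε b)) * a))
      rw [S_tl_mul, εl_sl_εl]
    | add x y hx hy =>
      rw [map_add, map_add, hx, hy, map_add, map_add]
      exact ((congrArg 𝓗.l.ε (map_add 𝓗.S _ _)).trans (map_add 𝓗.l.ε _ _)).symm
  have h2 := key x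
  rw [𝓗.antipode_l h x hx] at h2
  have h3 : 𝓗.l.leftBimod.contractRight 𝓗.l.coring.counit (𝓗.l.mkL x) = h :=
    (congrArg _ hx).trans (𝓗.l.coring.comul_counit h)
  rw [h3] at h2
  exact h2.symm

/-- `sᵣ εᵣ S⁻¹ = tₗ εₗ` -/
theorem sr_ν (h : H) : 𝓗.sr (𝓗.ν h) = 𝓗.l.t (op (𝓗.l.ε h)) := by
  have h1 := 𝓗.εl_S (𝓗.S.symm h)
  rw [LinearEquiv.apply_symm_apply] at h1
  rw [h1]
  exact (𝓗.tl_εl_sr _).symm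

theorem sr_injective : Function.Injective 𝓗.sr :=
  Function.LeftInverse.injective 𝓗.εr_sr

theorem ν_mul_sr_ν (h h' : H) : 𝓗.ν (h * 𝓗.sr (𝓗.ν h')) = 𝓗.ν (h * h') := by
  apply 𝓗.sr_injective
  rw [sr_ν, sr_ν, sr_ν, εl_tl_εl]

section Ind

variable (N : Type u) [AddCommGroup N] [Module H N]

/-- `H ⊗_{Aᵣ} N` for a left `H`-module `N`, where `h sᵣ(a) ⊗ n = h ⊗ sᵣ(a) n`. -/
def Ind : Type u :=
  Tens ((mulRightEnd H).comp (RingHom.op 𝓗.sr)) ((lact H N).comp 𝓗.sr)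

instance : AddCommGroup (𝓗.Ind N) := inferInstanceAs (AddCommGroup (Tens _ _))

/-- The left `H`-module structure `h·(h' ⊗ n) = h h' ⊗ n`. -/
instance : Module H (𝓗.Ind N) :=
  Module.compHom
    (Tens ((mulRightEnd H).comp (RingHom.op 𝓗.sr)) ((lact H N).comp 𝓗.sr))
    (Tens.leftAct (ρ := (mulRightEnd H).comp (RingHom.op 𝓗.sr)) (l := (lact H N).comp 𝓗.sr)
      (mulLeftEnd H) (fun x _ m => (mul_assoc x m _).symm))

variable {N} {N' : Type u} [AddCommGroup N'] [Module H N']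

/-- The element `h ⊗ n`. -/
def itm : H →+ N →+ 𝓗.Ind N :=
  Tens.tmul (ρ := (mulRightEnd H).comp (RingHom.op 𝓗.sr)) (l := (lact H N).comp 𝓗.sr)

theorem smul_itm (x h : H) (n : N) : x • 𝓗.itm h n = 𝓗.itm (x * h) n := rfl

theorem itm_sr (h : H) (a : Ar) (n : N) : 𝓗.itm (h * 𝓗.sr a) n = 𝓗.itm h (𝓗.sr a • n) :=
  Tens.balanced (ρ := (mulRightEnd H).comp (RingHom.op 𝓗.sr)) (l := (lact H N).comp 𝓗.sr) h a n

theorem ind_induction {Q : 𝓗.Ind N → Prop} (x : 𝓗.Ind N) (h0 : Q 0)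
    (ht : ∀ h n, Q (𝓗.itm h n)) (ha : ∀ x y, Q x → Q y → Q (x + y)) : Q x :=
  Tens.induction x h0 ht ha

theorem ind_ext {Q : Type*} [AddCommGroup Q] [Module H Q] {f g : 𝓗.Ind N →ₗ[H] Q}
    (h : ∀ m n, f (𝓗.itm m n) = g (𝓗.itm m n)) : f = g := by
  ext x
  induction x using ind_induction with
  | h0 => simp
  | ht m n => exact h m n
  | ha x y hx hy => rw [map_add, map_add, hx, hy]

theorem ind_hom_ext {Q : Type*} [AddCommGroup Q] {f g : 𝓗.Ind N →+ Q}
    (h : ∀ m n, f (𝓗.itm m n) = g (𝓗.itm m n)) : f = g := Tens.hom_ext h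

/-- The universal property of `H ⊗_{Aᵣ} N` for additive maps. -/
def indLiftAdd {Q : Type*} [AddCommGroup Q] (f : H →+ N →+ Q)
    (hf : ∀ (h : H) (a : Ar) (n : N), f (h * 𝓗.sr a) n = f h (𝓗.sr a • n)) : 𝓗.Ind N →+ Q :=
  Tens.lift (ρ := (mulRightEnd H).comp (RingHom.op 𝓗.sr)) (l := (lact H N).comp 𝓗.sr) f hf

theorem indLiftAdd_itm {Q : Type*} [AddCommGroup Q] (f : H →+ N →+ Q)
    (hf : ∀ (h : H) (a : Ar) (n : N), f (h * 𝓗.sr a) n = f h (𝓗.sr a • n)) (h : H) (n : N) :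
    𝓗.indLiftAdd f hf (𝓗.itm h n) = f h n := rfl

/-- The universal property of `H ⊗_{Aᵣ} N` for `H`-linear maps. -/
def indLift {Q : Type*} [AddCommGroup Q] [Module H Q] (f : H →ₗ[H] N →+ Q)
    (hf : ∀ (h : H) (a : Ar) (n : N), f (h * 𝓗.sr a) n = f h (𝓗.sr a • n)) :
    𝓗.Ind N →ₗ[H] Q :=
  let g : 𝓗.Ind N →+ Q := 𝓗.indLiftAdd f.toAddMonoidHom hf
  { g with
    map_smul' := fun a x => by
      change g (a • x) = a • g x
      induction x using ind_induction with
      | h0 => rw [smul_zero, map_zero, smul_zero]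
      | ht m n =>
        change (f (a • m)) n = a • (f m n)
        rw [map_smul]; rfl
      | ha x y hx hy => rw [smul_add, map_add, map_add, smul_add, hx, hy] }

@[simp] theorem indLift_itm {Q : Type*} [AddCommGroup Q] [Module H Q] (f : H →ₗ[H] N →+ Q)
    (hf : ∀ (h : H) (a : Ar) (n : N), f (h * 𝓗.sr a) n = f h (𝓗.sr a • n)) (h : H) (n : N) :
    𝓗.indLift f hf (𝓗.itm h n) = f h n := rfl

/-- `id ⊗ f`. -/
def indMap (f : N →ₗ[H] N') : 𝓗.Ind N →ₗ[H] 𝓗.Ind N' :=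
  𝓗.indLift
    { toFun := fun h => (𝓗.itm h).comp f.toAddMonoidHom
      map_add' := fun x y => by ext n; simp
      map_smul' := fun a x => by ext n; simp [smul_itm] }
    (fun h a n => (𝓗.itm_sr h a (f n)).trans (congrArg (𝓗.itm h) (f.map_smul (𝓗.sr a) n).symm))

@[simp] theorem indMap_itm (f : N →ₗ[H] N') (h : H) (n : N) :
    𝓗.indMap f (𝓗.itm h n) = 𝓗.itm h (f n) := rfl

/-- The multiplication `h ⊗ n ↦ h n`. -/
def indAct : 𝓗.Ind N →ₗ[H] N :=
  𝓗.indLift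
    { toFun := fun h => Module.toAddMonoidEnd H N h
      map_add' := fun x y => map_add (Module.toAddMonoidEnd H N) x y
      map_smul' := fun a x => map_mul (Module.toAddMonoidEnd H N) a x }
    (fun h a n => mul_smul h (𝓗.sr a) n)

@[simp] theorem indAct_itm (h : H) (n : N) : 𝓗.indAct (𝓗.itm h n) = h • n := rfl

/-- The last face `h ⊗ h' ↦ h sᵣ(εᵣ(S⁻¹ h'))`. -/
def indLast : 𝓗.Ind H →ₗ[H] H :=
  𝓗.indLift
    { toFun := fun h => AddMonoidHom.mk' (fun h' => h * 𝓗.sr (𝓗.r.ε (𝓗.S.symm h')))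
        (fun x y => by rw [map_add, map_add, map_add, mul_add])
      map_add' := fun x y => by ext n; exact add_mul _ _ _
      map_smul' := fun a x => by ext n; exact mul_assoc _ _ _ }
    (fun h a n => by
      change (h * 𝓗.sr a) * 𝓗.sr (𝓗.ν n) = h * 𝓗.sr (𝓗.ν (𝓗.sr a * n))
      rw [ν_sr_mul, map_mul, mul_assoc])

theorem indLast_itm (h h' : H) : 𝓗.indLast (𝓗.itm h h') = h * 𝓗.sr (𝓗.ν h') := rfl

/-- `h ⊗ n ↦ sᵣ(εᵣ h) n`. -/
def indCounit : 𝓗.Ind N →+ N :=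
  𝓗.indLiftAdd ((Module.toAddMonoidEnd H N).toAddMonoidHom.comp
      (𝓗.sr.toAddMonoidHom.comp 𝓗.r.ε))
    (fun h a n => by
      change 𝓗.sr (𝓗.r.ε (h * 𝓗.sr a)) • n = 𝓗.sr (𝓗.r.ε h) • (𝓗.sr a • n)
      rw [εr_mul_sr, map_mul, mul_smul])

theorem indCounit_itm (h : H) (n : N) : 𝓗.indCounit (𝓗.itm h n) = 𝓗.sr (𝓗.r.ε h) • n := rfl

end Ind

/-- The `(n + 1)`-fold tensor product `H ⊗_{Aᵣ} ⋯ ⊗_{Aᵣ} H`, formed with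
`h sᵣ(a) ⊗ h' = h ⊗ sᵣ(a) h'`, as a left `H`-module. -/
def barObj : ℕ → ModuleCat.{u} H
  | 0 => ModuleCat.of H H
  | n + 1 => ModuleCat.of H (𝓗.Ind (barObj n))

/-- `id ⊗ f : H ⊗ H^{⊗ (m + 1)} → H ⊗ H^{⊗ (n + 1)}`. -/
def bmap {m n : ℕ} (f : 𝓗.barObj m →ₗ[H] 𝓗.barObj n) :
    𝓗.barObj (m + 1) →ₗ[H] 𝓗.barObj (n + 1) := 𝓗.indMap f

/-- `h ⊗ x ↦ h x`. -/
def bact (n : ℕ) : 𝓗.barObj (n + 1) →ₗ[H] 𝓗.barObj n := 𝓗.indAct (N := 𝓗.barObj n)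

/-- `h ⊗ h' ↦ h sᵣ(εᵣ(S⁻¹ h'))`. -/
def blast : 𝓗.barObj 1 →ₗ[H] 𝓗.barObj 0 := 𝓗.indLast

/-- The faces `d'ᵢ : H^{⊗ (n + 2)} → H^{⊗ (n + 1)}`, `0 ≤ i ≤ n + 1`, of the bar complex:
`d'ᵢ(h⁰ ⊗ ⋯ ⊗ hⁿ⁺¹) = h⁰ ⊗ ⋯ ⊗ hⁱ hⁱ⁺¹ ⊗ ⋯ ⊗ hⁿ⁺¹` for `i ≤ n`, and
`d'ₙ₊₁(h⁰ ⊗ ⋯ ⊗ hⁿ⁺¹) = h⁰ ⊗ ⋯ ⊗ hⁿ sᵣ(εᵣ(S⁻¹ hⁿ⁺¹))`. -/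
def barFace : ∀ n : ℕ, ℕ → (𝓗.barObj (n + 1) →ₗ[H] 𝓗.barObj n)
  | 0, 0 => 𝓗.bact 0
  | 0, _ + 1 => 𝓗.blast
  | n + 1, 0 => 𝓗.bact (n + 1)
  | n + 1, i + 1 => 𝓗.bmap (barFace n i)

/-- The differential `b' = ∑ᵢ (-1)ⁱ d'ᵢ` of the bar complex. -/
def barD (n : ℕ) : 𝓗.barObj (n + 1) →ₗ[H] 𝓗.barObj n :=
  ∑ i ∈ Finset.range (n + 2), (-1 : ℤ) ^ i • 𝓗.barFace n i

theorem bmap_sum {m n : ℕ} {ι : Type*} (s : Finset ι) (f : ι → 𝓗.barObj m →ₗ[H] 𝓗.barObj n) :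
    𝓗.bmap (∑ i ∈ s, f i) = ∑ i ∈ s, 𝓗.bmap (f i) := by
  refine 𝓗.ind_ext (N := 𝓗.barObj m) fun h x => ?_
  refine Eq.trans ?_ (LinearMap.sum_apply s (fun i => 𝓗.bmap (f i))
    (𝓗.itm (N := 𝓗.barObj m) h x : 𝓗.barObj (m + 1))).symm
  refine (congrArg (𝓗.itm (N := 𝓗.barObj n) h) (LinearMap.sum_apply s f x)).trans ?_
  exact map_sum (𝓗.itm (N := 𝓗.barObj n) h) _ _

theorem bmap_zsmul {m n : ℕ} (c : ℤ) (f : 𝓗.barObj m →ₗ[H] 𝓗.barObj n) :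
    𝓗.bmap (c • f) = c • 𝓗.bmap f := 𝓗.ind_ext fun h x => map_zsmul (𝓗.itm h) c (f x)

theorem bmap_comp {l m n : ℕ} (g : 𝓗.barObj m →ₗ[H] 𝓗.barObj n)
    (f : 𝓗.barObj l →ₗ[H] 𝓗.barObj m) : 𝓗.bmap (g.comp f) = (𝓗.bmap g).comp (𝓗.bmap f) :=
  𝓗.ind_ext fun _ _ => rfl

theorem bmap_zero {m n : ℕ} : 𝓗.bmap (0 : 𝓗.barObj m →ₗ[H] 𝓗.barObj n) = 0 :=
  𝓗.ind_ext fun h _ => map_zero (𝓗.itm h)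

theorem bact_bmap {m n : ℕ} (f : 𝓗.barObj m →ₗ[H] 𝓗.barObj n) :
    (𝓗.bact n).comp (𝓗.bmap f) = f.comp (𝓗.bact m) :=
  𝓗.ind_ext (N := 𝓗.barObj m) fun h x => (f.map_smul h x).symm

theorem barD_zero : 𝓗.barD 0 = 𝓗.bact 0 - 𝓗.blast := by
  simp only [barD, Finset.sum_range_succ, Finset.sum_range_zero]
  rw [pow_zero, one_smul, pow_one, neg_one_zsmul]
  refine Eq.trans ?_ (sub_eq_add_neg (𝓗.bact 0) 𝓗.blast).symm
  exact congrArg (· + -𝓗.blast) (zero_add (𝓗.bact 0))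

theorem barFace_zero (n : ℕ) : 𝓗.barFace n 0 = 𝓗.bact n := by cases n <;> rfl

theorem barD_succ (n : ℕ) : 𝓗.barD (n + 1) = 𝓗.bact (n + 1) - 𝓗.bmap (𝓗.barD n) := by
  have h : 𝓗.bmap (𝓗.barD n) =
      ∑ i ∈ Finset.range (n + 2), (-1 : ℤ) ^ i • 𝓗.barFace (n + 1) (i + 1) := by
    refine (𝓗.bmap_sum _ _).trans (Finset.sum_congr rfl fun i _ => ?_)
    exact 𝓗.bmap_zsmul _ _
  rw [h, barD, Finset.sum_range_succ', pow_zero, one_smul, barFace_zero,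
    add_comm _ (𝓗.bact (n + 1)), sub_eq_add_neg, ← Finset.sum_neg_distrib]
  congr 1
  refine Finset.sum_congr rfl fun i _ => ?_
  rw [pow_succ, mul_neg_one, neg_smul]

/-- `εᵣ(S⁻¹ -)` vanishes on boundaries. -/
theorem ν_barD (x : 𝓗.barObj 1) : 𝓗.ν (𝓗.barD 0 x) = 0 := by
  have h : (𝓗.ν.comp (𝓗.barD 0).toAddMonoidHom : 𝓗.Ind H →+ Ar) = 0 :=
    𝓗.ind_hom_ext fun h h' => by
      change 𝓗.ν (𝓗.barD 0 (𝓗.itm h h')) = 0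
      have h1 : 𝓗.barD 0 (𝓗.itm h h') = (h * h' - h * 𝓗.sr (𝓗.ν h') : H) := by
        rw [barD_zero]
        rfl
      rw [h1]
      refine (map_sub 𝓗.ν (h * h') (h * 𝓗.sr (𝓗.ν h'))).trans ?_
      rw [ν_mul_sr_ν, sub_self]
  exact DFunLike.congr_fun h x

theorem barD_comp (n : ℕ) : (𝓗.barD n).comp (𝓗.barD (n + 1)) = 0 := by
  induction n with
  | zero =>
    rw [barD_succ, LinearMap.comp_sub, ← bact_bmap, ← LinearMap.sub_comp]
    have h : 𝓗.bact 0 - 𝓗.barD 0 = 𝓗.blast := by rw [barD_zero]; abel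
    rw [h]
    refine 𝓗.ind_ext fun h x => ?_
    change h * 𝓗.sr (𝓗.ν (𝓗.barD 0 x)) = 0
    rw [ν_barD, map_zero, mul_zero]
  | succ n ih =>
    rw [barD_succ (n := n + 1), LinearMap.comp_sub, ← bact_bmap, ← LinearMap.sub_comp]
    have h : 𝓗.bact (n + 1) - 𝓗.barD (n + 1) = 𝓗.bmap (𝓗.barD n) := by rw [barD_succ]; abel
    rw [h, ← bmap_comp, ih, bmap_zero]

/-- The bar complex, a chain complex of left `H`-modules. -/
def bar : ChainComplex (ModuleCat.{u} H) ℕ :=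
  ChainComplex.of 𝓗.barObj (fun n => ModuleCat.ofHom (𝓗.barD n)) (fun n => by
    ext1
    exact 𝓗.barD_comp n)

/-- The left action `h·a = εₗ(h sₗ(a))` of `H` on `Aₗ`. -/
def trivAct : H →+* AddMonoid.End Al where
  toFun h := 𝓗.l.ε.comp ((mulLeftEnd H h).comp (𝓗.l.s : Al →+ H))
  map_one' := by
    ext a
    change 𝓗.l.ε (1 * 𝓗.l.s a) = a
    rw [one_mul]
    exact 𝓗.l.counit_sLin a
  map_mul' x y := by
    ext a
    change 𝓗.l.ε (x * y * 𝓗.l.s a) = 𝓗.l.ε (x * 𝓗.l.s (𝓗.l.ε (y * 𝓗.l.s a)))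
    rw [εl_sl_εl, mul_assoc]
  map_zero' := by
    ext a
    change 𝓗.l.ε (0 * 𝓗.l.s a) = 0
    rw [zero_mul, map_zero]
  map_add' x y := by
    ext a
    change 𝓗.l.ε ((x + y) * 𝓗.l.s a) = 𝓗.l.ε (x * 𝓗.l.s a) + 𝓗.l.ε (y * 𝓗.l.s a)
    rw [add_mul, map_add]

/-- The ring `Aₗ` as a left `H`-module: `h·a = εₗ(h sₗ(a))`. -/
@[nolint unusedArguments]
def Triv (_ : HopfAlgebroid k Al Ar H) : Type u := Al

instance : AddCommGroup 𝓗.Triv := inferInstanceAs (AddCommGroup Al)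

instance : Module H 𝓗.Triv := Module.compHom Al 𝓗.trivAct

/-- `Aₗ` as an object of the category of left `H`-modules. -/
def triv : ModuleCat.{u} H := ModuleCat.of H 𝓗.Triv

/-- The augmentation `εₗ : Bar₀(H) = H → Aₗ`. -/
def aug : 𝓗.bar.X 0 ⟶ 𝓗.triv :=
  ModuleCat.ofHom (X := H) (Y := 𝓗.Triv)
    { toFun := fun h => (𝓗.l.ε h : Al)
      map_add' := fun x y => map_add 𝓗.l.ε x y
      map_smul' := fun x y => (𝓗.εl_sl_εl x y).symm }

/-- The ring `Aᵣ` as a right `H`-module: `a·h = εᵣ(sᵣ(a) h)`. -/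
def trivRight : RMod k H Ar where
  act :=
    { toFun := fun h => 𝓗.r.ε.comp (((mulRightEnd H) h).comp 𝓗.sr.toAddMonoidHom)
      map_one' := by
        ext a
        change 𝓗.r.ε (𝓗.sr a * 1) = a
        rw [mul_one, εr_sr]
      map_mul' := fun x y => by
        ext a
        change 𝓗.r.ε (𝓗.sr a * (y.unop * x.unop)) =
          𝓗.r.ε (𝓗.sr (𝓗.r.ε (𝓗.sr a * y.unop)) * x.unop)
        rw [εr_sr_εr, mul_assoc]
      map_zero' := by
        ext a
        change 𝓗.r.ε (𝓗.sr a * 0) = 0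
        rw [mul_zero, map_zero]
      map_add' := fun x y => by
        ext a
        change 𝓗.r.ε (𝓗.sr a * (x.unop + y.unop)) =
          𝓗.r.ε (𝓗.sr a * x.unop) + 𝓗.r.ε (𝓗.sr a * y.unop)
        rw [mul_add, map_add] }
  act_algebraMap c a := by
    change 𝓗.r.ε (𝓗.sr a * algebraMap k H c) = c • a
    have h : algebraMap k H c = 𝓗.sr (algebraMap k Ar c) := (𝓗.r.s.commutes c).symm
    rw [h, ← map_mul, εr_sr, ← Algebra.commutes, Algebra.smul_def]

theorem trivRight_act (a : Ar) (h : H) : 𝓗.trivRight.act (op h) a = 𝓗.r.ε (𝓗.sr a * h) := rfl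

/-- `Torₙ^H(Aᵣ, Aₗ)`: the left derived functors of `Aᵣ ⊗_H -` at `Aₗ`. -/
def Tor (n : ℕ) : ModuleCat.{u} k := (𝓗.trivRight.tor n).obj 𝓗.triv

/-- `C₀(H) = Aᵣ` and `Cₙ(H) = H ⊗_{Aᵣ} ⋯ ⊗_{Aᵣ} H` (`n` factors) for `n ≥ 1`. -/
def hochX : ℕ → ModuleCat.{u} k
  | 0 => ModuleCat.of k Ar
  | n + 1 => (ModuleCat.restrictScalars (algebraMap k H)).obj (𝓗.barObj n)

/-- The zeroth face `Cₙ₊₁(H) → Cₙ(H)`: `εᵣ` for `n = 0` and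
`h¹ ⊗ h² ⊗ ⋯ ↦ sᵣ(εᵣ h¹) h² ⊗ ⋯` for `n ≥ 1`. -/
def firstFace : ∀ n : ℕ, 𝓗.barObj n →+ 𝓗.hochX n
  | 0 => 𝓗.r.ε
  | n + 1 => 𝓗.indCounit (N := 𝓗.barObj n)

/-- The faces `dᵢ : Cₙ₊₁(H) → Cₙ(H)`, `0 ≤ i ≤ n + 1`. For `n = 0`, `d₀ = εᵣ` and
`d₁ = εᵣ S⁻¹`. For `n ≥ 1`, `d₀(h¹ ⊗ h² ⊗ ⋯) = sᵣ(εᵣ h¹) h² ⊗ ⋯`, `dᵢ` multiplies the factors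
`hⁱ` and `hⁱ⁺¹` for `1 ≤ i ≤ n`, and `dₙ₊₁(⋯ ⊗ hⁿ ⊗ hⁿ⁺¹) = ⋯ ⊗ hⁿ sᵣ(εᵣ(S⁻¹ hⁿ⁺¹))`. -/
def hochFace : ∀ n : ℕ, ℕ → (𝓗.barObj n →+ 𝓗.hochX n)
  | n, 0 => 𝓗.firstFace n
  | 0, _ + 1 => 𝓗.r.ε.comp 𝓗.S.symm.toLinearMap.toAddMonoidHom
  | n + 1, i + 1 => (𝓗.barFace n i).toAddMonoidHom

/-- The Hochschild differential `b = ∑ᵢ (-1)ⁱ dᵢ`. -/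
def hochB (n : ℕ) : 𝓗.barObj n →+ 𝓗.hochX n :=
  ∑ i ∈ Finset.range (n + 2), (-1 : ℤ) ^ i • 𝓗.hochFace n i

/-- `h¹ ⊗ h² ⊗ ⋯ ↦ sᵣ(εᵣ h¹) h² ⊗ ⋯`. -/
def firstS (n : ℕ) : 𝓗.barObj (n + 1) →+ 𝓗.barObj n := 𝓗.indCounit (N := 𝓗.barObj n)

/-- `b : Cₙ₊₂(H) → Cₙ₊₁(H)`. -/
def bS (n : ℕ) : 𝓗.barObj (n + 1) →+ 𝓗.barObj n := 𝓗.hochB (n + 1)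

theorem hochB_zero (h : H) : 𝓗.hochB 0 h = (𝓗.r.ε h - 𝓗.ν h : Ar) := by
  have h1 : 𝓗.hochB 0 = 𝓗.hochFace 0 0 - 𝓗.hochFace 0 1 := by
    simp only [hochB, Finset.sum_range_succ, Finset.sum_range_zero]
    rw [pow_zero, one_smul, pow_one, neg_one_zsmul]
    refine Eq.trans ?_ (sub_eq_add_neg (𝓗.hochFace 0 0) (𝓗.hochFace 0 1)).symm
    exact congrArg (· + -𝓗.hochFace 0 1) (zero_add (𝓗.hochFace 0 0))
  exact DFunLike.congr_fun h1 h

theorem bS_apply (n : ℕ) (x : 𝓗.barObj (n + 1)) : 𝓗.bS n x = 𝓗.firstS n x - 𝓗.barD n x := by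
  have h : 𝓗.hochB (n + 1) = 𝓗.hochFace (n + 1) 0 -
      ∑ i ∈ Finset.range (n + 2), (-1 : ℤ) ^ i • 𝓗.hochFace (n + 1) (i + 1) := by
    rw [hochB, Finset.sum_range_succ', pow_zero, one_smul, add_comm _ (𝓗.hochFace (n + 1) 0),
      sub_eq_add_neg, ← Finset.sum_neg_distrib]
    congr 1
    refine Finset.sum_congr rfl fun i _ => ?_
    rw [pow_succ, mul_neg_one, neg_smul]
  refine (DFunLike.congr_fun h x).trans ?_
  refine congrArg (𝓗.firstS n x - ·) ?_
  refine (AddMonoidHom.finsetSum_apply _ _ _).trans ?_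
  refine Eq.trans ?_ (LinearMap.sum_apply _ _ _).symm
  rfl

theorem firstFace_smul (n : ℕ) (h : H) (x : 𝓗.barObj n) :
    𝓗.firstFace n (𝓗.sr (𝓗.r.ε h) • x) = 𝓗.firstFace n (h • x) := by
  cases n with
  | zero => exact 𝓗.εr_sr_εr h x
  | succ n =>
    have h1 : ((𝓗.firstS n).comp (Module.toAddMonoidEnd H (𝓗.barObj (n + 1)) (𝓗.sr (𝓗.r.ε h))) :
        𝓗.Ind (𝓗.barObj n) →+ 𝓗.barObj n) =
        (𝓗.firstS n).comp (Module.toAddMonoidEnd H (𝓗.barObj (n + 1)) h) :=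
      𝓗.ind_hom_ext fun h' y => by
        change 𝓗.sr (𝓗.r.ε (𝓗.sr (𝓗.r.ε h) * h')) • y = 𝓗.sr (𝓗.r.ε (h * h')) • y
        rw [εr_sr_εr]
    exact DFunLike.congr_fun h1 x

theorem firstS_bmap (n : ℕ) (x : 𝓗.barObj (n + 2)) :
    𝓗.firstS n (𝓗.bmap (𝓗.barD n) x) = 𝓗.barD n (𝓗.firstS (n + 1) x) := by
  have h1 : ((𝓗.firstS n).comp (𝓗.bmap (𝓗.barD n)).toAddMonoidHom :
      𝓗.Ind (𝓗.barObj (n + 1)) →+ 𝓗.barObj n) =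
      (𝓗.barD n).toAddMonoidHom.comp (𝓗.firstS (n + 1)) :=
    𝓗.ind_hom_ext fun h y => ((𝓗.barD n).map_smul (𝓗.sr (𝓗.r.ε h)) y).symm
  exact DFunLike.congr_fun h1 x

theorem firstFace_bact (n : ℕ) (x : 𝓗.barObj (n + 1)) :
    𝓗.firstFace n (𝓗.firstS n x) = 𝓗.firstFace n (𝓗.bact n x) := by
  have h1 : ((𝓗.firstFace n).comp (𝓗.firstS n) : 𝓗.Ind (𝓗.barObj n) →+ 𝓗.hochX n) =
      (𝓗.firstFace n).comp (𝓗.bact n).toAddMonoidHom :=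
    𝓗.ind_hom_ext (N := 𝓗.barObj n) fun h y => 𝓗.firstFace_smul n h y
  exact DFunLike.congr_fun h1 x

theorem ε_blast (x : 𝓗.barObj 1) : 𝓗.r.ε (𝓗.blast x) = 𝓗.ν (𝓗.firstS 0 x) := by
  have h1 : (𝓗.r.ε.comp 𝓗.blast.toAddMonoidHom : 𝓗.Ind H →+ Ar) = 𝓗.ν.comp (𝓗.firstS 0) :=
    𝓗.ind_hom_ext fun h h' => by
      change 𝓗.r.ε (h * 𝓗.sr (𝓗.ν h')) = 𝓗.ν (𝓗.sr (𝓗.r.ε h) * h')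
      rw [εr_mul_sr, ν_sr_mul]
  exact DFunLike.congr_fun h1 x

/-- `d₀ b' = b d₀` -/
theorem firstFace_barD (n : ℕ) (x : 𝓗.barObj (n + 1)) :
    𝓗.firstFace n (𝓗.barD n x) = 𝓗.hochB n (𝓗.firstS n x) := by
  cases n with
  | zero =>
    rw [barD_zero, LinearMap.sub_apply, map_sub, ← firstFace_bact]
    refine Eq.trans ?_ (𝓗.hochB_zero (𝓗.firstS 0 x)).symm
    exact congrArg (𝓗.r.ε (𝓗.firstS 0 x) - ·) (𝓗.ε_blast x)
  | succ n =>
    rw [barD_succ, LinearMap.sub_apply, map_sub, ← firstFace_bact]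
    refine Eq.trans ?_ (𝓗.bS_apply n _).symm
    exact congrArg (𝓗.firstS n (𝓗.firstS (n + 1) x) - ·) (𝓗.firstS_bmap n x)

theorem hochB_barD (n : ℕ) (x : 𝓗.barObj (n + 1)) :
    𝓗.hochB n (𝓗.barD n x) = 𝓗.firstFace n (𝓗.barD n x) := by
  cases n with
  | zero =>
    refine (𝓗.hochB_zero (𝓗.barD 0 x)).trans ?_
    rw [ν_barD, sub_zero]
    rfl
  | succ n =>
    refine (𝓗.bS_apply n _).trans ?_
    have h : 𝓗.barD n (𝓗.barD (n + 1) x) = 0 := LinearMap.congr_fun (𝓗.barD_comp n) x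
    rw [h, sub_zero]
    rfl

theorem hochB_bS (n : ℕ) (x : 𝓗.barObj (n + 1)) : 𝓗.hochB n (𝓗.bS n x) = 0 := by
  rw [bS_apply, map_sub, hochB_barD, firstFace_barD, sub_self]

theorem εr_algebraMap_mul (c : k) (h : H) : 𝓗.r.ε (algebraMap k H c * h) = c • 𝓗.r.ε h := by
  have h1 : algebraMap k H c = 𝓗.sr (algebraMap k Ar c) := (𝓗.r.s.commutes c).symm
  rw [Algebra.commutes, h1, εr_mul_sr, ← Algebra.commutes, Algebra.smul_def]

theorem ν_algebraMap_mul (c : k) (h : H) : 𝓗.ν (algebraMap k H c * h) = c • 𝓗.ν h := by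
  have h1 : algebraMap k H c = 𝓗.sr (algebraMap k Ar c) := (𝓗.r.s.commutes c).symm
  rw [h1, ν_sr_mul, Algebra.smul_def]

theorem firstFace_algebraMap (n : ℕ) (c : k) (x : 𝓗.barObj n) :
    𝓗.firstFace n (algebraMap k H c • x) = c • 𝓗.firstFace n x := by
  cases n with
  | zero => exact 𝓗.εr_algebraMap_mul c x
  | succ n =>
    have h1 : ((𝓗.firstS n).comp
        (Module.toAddMonoidEnd H (𝓗.barObj (n + 1)) (algebraMap k H c)) :
        𝓗.Ind (𝓗.barObj n) →+ 𝓗.barObj n) =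
        (Module.toAddMonoidEnd H (𝓗.barObj n) (algebraMap k H c)).comp (𝓗.firstS n) :=
      𝓗.ind_hom_ext fun h' y => by
        change 𝓗.sr (𝓗.r.ε (algebraMap k H c * h')) • y =
          algebraMap k H c • 𝓗.sr (𝓗.r.ε h') • y
        have h : algebraMap k H c = 𝓗.sr (algebraMap k Ar c) := (𝓗.r.s.commutes c).symm
        rw [Algebra.commutes, h, εr_mul_sr, map_mul, ← h, ← Algebra.commutes, mul_smul]
    exact DFunLike.congr_fun h1 x

theorem hochB_algebraMap (n : ℕ) (c : k) (x : 𝓗.barObj n) :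
    𝓗.hochB n (algebraMap k H c • x) = c • 𝓗.hochB n x := by
  cases n with
  | zero =>
    refine (𝓗.hochB_zero _).trans (Eq.trans ?_ (congrArg (c • ·) (𝓗.hochB_zero x)).symm)
    refine Eq.trans ?_ (smul_sub c (𝓗.r.ε x) (𝓗.ν x)).symm
    exact congrArg₂ (fun a b : Ar => a - b) (𝓗.εr_algebraMap_mul c x) (𝓗.ν_algebraMap_mul c x)
  | succ n =>
    refine (𝓗.bS_apply n _).trans ?_
    refine Eq.trans ?_ (congrArg (algebraMap k H c • ·) (𝓗.bS_apply n x)).symm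
    refine Eq.trans ?_ (smul_sub _ _ _).symm
    exact congrArg₂ (fun a b => a - b) (𝓗.firstFace_algebraMap (n + 1) c x)
      ((𝓗.barD n).map_smul (algebraMap k H c) x)

/-- The Hochschild differential `Cₙ₊₁(H) → Cₙ(H)` as a `k`-linear map. -/
def hochD (n : ℕ) : 𝓗.hochX (n + 1) ⟶ 𝓗.hochX n :=
  ModuleCat.ofHom (X := 𝓗.hochX (n + 1)) (Y := 𝓗.hochX n)
    { toFun := 𝓗.hochB n
      map_add' := (𝓗.hochB n).map_add
      map_smul' := 𝓗.hochB_algebraMap n }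

/-- The Hochschild chain complex `(C_•(H), b)`. -/
def hoch : ChainComplex (ModuleCat.{u} k) ℕ :=
  ChainComplex.of 𝓗.hochX 𝓗.hochD (fun n => by
    ext x
    exact 𝓗.hochB_bS n x)

/-- The Hochschild homology `HHₙ(H)`. -/
def HH (n : ℕ) : ModuleCat.{u} k := 𝓗.hoch.homology n

/-- `Aᵣ ⊗_H Barₙ(H) → Cₙ(H)`, `a ⊗ x ↦ d₀(sᵣ(a) x)`. -/
def barToHochAux (n : ℕ) : 𝓗.trivRight.tensorFunctor.obj (𝓗.barObj n) ⟶ 𝓗.hochX n :=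
  ModuleCat.ofHom (𝓗.trivRight.lift
    { toFun := fun a => (𝓗.firstFace n).comp (Module.toAddMonoidEnd H (𝓗.barObj n) (𝓗.sr a))
      map_add' := fun a b => by
        ext x
        change 𝓗.firstFace n (𝓗.sr (a + b) • x) =
          𝓗.firstFace n (𝓗.sr a • x) + 𝓗.firstFace n (𝓗.sr b • x)
        rw [map_add, add_smul, map_add]
      map_smul' := fun c a => by
        ext x
        change 𝓗.firstFace n (𝓗.sr (c • a) • x) = c • 𝓗.firstFace n (𝓗.sr a • x)
        have h : algebraMap k H c = 𝓗.sr (algebraMap k Ar c) := (𝓗.r.s.commutes c).symm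
        rw [← firstFace_algebraMap, Algebra.smul_def, map_mul, ← h, mul_smul] }
    (fun a h x => by
      change 𝓗.firstFace n (𝓗.sr (𝓗.r.ε (𝓗.sr a * h)) • x) = 𝓗.firstFace n (𝓗.sr a • (h • x))
      rw [firstFace_smul, mul_smul]))

/-- The isomorphism of complexes `Aᵣ ⊗_H Bar_•(H) → C_•(H)`, as a chain map: it sends
`a ⊗ h⁰ ⊗ ⋯ ⊗ hⁿ` to `sᵣ(εᵣ(sᵣ(a) h⁰)) h¹ ⊗ ⋯ ⊗ hⁿ` for `n ≥ 1`, and `a ⊗ h⁰` to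
`εᵣ(sᵣ(a) h⁰)` for `n = 0`. -/
def barToHoch : (𝓗.trivRight.tensorFunctor.mapHomologicalComplex (ComplexShape.down ℕ)).obj 𝓗.bar ⟶
    𝓗.hoch where
  f n := 𝓗.barToHochAux n
  comm' i j hij := by
    obtain rfl : j + 1 = i := hij
    have h1 : 𝓗.bar.d (j + 1) j = ModuleCat.ofHom (𝓗.barD j) := 
      ChainComplex.of_d 𝓗.barObj (fun n => ModuleCat.ofHom (𝓗.barD n)) j
    have h2 : 𝓗.hoch.d (j + 1) j = 𝓗.hochD j := ChainComplex.of_d 𝓗.hochX _ j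
    rw [Functor.mapHomologicalComplex_obj_d, h1, h2]
    ext1
    refine 𝓗.trivRight.ten_ext fun a x => ?_
    change 𝓗.hochB j (𝓗.firstS j (𝓗.sr a • x)) = 𝓗.firstFace j (𝓗.sr a • 𝓗.barD j x)
    refine (𝓗.firstFace_barD j _).symm.trans (congrArg (𝓗.firstFace j) ?_)
    exact (𝓗.barD j).map_smul (𝓗.sr a) x

/-- `H` is projective as a left `Aᵣ`-module, via `a·h = sᵣ(a) h`. -/
def IsProj : Prop :=
  letI : Module Ar H := Module.compHom H 𝓗.sr
  Module.Projective Ar H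

end HopfAlgebroid

end HopfAlgd

end

-- Cohomology. Both sides are governed by Ext groups of comodules. A map of comodules from `A` to
-- `N` is determined by the image of `1`, which can be any element with coaction `n ↦ 1 ⊗ n`; these
-- elements form `A □ N`. So `A □ -` is Hom(A, -), corepresented by `A`, and the derived functors in
-- question compute Ext(A, A). The cobar complex is a coresolution of `A`: the map `ε ⊗ id`
-- contracts it, linearly over `A`, and flatness allows exactness to be tested on underlying
-- modules. Its terms are acyclic for Hom(A, -). Each is cofree or, in degree 0, a retract of a
-- cofree comodule. A comodule map from `A` to the cofree comodule on `N` is an `A`-linear map from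
-- `A` to `N`, and these form an exact functor of `N`; dimension shifting along an embedding of `N`
-- into an injective module then kills all higher Ext.
--
-- To obtain the statement for every comparison map `g`, and not only an abstract isomorphism, Ext
-- classes are attached to cocycles. Splicing the sequences Zⁿ → Kⁿ → Zⁿ⁺¹ of a coresolution `K` of
-- `X` gives a Yoneda class in Extⁿ(Zⁿ, X), so a cocycle T → Kⁿ has a class in Extⁿ(T, X). This
-- class is natural in `K` (`cls_map`) and vanishes on coboundaries. If `K` is acyclic for Hom(T,
-- -), every class is attained and a cocycle of class zero is a coboundary. Hence every map under
-- `X` between acyclic coresolutions induces an isomorphism, and two such maps induce the same one.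
-- Finally the primitive elements of Cobarⁿ are exactly those of the form `1 ⊗ x` (or `t(a)`), which
-- identifies the Hochschild complex with `A □ Cobar`.
--
-- Homology. The bar complex is a projective resolution of `Aₗ`. Its terms are induced modules `H
-- ⊗_{Aᵣ} N`, projective as soon as `N` is projective over `Aᵣ`, and `x ↦ 1 ⊗ x` contracts it. At
-- the augmented end the contraction works because `sᵣ εᵣ S⁻¹ = tₗ εₗ` (`sr_ν`), an identity that
-- comes from the antipode axioms. Applying `Aᵣ ⊗_H -` cancels the first factor and leaves the
-- Hochschild complex; independence of the choices is the comparison theorem for projective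
-- resolutions.

universe v w v'

noncomputable section

namespace HopfAlgd

open Limits Abelian

/-! ### Homology of complexes of modules, on elements -/

section ModuleHomology

variable {k : Type u} [Ring k] {ι : Type*} {c : ComplexShape ι}
  {M N : HomologicalComplex (ModuleCat.{u} k) c}

theorem homologyπ_surjective (M : HomologicalComplex (ModuleCat.{u} k) c) (n : ι) :
    Function.Surjective (M.homologyπ n) :=
  (ModuleCat.epi_iff_surjective _).1 inferInstance

theorem d_iCycles (M : HomologicalComplex (ModuleCat.{u} k) c) (n : ι) (z : M.cycles n) :
    M.d n (c.next n) (M.iCycles n z) = 0 :=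
  ConcreteCategory.congr_hom (M.iCycles_d n (c.next n)) z

theorem exists_iCycles_eq (M : HomologicalComplex (ModuleCat.{u} k) c) (n : ι) (x : M.X n)
    (hx : M.d n (c.next n) x = 0) : ∃ z : M.cycles n, M.iCycles n z = x :=
  ⟨(M.sc n).moduleCatCyclesIso.inv ⟨x, hx⟩,
    (M.sc n).moduleCatCyclesIso_inv_iCycles_apply ⟨x, hx⟩⟩

/-- Homology is the cokernel of the map from the preceding term to the cycles, and the inclusion of
cycles is injective, so the equation can be checked in the ambient module. If `n` has no predecessor
then `c.prev n = n` and the differential is zero, so the right side says that the cycle is zero. -/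
theorem homologyπ_eq_zero_iff (M : HomologicalComplex (ModuleCat.{u} k) c) (n : ι)
    (z : M.cycles n) :
    M.homologyπ n z = 0 ↔ ∃ y, M.d (c.prev n) n y = M.iCycles n z := by
  have hS : (ShortComplex.mk (M.toCycles (c.prev n) n) (M.homologyπ n)
      (M.toCycles_comp_homologyπ _ _)).Exact :=
    ShortComplex.exact_of_g_is_cokernel _ (M.homologyIsCokernel (c.prev n) n rfl)
  have hmono : Function.Injective (M.iCycles n) :=
    (ModuleCat.mono_iff_injective _).1 inferInstance
  have hi : ∀ y, M.iCycles n (M.toCycles (c.prev n) n y) = M.d (c.prev n) n y :=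
    fun y => ConcreteCategory.congr_hom (M.toCycles_i (c.prev n) n) y
  constructor
  · intro h
    obtain ⟨y, hy⟩ := (ShortComplex.moduleCat_exact_iff _).1 hS z h
    exact ⟨y, by rw [← hi]; exact congrArg _ hy⟩
  · rintro ⟨y, hy⟩
    have : M.toCycles (c.prev n) n y = z := hmono (by rw [hi, hy])
    rw [← this]
    exact ConcreteCategory.congr_hom (M.toCycles_comp_homologyπ (c.prev n) n) y

theorem homologyMap_homologyπ (f : M ⟶ N) (n : ι) (z : M.cycles n) :
    HomologicalComplex.homologyMap f n (M.homologyπ n z) =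
      N.homologyπ n (HomologicalComplex.cyclesMap f n z) :=
  ConcreteCategory.congr_hom (HomologicalComplex.homologyπ_naturality f n) z

theorem iCycles_cyclesMap (f : M ⟶ N) (n : ι) (z : M.cycles n) :
    N.iCycles n (HomologicalComplex.cyclesMap f n z) = f.f n (M.iCycles n z) :=
  ConcreteCategory.congr_hom (HomologicalComplex.cyclesMap_i f n) z

/-- A chain map which is injective and surjective on homology classes in degree `n` induces an
isomorphism on homology in degree `n`. -/
theorem isIso_homologyMap (f : M ⟶ N) (n : ι)
    (hinj : ∀ x, M.d n (c.next n) x = 0 → (∃ y, N.d (c.prev n) n y = f.f n x) →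
      ∃ y, M.d (c.prev n) n y = x)
    (hsurj : ∀ z, N.d n (c.next n) z = 0 →
      ∃ x, M.d n (c.next n) x = 0 ∧ ∃ y, N.d (c.prev n) n y = z - f.f n x) :
    IsIso (HomologicalComplex.homologyMap f n) := by
  rw [ConcreteCategory.isIso_iff_bijective]
  constructor
  · refine (injective_iff_map_eq_zero (HomologicalComplex.homologyMap f n).hom).2 fun x hx => ?_
    obtain ⟨z, rfl⟩ := homologyπ_surjective M n x
    have h : N.homologyπ n (HomologicalComplex.cyclesMap f n z) = 0 :=
      (homologyMap_homologyπ f n z).symm.trans hx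
    rw [homologyπ_eq_zero_iff, iCycles_cyclesMap] at h
    exact (homologyπ_eq_zero_iff M n z).2 (hinj _ (d_iCycles M n z) h)
  · intro x
    obtain ⟨z, rfl⟩ := homologyπ_surjective N n x
    obtain ⟨x, hx, y, hy⟩ := hsurj _ (d_iCycles N n z)
    obtain ⟨z', rfl⟩ := exists_iCycles_eq M n x hx
    refine ⟨M.homologyπ n z', ?_⟩
    rw [homologyMap_homologyπ, eq_comm, ← sub_eq_zero, ← map_sub, homologyπ_eq_zero_iff]
    exact ⟨y, by rw [hy, map_sub, iCycles_cyclesMap]⟩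

/-- Two chain maps which agree on cycles up to boundaries induce the same map on homology. -/
theorem homologyMap_eq (f g : M ⟶ N) (n : ι)
    (h : ∀ x, M.d n (c.next n) x = 0 → ∃ y, N.d (c.prev n) n y = f.f n x - g.f n x) :
    HomologicalComplex.homologyMap f n = HomologicalComplex.homologyMap g n := by
  ext x
  obtain ⟨z, rfl⟩ := homologyπ_surjective M n x
  change HomologicalComplex.homologyMap f n (M.homologyπ n z) =
    HomologicalComplex.homologyMap g n (M.homologyπ n z)
  rw [homologyMap_homologyπ, homologyMap_homologyπ, ← sub_eq_zero, ← map_sub,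
    homologyπ_eq_zero_iff, map_sub, iCycles_cyclesMap, iCycles_cyclesMap]
  exact h _ (d_iCycles M n z)

end ModuleHomology

/-! ### Coresolutions and Yoneda classes -/

variable {C : Type v} [Category.{w} C] [Abelian C]

/-- The complex `K` is a coresolution of `X` by means of `η : X ⟶ K.X 0`. -/
structure IsCoresolution {X : C} (K : CochainComplex C ℕ) (η : X ⟶ K.X 0) : Prop where
  mono : Mono η
  comp_d : η ≫ K.d 0 1 = 0
  exact₀ : (ShortComplex.mk η (K.d 0 1) comp_d).Exact
  exactAt : ∀ n, K.ExactAt (n + 1)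

theorem isCoresolution_of_injectiveResolution {X : C} (I : InjectiveResolution X) :
    IsCoresolution I.cocomplex (X := X) (I.ι.f 0) where
  mono := inferInstanceAs (Mono (I.ι.f 0))
  comp_d := I.ι_f_zero_comp_complex_d
  exact₀ := I.exact₀
  exactAt := I.cocomplex_exactAt_succ

namespace IsCoresolution

variable {X : C} {K L : CochainComplex C ℕ} {η : X ⟶ K.X 0} {θ : X ⟶ L.X 0}

theorem iCycles_toCycles (K : CochainComplex C ℕ) (n : ℕ) :
    K.iCycles n ≫ K.toCycles n (n + 1) = 0 := by
  rw [← cancel_mono (K.iCycles (n + 1))]; simp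

/-- The short complex `Zⁿ ⟶ Kⁿ ⟶ Zⁿ⁺¹`. -/
abbrev cyclesSES (K : CochainComplex C ℕ) (n : ℕ) : ShortComplex C :=
  ShortComplex.mk (K.iCycles n) (K.toCycles n (n + 1)) (iCycles_toCycles K n)

/-- The morphism of short complexes induced by a morphism of complexes. -/
abbrev cyclesSESMap (f : K ⟶ L) (n : ℕ) : cyclesSES K n ⟶ cyclesSES L n where
  τ₁ := HomologicalComplex.cyclesMap f n
  τ₂ := f.f n
  τ₃ := HomologicalComplex.cyclesMap f (n + 1)
  comm₁₂ := by simp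
  comm₂₃ := by
    dsimp
    rw [← cancel_mono (L.iCycles (n + 1))]
    simp

/-- Zⁿ is the kernel of Kⁿ → Zⁿ⁺¹ in any complex; only surjectivity onto Zⁿ⁺¹ uses exactness, in
degree `n + 1`. -/
theorem shortExact (hK : IsCoresolution K η) (n : ℕ) : (cyclesSES K n).ShortExact where
  exact := by
    refine ShortComplex.exact_of_f_is_kernel _ (KernelFork.IsLimit.ofι _ _
      (fun {A} x hx => K.liftCycles x (n + 1) (by simp) ?_) (fun x hx => by simp)
      (fun x hx m hm => ?_))
    · rw [← K.toCycles_i n (n + 1), ← Category.assoc]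
      exact (hx =≫ K.iCycles (n + 1)).trans zero_comp
    · rw [← cancel_mono (K.iCycles n)]
      simpa using hm
  mono_f := inferInstanceAs (Mono (K.iCycles n))
  epi_g := by
    have h := hK.exactAt n
    rw [HomologicalComplex.exactAt_iff, ShortComplex.exact_iff_epi_toCycles] at h
    -- `prev (n + 1)` equals `n` only propositionally and occurs in the type of the map, so the
    -- index is generalized before it is replaced.
    have h' : ∀ p, (ComplexShape.up ℕ).prev (n + 1) = p → Epi (K.toCycles p (n + 1)) := by
      rintro _ rfl
      exact h
    exact h' n (by simp)

/-- The isomorphism `Z⁰ ⟶ X`. -/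
def fromCycles (hK : IsCoresolution K η) : K.cycles 0 ⟶ X :=
  haveI := hK.mono
  hK.exact₀.lift (K.iCycles 0) (by simp)

theorem fromCycles_comp (hK : IsCoresolution K η) : hK.fromCycles ≫ η = K.iCycles 0 :=
  haveI := hK.mono
  hK.exact₀.lift_f _ _

variable [HasExt.{v'} C]

/-- The Yoneda class of `0 ⟶ X ⟶ K⁰ ⟶ ⋯ ⟶ Kⁿ⁻¹ ⟶ Zⁿ ⟶ 0`. -/
def yoneda (hK : IsCoresolution K η) : ∀ n : ℕ, Ext.{v'} (K.cycles n) X n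
  | 0 => Ext.mk₀ hK.fromCycles
  | n + 1 => (hK.shortExact n).extClass.comp (hK.yoneda n) (add_comm 1 n)

/-- In degree 0 this follows by cancelling the monomorphism `θ`. Each further degree adds one
extension class, which is natural along the map of sequences Zⁿ → Kⁿ → Zⁿ⁺¹. -/
theorem yoneda_naturality (hK : IsCoresolution K η) (hL : IsCoresolution L θ) (f : K ⟶ L)
    (hf : η ≫ f.f 0 = θ) (n : ℕ) :
    (Ext.mk₀ (HomologicalComplex.cyclesMap f n)).comp (hL.yoneda n) (zero_add n) =
      hK.yoneda n := by
  induction n with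
  | zero =>
    have := hL.mono
    simp only [yoneda, Ext.mk₀_comp_mk₀]
    congr 1
    rw [← cancel_mono θ, Category.assoc, fromCycles_comp, HomologicalComplex.cyclesMap_i, ← hf,
      ← Category.assoc, fromCycles_comp]
  | succ n ih =>
    have h := ShortComplex.ShortExact.extClass_naturality (hK.shortExact n) (hL.shortExact n)
      (cyclesSESMap f n)
    dsimp only [yoneda]
    rw [← ih, ← Ext.comp_assoc (a₁₂ := 1) _ _ _ (by omega) (by omega) (by omega)]
    refine (congrArg (fun e => e.comp (hL.yoneda n) (add_comm 1 n)) h.symm).trans ?_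
    exact Ext.comp_assoc _ _ _ (add_zero 1) (zero_add n) (by omega)

variable {T : C}

/-- Dimension shifting: since the positive Ext groups from `T` to Kⁿ vanish, the connecting maps
Extⁱ⁺¹(T, Zⁿ⁺¹) → Extⁱ⁺²(T, Zⁿ) are bijective, and the Yoneda class is their composite down to Z⁰ ≅
X. Degrees start at `i + 1` because Hom(T, Kⁿ) need not vanish; `i` and `m` are quantified inside
since the induction on `n` raises `i`. -/
theorem comp_yoneda_bijective (hK : IsCoresolution K η)
    (hac : ∀ n i (e : Ext.{v'} T (K.X n) (i + 1)), e = 0) (n : ℕ) :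
    ∀ (i m : ℕ) (h : i + 1 + n = m),
      (∀ e : Ext.{v'} T (K.cycles n) (i + 1), e.comp (hK.yoneda n) h = 0 → e = 0) ∧
      ∀ x : Ext.{v'} T X m, ∃ e : Ext.{v'} T (K.cycles n) (i + 1),
        e.comp (hK.yoneda n) h = x := by
  induction n with
  | zero =>
    intro i m h
    obtain rfl : i + 1 = m := h
    -- Exactness at K⁰ makes the lift of `η` to Z⁰ a two-sided inverse of `fromCycles`.
    have h1 : hK.fromCycles ≫ K.liftCycles η 1 (by simp) hK.comp_d = 𝟙 _ := by
      rw [← cancel_mono (K.iCycles 0)]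
      simp [fromCycles_comp]
    have h2 : K.liftCycles η 1 (by simp) hK.comp_d ≫ hK.fromCycles = 𝟙 _ := by
      have := hK.mono
      rw [← cancel_mono η]
      simp [fromCycles_comp]
    refine ⟨fun e he => ?_, fun x => ⟨x.comp (Ext.mk₀ (K.liftCycles η 1 (by simp) hK.comp_d))
      (add_zero _), ?_⟩⟩
    · rw [← e.comp_mk₀_id, ← h1, ← Ext.mk₀_comp_mk₀,
        ← Ext.comp_assoc _ _ _ (add_zero (i + 1)) (add_zero 0) (by omega)]
      refine (congrArg (fun e' : Ext.{v'} T X (i + 1) => e'.comp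
        (Ext.mk₀ (K.liftCycles η 1 (by simp) hK.comp_d)) (add_zero (i + 1))) he).trans ?_
      exact Ext.zero_comp _ _ _ _ _
    · dsimp only [yoneda]
      rw [Ext.comp_assoc _ _ _ (add_zero (i + 1)) (add_zero 0) (by omega), Ext.mk₀_comp_mk₀, h2,
        Ext.comp_mk₀_id]
  | succ n ih =>
    intro i m h
    have key : ∀ e : Ext.{v'} T (K.cycles (n + 1)) (i + 1), e.comp (hK.yoneda (n + 1)) h =
        (e.comp (hK.shortExact n).extClass rfl).comp (hK.yoneda n) (by omega) := fun e =>
      (Ext.comp_assoc _ _ _ rfl (add_comm 1 n) (by omega)).symm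
    obtain ⟨ih1, ih2⟩ := ih (i + 1) m (by omega)
    refine ⟨fun e he => ?_, fun x => ?_⟩
    · rw [key] at he
      obtain ⟨y, hy⟩ := Ext.covariant_sequence_exact₃ T (hK.shortExact n) e rfl (ih1 _ he)
      rw [← hy, hac n i y]
      exact Ext.zero_comp _ _ _ _ _
    · obtain ⟨y, hy⟩ := ih2 x
      obtain ⟨e, he⟩ := Ext.covariant_sequence_exact₁ T (hK.shortExact n) y (hac n _ _) rfl
      exact ⟨e, by rw [key, he, hy]⟩

/-- The class in `Extⁿ(T, X)` of a cocycle `z : T ⟶ Kⁿ`. -/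
def cls (hK : IsCoresolution K η) (n : ℕ) (z : T ⟶ K.X n) (hz : z ≫ K.d n (n + 1) = 0) :
    Ext.{v'} T X n :=
  (Ext.mk₀ (K.liftCycles z (n + 1) (by simp) hz)).comp (hK.yoneda n) (zero_add n)

/-- The lift of `z ≫ f` to cycles is the lift of `z` followed by the map on cycles, so naturality of
the Yoneda classes applies. -/
theorem cls_map (hK : IsCoresolution K η) (hL : IsCoresolution L θ) (f : K ⟶ L)
    (hf : η ≫ f.f 0 = θ) (n : ℕ) (z : T ⟶ K.X n) (hz : z ≫ K.d n (n + 1) = 0) :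
    hL.cls n (z ≫ f.f n) (by simp [reassoc_of% hz]) = hK.cls n z hz := by
  rw [cls, cls, ← hK.yoneda_naturality hL f hf, ← Ext.comp_assoc _ _ _ (zero_add 0) (zero_add n)
    (by omega), Ext.mk₀_comp_mk₀]
  congr 2
  rw [← cancel_mono (L.iCycles n)]
  simp

theorem cls_sub (hK : IsCoresolution K η) (n : ℕ) (z z' : T ⟶ K.X n)
    (hz : z ≫ K.d n (n + 1) = 0) (hz' : z' ≫ K.d n (n + 1) = 0) :
    hK.cls n (z - z') (by rw [Preadditive.sub_comp, hz, hz', sub_zero]) =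
      hK.cls n z hz - hK.cls n z' hz' := by
  have h : K.liftCycles (z - z') (n + 1) (by simp)
        (by rw [Preadditive.sub_comp, hz, hz', sub_zero]) =
      K.liftCycles z (n + 1) (by simp) hz + -K.liftCycles z' (n + 1) (by simp) hz' := by
    rw [← cancel_mono (K.iCycles n)]
    simp [sub_eq_add_neg]
  rw [cls, h, Ext.mk₀_add, Ext.mk₀_neg, Ext.add_comp, Ext.neg_comp, sub_eq_add_neg]
  rfl

/-- The one connecting map not covered by `comp_yoneda_bijective`, Hom(T, Zⁿ⁺¹) → Ext¹(T, Zⁿ), is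
still surjective because Ext¹(T, Kⁿ) = 0. -/
theorem exists_cls_eq (hK : IsCoresolution K η)
    (hac : ∀ n i (e : Ext.{v'} T (K.X n) (i + 1)), e = 0) (n : ℕ) (x : Ext.{v'} T X n) :
    ∃ (z : T ⟶ K.X n) (hz : z ≫ K.d n (n + 1) = 0), hK.cls n z hz = x := by
  suffices h : ∃ z : Ext.{v'} T (K.cycles n) 0, z.comp (hK.yoneda n) (zero_add n) = x by
    obtain ⟨z, rfl⟩ := h
    obtain ⟨z, rfl⟩ := (Ext.mk₀_bijective _ _).2 z
    refine ⟨z ≫ K.iCycles n, by simp, ?_⟩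
    rw [cls]
    congr 2
    rw [← cancel_mono (K.iCycles n)]
    simp
  cases n with
  | zero =>
    obtain ⟨x, rfl⟩ := (Ext.mk₀_bijective _ _).2 x
    refine ⟨Ext.mk₀ (x ≫ K.liftCycles η 1 (by simp) hK.comp_d), ?_⟩
    rw [yoneda, Ext.mk₀_comp_mk₀]
    congr 1
    have := hK.mono
    rw [← cancel_mono η]
    simp [fromCycles_comp]
  | succ n =>
    obtain ⟨y, hy⟩ := (hK.comp_yoneda_bijective hac n 0 (n + 1) (by omega)).2 x
    obtain ⟨e, he⟩ := Ext.covariant_sequence_exact₁ T (hK.shortExact n) y (hac n _ _) rfl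
    refine ⟨e, ?_⟩
    dsimp only [yoneda]
    rw [← Ext.comp_assoc _ _ _ (zero_add 1) (add_comm 1 n) (by omega), ← hy]
    exact congrArg (fun e => Ext.comp e _ _) he

/-- The kernel of Hom(T, Zⁿ⁺¹) → Ext¹(T, Zⁿ) consists of the maps that factor through Kⁿ, which are
the coboundaries; the remaining shifts down to `X` are injective. -/
theorem exists_of_cls_eq_zero (hK : IsCoresolution K η)
    (hac : ∀ n i (e : Ext.{v'} T (K.X n) (i + 1)), e = 0) (n : ℕ) (z : T ⟶ K.X n)
    (hz : z ≫ K.d n (n + 1) = 0) (h : hK.cls n z hz = 0) :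
    ∃ y : T ⟶ K.X ((ComplexShape.up ℕ).prev n), y ≫ K.d _ n = z := by
  cases n with
  | zero =>
    rw [cls, yoneda, Ext.mk₀_comp_mk₀, Ext.mk₀_eq_zero_iff] at h
    -- In degree 0 there are no nonzero coboundaries, so it has to be shown that `z` itself is zero.
    refine ⟨0, ?_⟩
    have h1 := h =≫ η
    rw [Category.assoc, fromCycles_comp, HomologicalComplex.liftCycles_i, zero_comp] at h1
    rw [h1, zero_comp]
  | succ n =>
    rw [cls, yoneda, ← Ext.comp_assoc _ _ _ (zero_add 1) (add_comm 1 n) (by omega)] at h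
    have h1 := (hK.comp_yoneda_bijective hac n 0 (n + 1) (by omega)).1 _ h
    obtain ⟨y, hy⟩ := Ext.covariant_sequence_exact₃ T (hK.shortExact n) _ _ h1
    obtain ⟨y, rfl⟩ := (Ext.mk₀_bijective _ _).2 y
    rw [Ext.mk₀_comp_mk₀] at hy
    have h2 := (Ext.mk₀_bijective _ _).1 hy =≫ K.iCycles (n + 1)
    dsimp at h2
    rw [Category.assoc, HomologicalComplex.toCycles_i, HomologicalComplex.liftCycles_i] at h2
    -- Again `prev (n + 1)` is replaced by a variable so that it can be substituted by `n`.
    obtain ⟨p, hp⟩ : ∃ p, (ComplexShape.up ℕ).prev (n + 1) = p := ⟨_, rfl⟩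
    rw [hp]
    obtain rfl : n = p := by rw [← hp]; simp
    exact ⟨y, h2⟩

/-- A coboundary lifts to a map into Zⁿ⁺¹ that factors through Kⁿ, and the extension class of Zⁿ →
Kⁿ → Zⁿ⁺¹ restricts to zero along Kⁿ → Zⁿ⁺¹. -/
theorem cls_d_eq_zero (hK : IsCoresolution K η) (n : ℕ)
    (y : T ⟶ K.X ((ComplexShape.up ℕ).prev n)) :
    hK.cls n (y ≫ K.d _ n) (by simp) = 0 := by
  obtain ⟨p, hp⟩ : ∃ p, (ComplexShape.up ℕ).prev n = p := ⟨_, rfl⟩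
  revert y
  rw [hp]
  intro y
  cases n with
  | zero =>
    obtain rfl : 0 = p := by rw [← hp]; simp
    have h : y ≫ K.d 0 0 = 0 := by simp
    rw [cls, Ext.mk₀_eq_zero_iff _ |>.2, Ext.zero_comp]
    rw [← cancel_mono (K.iCycles 0)]
    simp
  | succ n =>
    obtain rfl : n = p := by rw [← hp]; simp
    have h : K.liftCycles (y ≫ K.d n (n + 1)) (n + 1 + 1) (by simp) (by simp) =
        y ≫ (cyclesSES K n).g := by
      rw [← cancel_mono (K.iCycles (n + 1))]
      simp
    rw [cls, h, ← Ext.mk₀_comp_mk₀, yoneda, Ext.comp_assoc _ _ _ (zero_add 0) (zero_add (n + 1))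
      (by omega), ShortComplex.ShortExact.comp_extClass_assoc, Ext.comp_zero]

end IsCoresolution

/-! ### Homology of the image of a complex under an additive functor to modules -/

section mapHomologicalComplex

variable {k : Type u} [Ring k] (F : C ⥤ ModuleCat.{u} k) [F.Additive] {K L : CochainComplex C ℕ}

/-- The outgoing differential is written with `n + 1`, as in the cocycle condition of `cls`. The
incoming one keeps `prev n`, so that degree 0 needs no separate statement. -/
theorem isIso_homologyMap_mapHomologicalComplex (f : K ⟶ L) (n : ℕ)
    (hinj : ∀ x : F.obj (K.X n), F.map (K.d n (n + 1)) x = 0 →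
      (∃ y, F.map (L.d ((ComplexShape.up ℕ).prev n) n) y = F.map (f.f n) x) →
      ∃ y, F.map (K.d ((ComplexShape.up ℕ).prev n) n) y = x)
    (hsurj : ∀ z : F.obj (L.X n), F.map (L.d n (n + 1)) z = 0 →
      ∃ x, F.map (K.d n (n + 1)) x = 0 ∧
        ∃ y, F.map (L.d ((ComplexShape.up ℕ).prev n) n) y = z - F.map (f.f n) x) :
    IsIso (HomologicalComplex.homologyMap
      ((F.mapHomologicalComplex (ComplexShape.up ℕ)).map f) n) := by
  have hn : n + 1 = (ComplexShape.up ℕ).next n := by simp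
  rw [hn] at hinj hsurj
  exact isIso_homologyMap _ n hinj hsurj

theorem homologyMap_mapHomologicalComplex_eq (f g : K ⟶ L) (n : ℕ)
    (h : ∀ x : F.obj (K.X n), F.map (K.d n (n + 1)) x = 0 →
      ∃ y, F.map (L.d ((ComplexShape.up ℕ).prev n) n) y = F.map (f.f n) x - F.map (g.f n) x) :
    HomologicalComplex.homologyMap ((F.mapHomologicalComplex (ComplexShape.up ℕ)).map f) n =
      HomologicalComplex.homologyMap ((F.mapHomologicalComplex (ComplexShape.up ℕ)).map g) n := by
  have hn : n + 1 = (ComplexShape.up ℕ).next n := by simp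
  rw [hn] at h
  exact homologyMap_eq _ _ n h

end mapHomologicalComplex

/-! ### Comparison of acyclic coresolutions -/

namespace IsCoresolution

variable {X : C} {K L : CochainComplex C ℕ} {η : X ⟶ K.X 0} {θ : X ⟶ L.X 0}

theorem exact_succ (hK : IsCoresolution K η) (n : ℕ) :
    (ShortComplex.mk (K.d n (n + 1)) (K.d (n + 1) (n + 2)) (K.d_comp_d _ _ _)).Exact :=
  ((K.exactAt_iff' n (n + 1) (n + 2) (by simp) (by simp)).1 (hK.exactAt n) :)

/-- The identity of `X` extends to a map from any coresolution to an injective resolution. -/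
theorem exists_hom (hK : IsCoresolution K η) (I : InjectiveResolution X) :
    ∃ g : K ⟶ I.cocomplex, η ≫ g.f 0 = I.ι.f 0 := by
  have := hK.mono
  -- The source of `I.ι.f 0` is the degree 0 term of a single complex, which is `X` only after
  -- unfolding; `ι₀` fixes the type.
  let ι₀ : X ⟶ I.cocomplex.X 0 := I.ι.f 0
  have hι : ι₀ ≫ I.cocomplex.d 0 1 = 0 := I.ι_f_zero_comp_complex_d
  let g₀ : K.X 0 ⟶ I.cocomplex.X 0 := Injective.factorThru ι₀ η
  have hg₀ : η ≫ g₀ = ι₀ := Injective.comp_factorThru _ _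
  let g₁ : K.X 1 ⟶ I.cocomplex.X 1 := hK.exact₀.descToInjective (g₀ ≫ I.cocomplex.d 0 1)
    (by dsimp; rw [reassoc_of% hg₀, hι])
  have hg₁ : K.d 0 1 ≫ g₁ = g₀ ≫ I.cocomplex.d 0 1 := hK.exact₀.comp_descToInjective _ _
  -- The composite of the last component built with the differential of the resolution vanishes on
  -- the image of the preceding differential of `K`. By exactness of `K` and injectivity of the
  -- target, it extends along the next differential.
  refine ⟨CochainComplex.mkHom _ _ g₀ g₁ hg₁.symm fun n p =>
    ⟨(hK.exact_succ n).descToInjective (p.2.1 ≫ I.cocomplex.d (n + 1) (n + 2))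
      (by dsimp; rw [← reassoc_of% p.2.2]; simp), ?_⟩, ?_⟩
  · exact ((hK.exact_succ n).comp_descToInjective _ _).symm
  · exact hg₀

variable {k : Type u} [Ring k] {F : C ⥤ ModuleCat.{u} k} [F.Additive] {T : C}
  [HasExt.{v'} C]

/-- Two maps from a coresolution of `X` to an acyclic coresolution of `X` which extend the
identity of `X` induce the same map on the homology of the images by a corepresentable functor. -/
theorem homologyMap_eq (φ : ∀ N, F.obj N ≃+ (T ⟶ N))
    (hφ : ∀ {N N' : C} (f : N ⟶ N') (x : F.obj N), φ N' (F.map f x) = φ N x ≫ f)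
    (hK : IsCoresolution K η) (hL : IsCoresolution L θ)
    (hacL : ∀ n i (e : Ext.{v'} T (L.X n) (i + 1)), e = 0) (f g : K ⟶ L)
    (hf : η ≫ f.f 0 = θ) (hg : η ≫ g.f 0 = θ) (n : ℕ) :
    HomologicalComplex.homologyMap ((F.mapHomologicalComplex (ComplexShape.up ℕ)).map f) n =
      HomologicalComplex.homologyMap ((F.mapHomologicalComplex (ComplexShape.up ℕ)).map g) n := by
  refine homologyMap_mapHomologicalComplex_eq F f g n fun x hx => ?_
  have hz : φ _ x ≫ K.d n (n + 1) = 0 := by rw [← hφ, hx, map_zero]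
  -- Both images have the class of `x` itself, computed in `K`, so their difference has class zero
  -- and is a coboundary in the acyclic complex `L`.
  obtain ⟨y, hy⟩ := hL.exists_of_cls_eq_zero hacL n (φ _ x ≫ f.f n - φ _ x ≫ g.f n)
    (by simp [reassoc_of% hz])
    (by
      rw [hL.cls_sub n _ _ (by simp [reassoc_of% hz]) (by simp [reassoc_of% hz]),
        hK.cls_map hL f hf n _ hz, hK.cls_map hL g hg n _ hz, sub_self])
  refine ⟨(φ _).symm y, (φ _).injective ?_⟩
  rw [hφ, AddEquiv.apply_symm_apply, hy, map_sub, hφ, hφ]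

/-- A map between acyclic coresolutions of `X` which extends the identity of `X` induces
isomorphisms on the homology of the images by a corepresentable functor. -/
theorem isIso_homologyMap (φ : ∀ N, F.obj N ≃+ (T ⟶ N))
    (hφ : ∀ {N N' : C} (f : N ⟶ N') (x : F.obj N), φ N' (F.map f x) = φ N x ≫ f)
    (hK : IsCoresolution K η) (hL : IsCoresolution L θ)
    (hacK : ∀ n i (e : Ext.{v'} T (K.X n) (i + 1)), e = 0)
    (hacL : ∀ n i (e : Ext.{v'} T (L.X n) (i + 1)), e = 0) (f : K ⟶ L)
    (hf : η ≫ f.f 0 = θ) (n : ℕ) :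
    IsIso (HomologicalComplex.homologyMap
      ((F.mapHomologicalComplex (ComplexShape.up ℕ)).map f) n) := by
  refine isIso_homologyMap_mapHomologicalComplex F f n (fun x hx ⟨y, hy⟩ => ?_) (fun x hx => ?_)
  · have hz : φ _ x ≫ K.d n (n + 1) = 0 := by rw [← hφ, hx, map_zero]
    have hy' : φ _ y ≫ L.d _ n = φ _ x ≫ f.f n := by rw [← hφ, ← hφ, hy]
    -- The class of `x` in `K` equals that of its image in `L`, which is a coboundary and has class
    -- zero.
    obtain ⟨t, ht⟩ := hK.exists_of_cls_eq_zero hacK n (φ _ x) hz (by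
      rw [← hK.cls_map hL f hf n _ hz]
      simp only [← hy']
      exact hL.cls_d_eq_zero n _)
    refine ⟨(φ _).symm t, (φ _).injective ?_⟩
    rw [hφ, AddEquiv.apply_symm_apply, ht]
  · have hz : φ _ x ≫ L.d n (n + 1) = 0 := by rw [← hφ, hx, map_zero]
    -- The preimage is any cocycle of `K` that represents the class of `x`; its image and `x` have
    -- the same class, so they differ by a coboundary of `L`.
    obtain ⟨w, hw, hwx⟩ := hK.exists_cls_eq hacK n (hL.cls n (φ _ x) hz)
    obtain ⟨y, hy⟩ := hL.exists_of_cls_eq_zero hacL n (φ _ x - w ≫ f.f n)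
      (by simp [reassoc_of% hw, hz])
      (by
        rw [hL.cls_sub n _ _ hz (by simp [reassoc_of% hw]), hK.cls_map hL f hf n _ hw, hwx,
          sub_self])
    refine ⟨(φ _).symm w, (φ _).injective ?_, (φ _).symm y, (φ _).injective ?_⟩
    · rw [hφ, AddEquiv.apply_symm_apply, hw, map_zero]
    · rw [hφ, AddEquiv.apply_symm_apply, hy, map_sub, hφ, AddEquiv.apply_symm_apply]

end IsCoresolution

end HopfAlgd

end

/-! ### Cofree comodules and exactness -/

noncomputable section

namespace HopfAlgd

open Limits Abelian

namespace Coring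

variable {A M : Type u} [Ring A] [AddCommGroup M] {β : Bimod A M}

instance {C : Coring β} : C.comonad.cofree.PreservesZeroMorphisms where
  map_zero X Y := by
    apply Comonad.Coalgebra.Hom.ext
    exact C.comonad.toFunctor.map_zero X Y

/-- By the adjunction between the forgetful and the cofree functor, a comodule map from `T` to a
cofree comodule is a linear map out of the underlying module of `T`, which lifts along epimorphisms
by projectivity. -/
theorem exists_lift_cofree {C : Coring β} (T : C.Comod) [Projective T.A]
    (S : ShortComplex (ModuleCat.{u} A)) (hS : Epi S.g) (x : T ⟶ (S.map C.comonad.cofree).X₃) :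
    ∃ y : T ⟶ (S.map C.comonad.cofree).X₂, y ≫ (S.map C.comonad.cofree).g = x := by
  let x' : C.comonad.forget.obj T ⟶ S.X₃ := (C.comonad.adj.homEquiv T S.X₃).symm x
  have : Projective (C.comonad.forget.obj T) := inferInstanceAs (Projective T.A)
  refine ⟨C.comonad.adj.homEquiv T S.X₂ (Projective.factorThru x' S.g), ?_⟩
  refine (C.comonad.adj.homEquiv_naturality_right (Projective.factorThru x' S.g) S.g).symm.trans ?_
  rw [Projective.factorThru_comp]
  exact (C.comonad.adj.homEquiv T S.X₃).apply_symm_apply x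

variable (C : Coring β) [β.IsFlat]

instance : PreservesFiniteLimits C.comonad.forget := ⟨fun _ _ _ => inferInstance⟩

instance : PreservesFiniteColimits C.comonad.forget := ⟨fun _ _ _ => inferInstance⟩

variable {C}

/-- Exactness of comodules can be tested on the underlying modules. -/
theorem exact_of_function_exact (S : ShortComplex C.Comod)
    (h : Function.Exact S.f.f.hom S.g.f.hom) : S.Exact := by
  rw [← S.exact_map_iff_of_faithful C.comonad.forget,
    ShortComplex.ShortExact.moduleCat_exact_iff_function_exact]
  exact h

variable (C) in
/-- Cofree comodules preserve short exact sequences. -/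
theorem cofree_shortExact {S : ShortComplex (ModuleCat.{u} A)} (hS : S.ShortExact) :
    (S.map C.comonad.cofree).ShortExact where
  exact := exact_of_function_exact _ (Bimod.IsFlat.exact S.f.hom S.g.hom
    ((ShortComplex.ShortExact.moduleCat_exact_iff_function_exact S).1 hS.exact))
  mono_f := by
    have := hS.mono_f
    -- The cofree functor is a right adjoint, so it preserves monomorphisms.
    have : PreservesLimitsOfSize.{0, 0} C.comonad.cofree := C.comonad.adj.rightAdjoint_preservesLimits
    exact inferInstanceAs (Mono (C.comonad.cofree.map S.f))
  epi_g := by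
    refine C.comonad.forget.epi_of_epi_map ?_
    refine (ModuleCat.epi_iff_surjective _).2 fun x => ?_
    induction x using Bimod.ten_induction with
    | h0 => exact ⟨0, map_zero _⟩
    | ht m n =>
      obtain ⟨n, rfl⟩ := hS.moduleCat_surjective_g n
      exact ⟨β.tm m n, rfl⟩
    | ha x y hx hy =>
      obtain ⟨x, rfl⟩ := hx
      obtain ⟨y, rfl⟩ := hy
      exact ⟨x + y, map_add _ _ _⟩

/-- The cofree functor is right adjoint to the forgetful functor, which preserves monomorphisms
because flatness makes it left exact. -/
instance injective_cofree (J : ModuleCat.{u} A) [Injective J] :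
    Injective (C.comonad.cofree.obj J) :=
  Injective.injective_of_adjoint C.comonad.adj J

/-- `Ext` from a comodule with projective underlying module to a cofree comodule vanishes. -/
theorem ext_cofree_eq_zero [HasExt.{v'} C.Comod] (T : C.Comod) [Projective T.A] (i : ℕ) :
    ∀ (N : ModuleCat.{u} A) (e : Ext.{v'} T (C.comonad.cofree.obj N) (i + 1)), e = 0 := by
  induction i with
  | zero =>
    intro N e
    -- `N` is embedded into an injective module. The cofree functor keeps the sequence exact and its
    -- middle term injective, so every class in Ext¹ comes from a map `x` into the cofree comodule
    -- on the quotient.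
    let S := ShortComplex.mk _ _ (cokernel.condition (Injective.ι N))
    have hS : S.ShortExact :=
      { exact := ShortComplex.exact_of_g_is_cokernel _ (cokernelIsCokernel S.f) }
    obtain ⟨x, rfl⟩ := Ext.covariant_sequence_exact₁ T (cofree_shortExact C hS) e
      (Ext.eq_zero_of_injective (I := C.comonad.cofree.obj (Injective.under N)) _) rfl
    obtain ⟨x, rfl⟩ := (Ext.mk₀_bijective _ _).2 x
    -- Since `x` lifts to the middle term, its composite with the extension class is zero.
    obtain ⟨y, hy⟩ := exists_lift_cofree T S hS.epi_g x
    rw [← hy, ← Ext.mk₀_comp_mk₀, Ext.comp_assoc _ _ _ (zero_add 0) (zero_add 1) (by omega),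
      ShortComplex.ShortExact.comp_extClass, Ext.comp_zero]
    rfl
  | succ i ih =>
    intro N e
    let S := ShortComplex.mk _ _ (cokernel.condition (Injective.ι N))
    have hS : S.ShortExact :=
      { exact := ShortComplex.exact_of_g_is_cokernel _ (cokernelIsCokernel S.f) }
    obtain ⟨x, rfl⟩ := Ext.covariant_sequence_exact₁ T (cofree_shortExact C hS) e
      (Ext.eq_zero_of_injective (I := C.comonad.cofree.obj (Injective.under N)) _) rfl
    -- The class is the image of a class one degree lower with values in another cofree comodule,
    -- which vanishes by induction. This is why `N` is quantified inside the induction.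
    rw [ih S.X₃ x]
    exact Ext.zero_comp _ _ _ _ _

end Coring

/-- `M ⊗_A A → M`, `m ⊗ a ↦ m·a`. -/
def Bimod.tenBase {A M : Type u} [Ring A] [AddCommGroup M] (β : Bimod A M) :
    β.Ten A →ₗ[A] β.Self :=
  β.lift
    { toFun := fun m => AddMonoidHom.mk' (fun a => β.rightLin a m) (fun a b => by
        have h' : β.right (op (a + b)) = β.right (op a) + β.right (op b) := by
          rw [MulOpposite.op_add, _root_.map_add]
        exact DFunLike.congr_fun h' m)
      map_add' := fun x y => by ext a; exact (β.rightLin a).map_add x y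
      map_smul' := fun b x => by ext a; exact (β.rightLin a).map_smul b x }
    (fun m a b => by
      change β.right (op b) (β.right (op a) m) = β.right (op (a * b)) m
      rw [op_mul, map_mul]
      rfl)

namespace LeftBialgebroid

variable {k A H : Type u} [CommRing k] [Ring A] [Algebra k A] [Ring H] [Algebra k H]
  (L : LeftBialgebroid k A H)

/-! ### Exactness of the cobar complex -/

theorem cobar_d (n : ℕ) : L.cobar.d n (n + 1) = L.cobarHom n :=
  CochainComplex.of_d L.cobarObj L.cobarHom n

/-- `ε ⊗ id : H^{⊗ (n + 2)} → H^{⊗ (n + 1)}`. -/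
def tctr (n : ℕ) : L.tpow (n + 1) →ₗ[A] L.tpow n := L.coring.ctr (L.tpow n)

theorem tctr_cobarFace (n : ℕ) (x : L.tpow n) : L.tctr n (L.cobarFace n 0 x) = x :=
  LinearMap.congr_fun (L.face_counit n) x

theorem tctr_tmap {m n : ℕ} (f : L.tpow m →ₗ[A] L.tpow n) (x : L.tpow (m + 1)) :
    L.tctr n (L.tmap f x) = f (L.tctr m x) :=
  LinearMap.congr_fun (L.coring.ctr_naturality f) x

theorem tctr_appUnit (h : L.tpow 0) : L.tctr 0 (L.appUnit h) = L.sLin (L.coring.counit h) :=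
  L.smul_e (L.coring.counit h)

/-- The bottom of the contracting homotopy `tctr`: the defect from the identity is `s ε`, which
takes values in the image of the coaugmentation. -/
theorem tctr_cobarD_zero (h : L.tpow 0) :
    L.tctr 0 (L.cobarD 0 h) = h - (show L.tpow 0 from L.sLin (L.coring.counit h)) := by
  rw [cobarD_zero, LinearMap.sub_apply, map_sub, tctr_cobarFace, tctr_appUnit]

/-- The homotopy identity. The map `ε ⊗ id` undoes the coproduct on the first factor and, by
naturality, commutes with the remaining part `id ⊗ b'` of the differential. -/
theorem tctr_cobarD_succ (n : ℕ) (x : L.tpow (n + 1)) :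
    L.tctr (n + 1) (L.cobarD (n + 1) x) = x - L.cobarD n (L.tctr n x) := by
  rw [cobarD_succ, LinearMap.sub_apply, map_sub, tctr_cobarFace, tctr_tmap]

theorem cobarD_sLin (a : A) : L.cobarD 0 (L.sLin a) = 0 := by
  rw [cobarD_zero]
  change L.coring.comul (L.sLin a) - L.bim.tm (L.sLin a) L.e = 0
  rw [comul_sLin, sub_self]

/-- The homotopy `tctr` is used only as a linear map, which suffices because flatness lets exactness
of comodules be tested on the underlying modules. -/
theorem isCoresolution_cobar [L.IsFlat] : IsCoresolution L.cobar L.coaug where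
  mono := by
    refine (Coring.comonad L.coring).forget.mono_of_mono_map ?_
    exact (ModuleCat.mono_iff_injective _).2
      (Function.LeftInverse.injective (g := L.coring.counit) L.counit_sLin)
  comp_d := by
    rw [cobar_d]
    apply Comonad.Coalgebra.Hom.ext
    ext1
    exact LinearMap.ext L.cobarD_sLin
  exact₀ := by
    have h0 : L.cobar.d 0 1 = L.cobarHom 0 := L.cobar_d 0
    refine Coring.exact_of_function_exact _ fun (h : L.tpow 0) => ?_
    simp only [h0]
    constructor
    · intro (hh : L.cobarD 0 h = 0)
      have h1 := L.tctr_cobarD_zero h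
      rw [hh, map_zero, eq_comm, sub_eq_zero] at h1
      exact ⟨L.coring.counit h, h1.symm⟩
    · rintro ⟨a, rfl⟩
      exact L.cobarD_sLin a
  exactAt n := by
    rw [L.cobar.exactAt_iff' n (n + 1) (n + 2) (by simp) (by simp)]
    refine Coring.exact_of_function_exact _ fun (x : L.tpow (n + 1)) => ?_
    dsimp only [HomologicalComplex.shortComplexFunctor', HomologicalComplex.sc']
    rw [cobar_d, cobar_d]
    constructor
    · intro (hx : L.cobarD (n + 1) x = 0)
      have h1 := L.tctr_cobarD_succ n x
      rw [hx, map_zero, eq_comm, sub_eq_zero] at h1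
      exact ⟨L.tctr n x, h1.symm⟩
    · rintro ⟨y, rfl⟩
      exact LinearMap.congr_fun (L.cobarD_comp n) y

/-! ### Acyclicity of the cobar complex -/

/-- `h ↦ h ⊗ 1`, as a comodule map `H ⟶ H ⊗_A A`. -/
def cobarZeroTo : L.cobarObj 0 ⟶ L.coring.comonad.cofree.obj (ModuleCat.of A A) where
  f := ModuleCat.ofHom (L.bim.ins (1 : A))
  h := rfl

/-- `h ⊗ a ↦ t(a) h`, as a comodule map `H ⊗_A A ⟶ H`. -/
def cobarZeroFrom : L.coring.comonad.cofree.obj (ModuleCat.of A A) ⟶ L.cobarObj 0 where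
  f := ModuleCat.ofHom L.bim.tenBase
  h := by
    ext1
    refine L.bim.ten_ext (N := A) fun h a => ?_
    -- Compatibility with the coactions is the right `A`-linearity of the coproduct.
    refine Eq.trans ?_ (L.coring.comul_right a h).symm
    exact LinearMap.congr_fun (L.bim.map_comp L.bim.tenBase (L.bim.ins a)).symm (L.coring.comul h)

/-- Exhibits `H` as a retract of the cofree comodule on `A`, so vanishing of Ext passes to it. -/
theorem cobarZeroTo_from : L.cobarZeroTo ≫ L.cobarZeroFrom = 𝟙 _ := by
  apply Comonad.Coalgebra.Hom.ext
  ext1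
  refine LinearMap.ext fun (h : H) => ?_
  change L.t (op 1) * h = h
  rw [op_one, map_one, one_mul]

instance : Projective L.base.A := ModuleCat.projective_of_free (Module.Free.chooseBasis A A)

/-- In positive degree Cobarⁿ is by definition the cofree comodule on the remaining `n` factors. In
degree 0 it is a retract of one, and `A` is free as a module over itself. -/
theorem ext_cobar_eq_zero [L.IsFlat] [HasExt.{v'} L.Comod] (n i : ℕ)
    (e : Ext.{v'} L.base (L.cobar.X n) (i + 1)) : e = 0 := by
  cases n with
  | zero =>
    change Ext.{v'} L.base (L.cobarObj 0) (i + 1) at e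
    have h : e.comp (Ext.mk₀ L.cobarZeroTo) (add_zero (i + 1)) = 0 :=
      Coring.ext_cofree_eq_zero L.base i _ _
    have h' : e = (e.comp (Ext.mk₀ L.cobarZeroTo) (add_zero (i + 1))).comp
        (Ext.mk₀ L.cobarZeroFrom) (add_zero (i + 1)) := by
      rw [Ext.comp_assoc _ _ _ (add_zero (i + 1)) (add_zero 0) (by omega), Ext.mk₀_comp_mk₀,
        cobarZeroTo_from, Ext.comp_mk₀_id]
    rw [h', h]
    exact Ext.zero_comp _ _ _ _ _
  | succ n => exact Coring.ext_cofree_eq_zero L.base i (L.tpow n) e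

/-! ### The cotensor product `A □ -` is corepresented by `A` -/

section Cotensor

/-- `A ⊗_A N → N`, `a ⊗ n ↦ a n`. -/
def baseTenTo (N : Type u) [AddCommGroup N] [Module A N] : L.baseRight.toRMod.Ten N →+ N :=
  Tens.lift (Module.toAddMonoidEnd A N).toAddMonoidHom (fun m r n => mul_smul m r n)

variable {N : Type u} [AddCommGroup N] [Module A N]

theorem baseTenTo_tm (a : A) (n : N) : L.baseTenTo N (L.baseRight.toRMod.tm a n) = a • n := rfl

theorem tm_baseTenTo (x : L.baseRight.toRMod.Ten N) :
    L.baseRight.toRMod.tm (1 : A) (L.baseTenTo N x) = x := by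
  induction x using RMod.ten_induction with
  | h0 => rw [map_zero, map_zero]
  | ht a n =>
    rw [baseTenTo_tm, ← RMod.tm_right]
    exact congrArg (fun b => L.baseRight.toRMod.tm b n) (one_mul a)
  | ha x y hx hy => rw [map_add, map_add, hx, hy]

theorem one_tm_injective :
    Function.Injective (L.baseRight.toRMod.tm (N := N) (1 : A)) :=
  Function.LeftInverse.injective (g := L.baseTenTo N) fun n => one_smul A n

/-- The right coaction sends `1` to `1 ⊗ t(1) = 1 ⊗ 1`. After cancelling the injective map `1 ⊗ -`,
the equation of the cotensor product says that `n` is primitive. -/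
theorem one_tm_mem_cotensorObj (N : L.Comod) (n : N.A) :
    L.baseRight.toRMod.tm (1 : A) n ∈ Coring.cotensorObj L.baseRight N ↔
      Coring.Comod.coaction N n = L.bim.tm L.e n := by
  rw [Coring.mem_cotensorObj]
  have h : L.baseRight.toRMod.extend L.baseRight.coact L.baseRight.coact_right
      (L.baseRight.toRMod.tm (1 : A) n) =
        L.baseRight.toRMod.tm (1 : A) (L.bim.tm (L.tHom 1) n) := rfl
  rw [h, tHom_one]
  exact ⟨fun h => (L.one_tm_injective h).symm, fun h => congrArg _ h.symm⟩

theorem coaction_baseTenTo {N : L.Comod} {x : L.baseRight.toRMod.Ten N.A}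
    (hx : x ∈ Coring.cotensorObj L.baseRight N) :
    Coring.Comod.coaction N (L.baseTenTo N.A x) = L.bim.tm L.e (L.baseTenTo N.A x) :=
  (L.one_tm_mem_cotensorObj N _).1 (by rwa [tm_baseTenTo])

/-- The primitive elements of a left comodule, as comodule maps from `A`. -/
def homOfPrimitive (N : L.Comod) (n : N.A) (hn : Coring.Comod.coaction N n = L.bim.tm L.e n) :
    L.base ⟶ N where
  f := ModuleCat.ofHom (LinearMap.toSpanSingleton A N.A n)
  h := by
    ext1
    refine LinearMap.ext fun (a : A) => ?_
    change L.bim.tm (L.sLin a) ((1 : A) • n) = Coring.Comod.coaction N (a • n)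
    rw [(Coring.Comod.coaction N).map_smul, hn, one_smul, Bimod.smul_tm, smul_e]

/-- The image of `1` under a comodule map from `A`. -/
def evalOne {N : L.Comod} (f : L.base ⟶ N) : N.A := f.f.hom (1 : A)

theorem coaction_evalOne {N : L.Comod} (f : L.base ⟶ N) :
    Coring.Comod.coaction N (L.evalOne f) = L.bim.tm L.e (L.evalOne f) := by
  have h := LinearMap.congr_fun (Coring.Comod.coaction_hom f) (1 : A)
  refine h.symm.trans ?_
  change L.bim.map f.f.hom (L.bim.tm (L.sLin 1) (1 : A)) = _
  rw [sLin_one]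
  rfl

theorem evalOne_injective {N : L.Comod} {f g : L.base ⟶ N} (h : L.evalOne f = L.evalOne g) :
    f = g := by
  apply Comonad.Coalgebra.Hom.ext
  ext1
  exact LinearMap.ext_ring h

theorem evalOne_add {N : L.Comod} (f g : L.base ⟶ N) :
    L.evalOne (f + g) = L.evalOne f + L.evalOne g := rfl

theorem evalOne_homOfPrimitive (N : L.Comod) (n : N.A)
    (hn : Coring.Comod.coaction N n = L.bim.tm L.e n) :
    L.evalOne (L.homOfPrimitive N n hn) = n := one_smul A n

/-- `A □ N ≃ Hom(A, N)`. -/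
def cotensorEquiv (N : L.Comod) : Coring.cotensorObj L.baseRight N ≃+ (L.base ⟶ N) where
  toFun x := L.homOfPrimitive N (L.baseTenTo N.A x.1) (L.coaction_baseTenTo x.2)
  invFun f := ⟨L.baseRight.toRMod.tm (1 : A) (L.evalOne f),
    (L.one_tm_mem_cotensorObj N _).2 (L.coaction_evalOne f)⟩
  left_inv x := Subtype.ext (by
    dsimp only
    rw [evalOne_homOfPrimitive, tm_baseTenTo])
  right_inv f := L.evalOne_injective (by rw [evalOne_homOfPrimitive, baseTenTo_tm, one_smul])
  map_add' x y := L.evalOne_injective (by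
    rw [evalOne_add, evalOne_homOfPrimitive, evalOne_homOfPrimitive, evalOne_homOfPrimitive,
      Submodule.coe_add, map_add])

/-- The naturality required of `φ` in the comparison of acyclic coresolutions, checked after
applying the inverse equivalence. -/
theorem cotensorEquiv_map {N N' : L.Comod} (f : N ⟶ N') (x : Coring.cotensorObj L.baseRight N) :
    L.cotensorEquiv N' ⟨L.baseRight.toRMod.map f.f.hom x.1,
      Coring.cotensor_map_mem L.baseRight f x.1 x.2⟩ = L.cotensorEquiv N x ≫ f := by
  refine (L.cotensorEquiv N').symm.injective ?_
  rw [AddEquiv.symm_apply_apply]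
  refine Subtype.ext ?_
  change L.baseRight.toRMod.map f.f.hom x.1 =
    L.baseRight.toRMod.map f.f.hom (L.baseRight.toRMod.tm (1 : A) ((1 : A) • L.baseTenTo N.A x.1))
  rw [one_smul, tm_baseTenTo]

end Cotensor

/-! ### The comparison of the Hochschild and the cobar complexes -/

/-- The counit gives a left inverse: `ε t = id`, and `ε ⊗ id` sends `1 ⊗ x` to `x`. -/
theorem firstFace_injective (n : ℕ) : Function.Injective (L.firstFace n) := by
  cases n with
  | zero => exact Function.LeftInverse.injective (g := L.coring.counit) L.counit_tHom
  | succ n =>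
    refine Function.LeftInverse.injective (g := L.coring.ctr (L.tpow n)) fun x => ?_
    refine (L.coring.ctr_tm L.e x).trans ?_
    rw [counit_e, one_smul]

/-- Contract the second factor of the equation `Δ x = 1 ⊗ x` with the counit. By the counit axiom
the left side becomes `x`, while the right side becomes `t(ε x)` in degree 0 and `1 ⊗ (ε ⊗ id) x` in
higher degree. -/
theorem exists_firstFace_eq (n : ℕ) (x : L.tpow n)
    (hx : L.cobarFace n 0 x = L.bim.tm (N := L.tpow n) L.e x) : ∃ y, L.firstFace n y = x := by
  cases n with
  | zero =>
    refine ⟨L.coring.counit x, (L.rightLin_e _).symm.trans ?_⟩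
    exact (congrArg (L.bim.contractRight L.coring.counit) hx).symm.trans
      (L.coring.comul_counit x)
  | succ n =>
    refine ⟨L.coring.ctr (L.tpow n) x, ?_⟩
    exact (congrArg (L.bim.map (L.coring.ctr (L.tpow n))) hx).symm.trans
      (LinearMap.congr_fun (L.coring.map_ctr_ext (N := L.tpow n)) x)

theorem hochToCobarAux_bijective (n : ℕ) : Function.Bijective (L.hochToCobarAux n) := by
  constructor
  · intro x y hxy
    exact L.firstFace_injective n (L.one_tm_injective (congrArg Subtype.val hxy))
  · intro (x : Coring.cotensorObj L.baseRight (L.cobarObj n))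
    obtain ⟨y, hy⟩ := L.exists_firstFace_eq n (L.baseTenTo (L.tpow n) x.1)
      (L.coaction_baseTenTo x.2)
    refine ⟨y, Subtype.ext ?_⟩
    exact (congrArg (L.oneTm n) hy).trans (L.tm_baseTenTo x.1)

instance isIso_hochToCobar : IsIso L.hochToCobar := by
  have (n : ℕ) : IsIso (L.hochToCobar.f n) :=
    (ConcreteCategory.isIso_iff_bijective _).2 (L.hochToCobarAux_bijective n)
  exact HomologicalComplex.Hom.isIso_of_components _

end LeftBialgebroid

end HopfAlgd

end

/-! ### The comparison isomorphism in cohomology -/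

noncomputable section

namespace HopfAlgd

open Limits Abelian

namespace LeftBialgebroid

variable {k A H : Type u} [CommRing k] [Ring A] [Algebra k A] [Ring H] [Algebra k H]
  (L : LeftBialgebroid k A H)

/-- The map on cohomology induced by a map from the cobar complex to an injective resolution. -/
def comparison [L.IsFlat] (I : InjectiveResolution L.base) (g : L.cobar ⟶ I.cocomplex) (n : ℕ) :
    L.HH n ⟶ L.Cotor n :=
  HomologicalComplex.homologyMap (L.hochToCobar ≫
    ((Coring.cotensor L.baseRight).mapHomologicalComplex (ComplexShape.up ℕ)).map g) n ≫
    (I.isoRightDerivedObj (Coring.cotensor L.baseRight) n).inv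

/-- The outer factors are isomorphisms by construction. The middle one compares the cobar complex
with an injective resolution, two coresolutions of `A` that are acyclic for Hom(A, -). -/
theorem isIso_comparison [L.IsFlat] (I : InjectiveResolution L.base) (g : L.cobar ⟶ I.cocomplex)
    (hg : L.coaug ≫ g.f 0 = I.ι.f 0) (n : ℕ) : IsIso (L.comparison I g n) := by
  -- Ext occurs only inside the argument, so any choice of its universe will do.
  have := HasExt.standard L.Comod
  have hF : IsIso (HomologicalComplex.homologyMap
      (((Coring.cotensor L.baseRight).mapHomologicalComplex (ComplexShape.up ℕ)).map g) n) :=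
    IsCoresolution.isIso_homologyMap (F := Coring.cotensor L.baseRight) L.cotensorEquiv
      L.cotensorEquiv_map L.isCoresolution_cobar (isCoresolution_of_injectiveResolution I)
      L.ext_cobar_eq_zero (fun _ _ e => Ext.eq_zero_of_injective e) g hg n
  have : IsIso (HomologicalComplex.homologyMap L.hochToCobar n) :=
    inferInstanceAs (IsIso ((HomologicalComplex.homologyFunctor _ _ n).map L.hochToCobar))
  have h := IsIso.comp_isIso' (f := HomologicalComplex.homologyMap L.hochToCobar n)
    inferInstance hF
  rw [comparison, HomologicalComplex.homologyMap_comp]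
  exact IsIso.comp_isIso' h (I.isoRightDerivedObj (Coring.cotensor L.baseRight) n).isIso_inv

/-- Extend the identity of `A` to a map `φ` from `I` to `J`. Naturality of the derived functor
transfers the first comparison to `g ≫ φ`, and `g ≫ φ` and `g'` are two maps under `A` into the same
injective resolution. -/
theorem comparison_eq [L.IsFlat] (I J : InjectiveResolution L.base) (g : L.cobar ⟶ I.cocomplex)
    (hg : L.coaug ≫ g.f 0 = I.ι.f 0) (g' : L.cobar ⟶ J.cocomplex)
    (hg' : L.coaug ≫ g'.f 0 = J.ι.f 0) (n : ℕ) : L.comparison I g n = L.comparison J g' n := by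
  have := HasExt.standard L.Comod
  let φ : I.cocomplex ⟶ J.cocomplex := InjectiveResolution.desc (𝟙 _) J I
  have hφ : I.ι.f 0 ≫ φ.f 0 = 𝟙 _ ≫ J.ι.f 0 := InjectiveResolution.desc_commutes_zero _ _ _
  have h1 := InjectiveResolution.isoRightDerivedObj_inv_naturality (𝟙 _) I J φ hφ
    (Coring.cotensor L.baseRight) n
  rw [CategoryTheory.Functor.map_id, Category.comp_id] at h1
  have h2 := IsCoresolution.homologyMap_eq (F := Coring.cotensor L.baseRight) L.cotensorEquiv
    L.cotensorEquiv_map L.isCoresolution_cobar (isCoresolution_of_injectiveResolution J)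
    (fun _ _ e => Ext.eq_zero_of_injective e) (g ≫ φ) g'
    (by
      rw [HomologicalComplex.comp_f]
      refine (Category.assoc _ _ _).symm.trans ((congrArg (· ≫ φ.f 0) hg).trans ?_)
      exact hφ.trans (Category.id_comp _)) hg' n
  rw [comparison, h1, comparison, HomologicalComplex.homologyMap_comp,
    HomologicalComplex.homologyMap_comp, ← h2, CategoryTheory.Functor.map_comp,
    HomologicalComplex.homologyMap_comp]
  exact (Category.assoc _ _ _).symm.trans (congrArg (· ≫ _) (Category.assoc _ _ _))

end LeftBialgebroid

end HopfAlgd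

end

/-! ### Projective resolutions and change of rings -/

noncomputable section

namespace HopfAlgd

open Limits

/-- A projective resolution from a complex of projective objects which is exact in positive
degrees and augmented by a cokernel of the last differential. -/
def projectiveResolutionMk {C : Type v} [Category.{w} C] [Abelian C] {Z : C}
    (K : ChainComplex C ℕ) (hK : ∀ n, Projective (K.X n)) (aug : K.X 0 ⟶ Z)
    (hd : K.d 1 0 ≫ aug = 0) (h₀ : (ShortComplex.mk _ _ hd).Exact) (hepi : Epi aug)
    (hexact : ∀ n, K.ExactAt (n + 1)) : ProjectiveResolution Z where
  complex := K
  projective := hK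
  π := (ChainComplex.toSingle₀Equiv _ _).symm ⟨aug, hd⟩
  quasiIso := ⟨fun n => by
    cases n
    · rw [ChainComplex.quasiIsoAt₀_iff, ShortComplex.quasiIso_iff_of_zeros']
      · refine (ShortComplex.exact_and_epi_g_iff_of_iso ?_).2 ⟨h₀, hepi⟩
        exact ShortComplex.isoMk (Iso.refl _) (Iso.refl _) (Iso.refl _)
          ((Category.id_comp _).trans (Category.comp_id (K.d 1 0)).symm)
          ((Category.id_comp _).trans (Eq.trans (by simp; rfl) (Category.comp_id _).symm))
      all_goals first | rfl | exact K.shape _ _ (by simp)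
    · rw [quasiIsoAt_iff_exactAt']
      · apply hexact
      · apply ChainComplex.exactAt_succ_single_obj⟩

theorem projectiveResolutionMk_π {C : Type v} [Category.{w} C] [Abelian C] {Z : C}
    (K : ChainComplex C ℕ) (hK : ∀ n, Projective (K.X n)) (aug : K.X 0 ⟶ Z)
    (hd : K.d 1 0 ≫ aug = 0) (h₀ : (ShortComplex.mk _ _ hd).Exact) (hepi : Epi aug)
    (hexact : ∀ n, K.ExactAt (n + 1)) :
    (projectiveResolutionMk K hK aug hd h₀ hepi hexact).π.f 0 = aug :=
  ChainComplex.toSingle₀Equiv_symm_apply_f_zero _ _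

/-- Projectivity of the restriction of scalars of a projective module along `R → S`, when `S` is
projective over `R`. -/
theorem projective_compHom {R S : Type u} [Ring R] [Ring S] (f : R →+* S)
    (hS : letI := Module.compHom S f; Module.Projective R S) (N : Type u) [AddCommGroup N]
    [Module S N] [Module.Projective S N] :
    letI := Module.compHom N f
    Module.Projective R N := by
  let _ := Module.compHom S f
  let _ := Module.compHom N f
  have : Module.Projective R S := hS
  -- `N` is a summand over `S` of the free module on its own elements. The splitting remains linear
  -- over `R`, where that free module is a direct sum of copies of the projective module `S`.
  obtain ⟨s, hs⟩ := (Module.projective_def' (R := S) (P := N)).1 inferInstance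
  let i : N →ₗ[R] N →₀ S :=
    { toFun := s
      map_add' := s.map_add
      map_smul' := fun r n => by
        change s (f r • n) = r • s n
        rw [map_smul]
        ext x
        rfl }
  let p : (N →₀ S) →ₗ[R] N :=
    { toFun := Finsupp.linearCombination S id
      map_add' := map_add _
      map_smul' := fun r x => by
        have h : r • x = f r • x := by
          ext y
          rfl
        rw [h, map_smul]
        rfl }
  have h : Module.Projective R (N →₀ S) := by
    classical exact .of_equiv (finsuppLEquivDirectSum R S N).symm
  exact Module.Projective.of_split i p (LinearMap.ext fun n => LinearMap.congr_fun hs n)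

namespace HopfAlgebroid

variable {k Al Ar H : Type u} [CommRing k] [Ring Al] [Algebra k Al] [Ring Ar] [Algebra k Ar]
  [Ring H] [Algebra k H] (𝓗 : HopfAlgebroid k Al Ar H)

/-! ### The bar resolution -/

/-- `H ⊗_{Aᵣ} N` is a projective `H`-module if `N` is a projective `Aᵣ`-module. -/
theorem projective_ind (N : Type u) [AddCommGroup N] [Module H N]
    (hN : letI := Module.compHom N 𝓗.sr; Module.Projective Ar N) :
    Projective (ModuleCat.of H (𝓗.Ind N)) where
  factors {P Q} f p hp := by
    let _ := Module.compHom N 𝓗.sr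
    let _ := Module.compHom P 𝓗.sr
    let _ := Module.compHom Q 𝓗.sr
    let p' : P →ₗ[Ar] Q :=
      { toFun := p.hom
        map_add' := p.hom.map_add
        map_smul' := fun a x => p.hom.map_smul (𝓗.sr a) x }
    -- Induction is left adjoint to restriction along `sᵣ`: the restriction of `f` to `1 ⊗ N` is
    -- `Aᵣ`-linear, it is lifted there to `g`, and `h ⊗ n ↦ h g(n)` extends the lift.
    let f' : N →ₗ[Ar] Q :=
      { toFun := fun n => f.hom (𝓗.itm 1 n)
        map_add' := fun x y => by rw [map_add, map_add]
        map_smul' := fun a x => by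
          change f.hom (𝓗.itm 1 (𝓗.sr a • x)) = 𝓗.sr a • f.hom (𝓗.itm 1 x)
          rw [← map_smul, smul_itm, ← itm_sr, one_mul, mul_one] }
    obtain ⟨g, hg⟩ := Module.projective_lifting_property p' f'
      ((ModuleCat.epi_iff_surjective p).1 hp)
    refine ⟨ModuleCat.ofHom (𝓗.indLift
      { toFun := fun h => (Module.toAddMonoidEnd H P h).comp g.toAddMonoidHom
        map_add' := fun x y => by ext n; exact add_smul x y (g n)
        map_smul' := fun x y => by ext n; exact mul_smul x y (g n) }
      (fun h a n => ?_)), ?_⟩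
    · change (h * 𝓗.sr a) • g n = h • g (a • n)
      rw [map_smul, mul_smul]
      rfl
    · ext1
      refine 𝓗.ind_ext fun h n => ?_
      change p.hom (h • g n) = f.hom (𝓗.itm h n)
      rw [map_smul]
      refine (congrArg (h • ·) (LinearMap.congr_fun hg n)).trans ?_
      change h • f.hom (𝓗.itm 1 n) = f.hom (𝓗.itm h n)
      rw [← map_smul, smul_itm, mul_one]

/-- Each term is induced from the previous one, which is projective over `H` and hence over `Aᵣ`
because `H` is. -/
theorem projective_barObj (hP : 𝓗.IsProj) (n : ℕ) : Projective (𝓗.barObj n) := by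
  induction n with
  | zero => exact ModuleCat.projective_of_free (Module.Free.chooseBasis H H)
  | succ n ih =>
    have : Module.Projective H (𝓗.barObj n) := (IsProjective.iff_projective _).2 ih
    exact 𝓗.projective_ind (𝓗.barObj n) (projective_compHom 𝓗.sr hP (𝓗.barObj n))

theorem bar_d (n : ℕ) : 𝓗.bar.d (n + 1) n = ModuleCat.ofHom (𝓗.barD n) :=
  ChainComplex.of_d 𝓗.barObj (fun n => ModuleCat.ofHom (𝓗.barD n)) n

/-- The contracting homotopy `x ↦ 1 ⊗ x` of the bar complex. -/
def barS (n : ℕ) : 𝓗.barObj n →+ 𝓗.barObj (n + 1) := 𝓗.itm (N := 𝓗.barObj n) 1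

theorem bact_barS (n : ℕ) (x : 𝓗.barObj n) : 𝓗.bact n (𝓗.barS n x) = x := one_smul H x

/-- The last face sends `1 ⊗ x` to `sᵣ εᵣ S⁻¹ x`, which is `tₗ εₗ x` by `sr_ν`. This is the point
where the antipode links the right-handed complex to the augmentation `εₗ`. -/
theorem barD_zero_barS (x : 𝓗.barObj 0) :
    𝓗.barD 0 (𝓗.barS 0 x) = x - (show 𝓗.barObj 0 from 𝓗.l.t (op (𝓗.l.ε x))) := by
  rw [barD_zero, LinearMap.sub_apply, bact_barS]
  refine congrArg (x - ·) ?_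
  exact (one_mul (𝓗.sr (𝓗.ν (show H from x)))).trans (𝓗.sr_ν (show H from x))

/-- Multiplication undoes `x ↦ 1 ⊗ x`, and the other part `id ⊗ b'` of the differential leaves the
leading `1` alone. -/
theorem barD_succ_barS (n : ℕ) (x : 𝓗.barObj (n + 1)) :
    𝓗.barD (n + 1) (𝓗.barS (n + 1) x) = x - 𝓗.barS n (𝓗.barD n x) := by
  rw [barD_succ, LinearMap.sub_apply, bact_barS]
  rfl

/-- Since `εₗ tₗ = id` and `tₗ εₗ = sᵣ εᵣ S⁻¹`, the claim reduces to the vanishing of `εᵣ S⁻¹` on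
boundaries. -/
theorem εl_barD (x : 𝓗.barObj 1) : 𝓗.l.ε (𝓗.barD 0 x) = 0 := by
  have h := 𝓗.sr_ν (𝓗.barD 0 x)
  rw [ν_barD, map_zero] at h
  have h1 : 𝓗.l.ε (𝓗.l.t (op (𝓗.l.ε (𝓗.barD 0 x)))) = 𝓗.l.ε (𝓗.barD 0 x) :=
    𝓗.l.counit_tHom _
  rw [← h1, ← h, map_zero]

theorem barD_barD (n : ℕ) (x : 𝓗.barObj (n + 2)) : 𝓗.barD n (𝓗.barD (n + 1) x) = 0 :=
  LinearMap.congr_fun (𝓗.barD_comp n) x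

theorem bar_exactAt (n : ℕ) : 𝓗.bar.ExactAt (n + 1) := by
  rw [𝓗.bar.exactAt_iff' (n + 2) (n + 1) n (by simp) (by simp),
    ShortComplex.ShortExact.moduleCat_exact_iff_function_exact]
  dsimp only [HomologicalComplex.shortComplexFunctor', HomologicalComplex.sc']
  rw [bar_d, bar_d]
  intro (x : 𝓗.barObj (n + 1))
  constructor
  · intro (hx : 𝓗.barD n x = 0)
    have h := 𝓗.barD_succ_barS n x
    rw [hx, map_zero, sub_zero] at h
    exact ⟨_, h⟩
  · rintro ⟨y, rfl⟩
    exact 𝓗.barD_barD n y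

theorem bar_d_aug : 𝓗.bar.d 1 0 ≫ 𝓗.aug = 0 := by
  rw [(𝓗.bar_d 0 :)]
  ext1
  exact LinearMap.ext 𝓗.εl_barD

theorem bar_exact_zero : (ShortComplex.mk _ _ 𝓗.bar_d_aug).Exact := by
  rw [ShortComplex.ShortExact.moduleCat_exact_iff_function_exact]
  have h0 : 𝓗.bar.d 1 0 = ModuleCat.ofHom (𝓗.barD 0) := 𝓗.bar_d 0
  simp only [h0]
  intro (x : 𝓗.barObj 0)
  constructor
  · intro (hx : 𝓗.l.ε x = 0)
    have h := 𝓗.barD_zero_barS x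
    -- On the kernel of `εₗ` the correction term `tₗ εₗ x` disappears, so `x` is the boundary of `1
    -- ⊗ x`.
    rw [hx, MulOpposite.op_zero, map_zero] at h
    exact ⟨_, h.trans (sub_zero x)⟩
  · rintro ⟨y, rfl⟩
    exact 𝓗.εl_barD y

theorem epi_aug : Epi 𝓗.aug :=
  (ModuleCat.epi_iff_surjective _).2 fun a => ⟨𝓗.l.sLin a, 𝓗.l.counit_sLin a⟩

/-- The bar resolution of `Aₗ`. -/
def barResolution (hP : 𝓗.IsProj) : ProjectiveResolution 𝓗.triv :=
  projectiveResolutionMk 𝓗.bar (𝓗.projective_barObj hP) 𝓗.aug 𝓗.bar_d_aug 𝓗.bar_exact_zero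
    𝓗.epi_aug 𝓗.bar_exactAt

theorem barResolution_π (hP : 𝓗.IsProj) : (𝓗.barResolution hP).π.f 0 = 𝓗.aug :=
  projectiveResolutionMk_π _ _ _ _ _ _ _

/-! ### The comparison of the bar and the Hochschild complexes -/

/-- The inverse of `Aᵣ ⊗_H Barₙ(H) → Cₙ(H)`: `a ↦ a ⊗ 1` and `x ↦ 1 ⊗ 1 ⊗ x`. -/
def hochToBar : ∀ n : ℕ, 𝓗.hochX n →+ 𝓗.trivRight.Ten (𝓗.barObj n)
  | 0 => (𝓗.trivRight.tm (N := H)).flip 1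
  | n + 1 => (𝓗.trivRight.tm (N := 𝓗.barObj (n + 1)) (1 : Ar)).comp (𝓗.barS n)

theorem firstS_barS (n : ℕ) (x : 𝓗.barObj n) : 𝓗.firstS n (𝓗.barS n x) = x := by
  change 𝓗.sr (𝓗.r.ε 1) • x = x
  rw [← map_one 𝓗.sr, εr_sr, map_one, one_smul]

theorem barToHochAux_hochToBar (n : ℕ) (x : 𝓗.hochX n) :
    𝓗.barToHochAux n (𝓗.hochToBar n x) = x := by
  cases n with
  | zero =>
    exact (congrArg 𝓗.r.ε (mul_one (𝓗.sr (show Ar from x)))).trans (𝓗.εr_sr (show Ar from x))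
  | succ n =>
    have h : 𝓗.sr 1 • 𝓗.barS n x = 𝓗.barS n x := by rw [map_one, one_smul]
    exact (congrArg (𝓗.firstFace (n + 1)) h).trans (𝓗.firstS_barS n x)

/-- `Aᵣ` is generated by `1` as a right `H`-module, with `sᵣ` choosing the multiplier; hence any
element `a` in the first tensor factor can be replaced by `1`. -/
theorem trivRight_act_one (a : Ar) : 𝓗.trivRight.act (op (𝓗.sr a)) (1 : Ar) = a := by
  rw [trivRight_act, map_one, one_mul, εr_sr]

theorem hochToBar_barToHochAux (n : ℕ) (x : 𝓗.trivRight.Ten (𝓗.barObj n)) :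
    𝓗.hochToBar n (𝓗.barToHochAux n x) = x := by
  have h : (𝓗.hochToBar n).comp (𝓗.barToHochAux n).hom.toAddMonoidHom =
      AddMonoidHom.id (𝓗.trivRight.Ten (𝓗.barObj n)) := by
    refine Tens.hom_ext fun a x => ?_
    cases n with
    | zero =>
      exact (𝓗.trivRight.tm_right a (show H from x) (1 : H)).trans
        (congrArg (𝓗.trivRight.tm (N := H) a) (mul_one (show H from x)))
    | succ n =>
      refine DFunLike.congr_fun (𝓗.ind_hom_ext (N := 𝓗.barObj n)
        (f := (𝓗.hochToBar (n + 1)).comp ((𝓗.barToHochAux (n + 1)).hom.toAddMonoidHom.comp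
          (𝓗.trivRight.tm (N := 𝓗.barObj (n + 1)) a)))
        (g := 𝓗.trivRight.tm (N := 𝓗.barObj (n + 1)) a) fun h y => ?_) x
      have h1 (b c : H) : 𝓗.trivRight.tm (N := 𝓗.Ind (𝓗.barObj n)) (1 : Ar)
          (b • 𝓗.itm (N := 𝓗.barObj n) c y) =
          𝓗.trivRight.tm (N := 𝓗.Ind (𝓗.barObj n)) (𝓗.trivRight.act (op b) (1 : Ar))
            (𝓗.itm (N := 𝓗.barObj n) c y) :=
        (𝓗.trivRight.tm_right (1 : Ar) b (𝓗.itm (N := 𝓗.barObj n) c y)).symm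
      -- `1 ⊗ 1 ⊗ sᵣ(c) y = 1 ⊗ sᵣ(c) ⊗ y = c ⊗ 1 ⊗ y`, moving `sᵣ(c)` across both tensor signs.
      -- With `c = a·h` the result is `(a·h) ⊗ 1 ⊗ y = a ⊗ h ⊗ y`.
      have h2 (c : Ar) : 𝓗.trivRight.tm (N := 𝓗.Ind (𝓗.barObj n)) (1 : Ar)
          (𝓗.itm (N := 𝓗.barObj n) 1 (𝓗.sr c • y)) =
          𝓗.trivRight.tm (N := 𝓗.Ind (𝓗.barObj n)) c (𝓗.itm (N := 𝓗.barObj n) 1 y) := by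
        rw [← itm_sr, one_mul, ← trivRight_act_one 𝓗 c, ← h1, smul_itm, mul_one,
          trivRight_act_one]
      refine (h2 (𝓗.r.ε (𝓗.sr a * h))).trans ?_
      refine (𝓗.trivRight.tm_right (N := 𝓗.Ind (𝓗.barObj n)) a h
        (𝓗.itm (N := 𝓗.barObj n) 1 y)).trans ?_
      rw [smul_itm, mul_one]
      rfl
  exact DFunLike.congr_fun h x

theorem barToHochAux_bijective (n : ℕ) : Function.Bijective (𝓗.barToHochAux n) :=
  ⟨Function.LeftInverse.injective (g := 𝓗.hochToBar n) (𝓗.hochToBar_barToHochAux n),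
    Function.RightInverse.surjective (g := 𝓗.hochToBar n) (𝓗.barToHochAux_hochToBar n)⟩

instance isIso_barToHoch : IsIso 𝓗.barToHoch := by
  have (n : ℕ) : IsIso (𝓗.barToHoch.f n) :=
    (ConcreteCategory.isIso_iff_bijective _).2 (𝓗.barToHochAux_bijective n)
  exact HomologicalComplex.Hom.isIso_of_components _

/-! ### The comparison isomorphism in homology -/

/-- The map on homology induced by a map from a projective resolution to the bar complex. -/
def comparison (P : ProjectiveResolution 𝓗.triv) (g : P.complex ⟶ 𝓗.bar) (n : ℕ) :
    𝓗.Tor n ⟶ 𝓗.HH n :=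
  (P.isoLeftDerivedObj 𝓗.trivRight.tensorFunctor n).hom ≫
    HomologicalComplex.homologyMap
      ((𝓗.trivRight.tensorFunctor.mapHomologicalComplex (ComplexShape.down ℕ)).map g ≫
        𝓗.barToHoch) n

/-- The right side does not involve `g` or `P`. The bar complex is itself a projective resolution
and `g` lifts the identity of `Aₗ`, so naturality of the left derived functor gives the equality. -/
theorem comparison_eq (hP : 𝓗.IsProj) (P : ProjectiveResolution 𝓗.triv) (g : P.complex ⟶ 𝓗.bar)
    (hg : g.f 0 ≫ 𝓗.aug = P.π.f 0) (n : ℕ) :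
    𝓗.comparison P g n =
      ((𝓗.barResolution hP).isoLeftDerivedObj 𝓗.trivRight.tensorFunctor n).hom ≫
        HomologicalComplex.homologyMap 𝓗.barToHoch n := by
  have h1 := ProjectiveResolution.isoLeftDerivedObj_hom_naturality (𝟙 _) P (𝓗.barResolution hP) g
    (by
      rw [barResolution_π]
      exact hg.trans (Category.comp_id _).symm)
    𝓗.trivRight.tensorFunctor n
  rw [CategoryTheory.Functor.map_id, Category.id_comp] at h1
  rw [comparison, h1, HomologicalComplex.homologyMap_comp]
  exact (Category.assoc _ _ _).symm

theorem exists_hom_bar (hP : 𝓗.IsProj) (P : ProjectiveResolution 𝓗.triv) :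
    ∃ g : P.complex ⟶ 𝓗.bar, g.f 0 ≫ 𝓗.aug = P.π.f 0 :=
  ⟨ProjectiveResolution.lift (𝟙 _) P (𝓗.barResolution hP), by
    rw [← 𝓗.barResolution_π hP]
    exact (ProjectiveResolution.lift_commutes_zero (𝟙 _) P (𝓗.barResolution hP)).trans
      (Category.comp_id _)⟩

/-- The isomorphism `HHₙ(H) ≅ Torₙ(Aᵣ, Aₗ)` defined by the bar resolution. -/
def homologyIso (hP : 𝓗.IsProj) (n : ℕ) : 𝓗.HH n ≅ 𝓗.Tor n :=
  ((𝓗.barResolution hP).isoLeftDerivedObj 𝓗.trivRight.tensorFunctor n ≪≫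
    (HomologicalComplex.homologyFunctor _ _ n).mapIso
      (@asIso _ _ _ _ 𝓗.barToHoch 𝓗.isIso_barToHoch)).symm

end HopfAlgebroid

end HopfAlgd

end

theorem theorem2p8 {k Al Ar H : Type u} [CommRing k] [Ring Al] [Algebra k Al] [Ring Ar]
    [Algebra k Ar] [Ring H] [Algebra k H] (𝓗 : HopfAlgd.HopfAlgebroid k Al Ar H) :
    (∀ [𝓗.l.IsFlat],
      ∃ e : ∀ n : ℕ, 𝓗.l.HH n ≅ 𝓗.l.Cotor n,
        ∀ I : InjectiveResolution 𝓗.l.base,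
          (∃ g : 𝓗.l.cobar ⟶ I.cocomplex, 𝓗.l.coaug ≫ g.f 0 = I.ι.f 0) ∧
          ∀ g : 𝓗.l.cobar ⟶ I.cocomplex, 𝓗.l.coaug ≫ g.f 0 = I.ι.f 0 →
            ∀ n : ℕ, (e n).hom =
              HomologicalComplex.homologyMap (𝓗.l.hochToCobar ≫
                ((HopfAlgd.Coring.cotensor 𝓗.l.baseRight).mapHomologicalComplex
                  (ComplexShape.up ℕ)).map g) n ≫
              (I.isoRightDerivedObj (HopfAlgd.Coring.cotensor 𝓗.l.baseRight) n).inv) ∧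
    (𝓗.IsProj →
      ∃ e : ∀ n : ℕ, 𝓗.HH n ≅ 𝓗.Tor n,
        ∀ P : ProjectiveResolution 𝓗.triv,
          (∃ g : P.complex ⟶ 𝓗.bar, g.f 0 ≫ 𝓗.aug = P.π.f 0) ∧
          ∀ g : P.complex ⟶ 𝓗.bar, g.f 0 ≫ 𝓗.aug = P.π.f 0 →
            ∀ n : ℕ, (e n).inv =
              (P.isoLeftDerivedObj 𝓗.trivRight.tensorFunctor n).hom ≫
              HomologicalComplex.homologyMap
                ((𝓗.trivRight.tensorFunctor.mapHomologicalComplex (ComplexShape.down ℕ)).map g ≫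
                  𝓗.barToHoch) n) := by
  refine ⟨fun {_} => ?_, fun hP => ⟨𝓗.homologyIso hP, fun P => ⟨𝓗.exists_hom_bar hP P,
    fun g hg n => (𝓗.comparison_eq hP P g hg n).symm⟩⟩⟩
  have hK := 𝓗.l.isCoresolution_cobar
  -- The isomorphism is defined by one chosen resolution and one chosen map; `comparison_eq` shows
  -- that every other choice gives the same map.
  let I₀ := injectiveResolution 𝓗.l.base
  obtain ⟨g₀, hg₀⟩ := hK.exists_hom I₀
  exact ⟨fun n => @asIso _ _ _ _ (𝓗.l.comparison I₀ g₀ n) (𝓗.l.isIso_comparison I₀ g₀ hg₀ n),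
    fun I => ⟨hK.exists_hom I, fun g hg n => 𝓗.l.comparison_eq I₀ I g₀ hg₀ g hg n⟩⟩
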